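/- Let $H^m=\mathbb R^{2m+1}$ be the Heisenberg group, with points $q=(x,y,t)$, $x,y\in\mathbb R^m$, $t\in\mathbb R$, and left-invariant fields $X_j=\partial_{x_j}+2y_j\partial_t$, $Y_j=\partial_{y_j}-2x_j\partial_t$ $(1\le j\le m)$. Write $\nabla_{H^m}u=\sum_j (X_ju)X_j+(Y_ju)Y_j$, $\nabla_{H^m}u\cdot\nabla_{H^m}v=\sum_j (X_ju\,X_jv+Y_ju\,Y_jv)$ and $|\nabla_{H^m}u|=(\nabla_{H^m}u\cdot\nabla_{H^m}u)^{1/2}$. Let $\varphi,f,h,g$ be real functions and $\tau\ge 0$, $\theta<2$ real numbers such that: - ($\Phi$) $\varphi\in C^0([0,\infty))\cap C^1((0,\infty))$, $\varphi(0)=0$, $\varphi'>0$ on $(0,\infty)$; - ($F$) $f\in C^0([0,\infty))$, $f>0$ on $(0,\infty)$, and $f$ is increasing (not necessarily strictly) on $[0,\infty)$; - ($H$) $h\in C^0((0,\infty))$, $h\ge0$, $h\in L^1(0^+)$, and $h$ is non-increasing on $(0,\infty)$; - ($\Phi0$) $t\varphi'(t)\in L^1(0^+)$; - ($\Phi2$)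 for some $D>0$: $s\varphi'(st)\le D s^{\tau}\varphi'(t)$ for all $s\in[0,1]$, $t>0$ (the left side being $0$ for $s=0$); - ($\Phi3$) for some $B>0$: $\varphi'(ts)\ge B\varphi'(t)s^{-\theta}$ for all $t>0$, $s\ge1$; - ($G$) $g$ is a non-negative measurable function on $[0,\infty)$ and, for some $\widetilde D>0$ and the same $\tau$ as in ($\Phi2$), $g(st)\le\widetilde D s^{\tau+1}t^2\varphi'(t)$ for all $s\in[0,1]$, $t>0$. Let $K(t)=\int_0^t s\varphi'(s)\,ds$, which is a bijection of $[0,\infty)$ onto itself, let $K^{-1}$ be its inverse, and let $\hat F(t)=\int_0^t f(s)\,e^{(2-\theta)\int_0^s h(x)\,dx}\,ds$, with $\theta$ as in ($\Phi3$). Assume the Keller–Osserman condition $$\frac{e^{\int_0^t h(x)\,dx}}{K^{-1}(\hat F(t))}\in L^1(+\infty).$$ Let $u\in C^1(H^m)$, $u\ge0$, be a weak solution of $\Delta^\varphi_{H^m}u\ge f(u)-h(u)g(|\nabla_{H^m}u|)$ on $H^m$, that is, for every $\zeta\in C_c^\infty(H^m)$, $\zeta\ge0$, $$-\int_{\mathbb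 R^{2m+1}}\frac{\varphi(|\nabla_{H^m}u|)}{|\nabla_{H^m}u|}\,\nabla_{H^m}u\cdot\nabla_{H^m}\zeta\ \ge\ \int_{\mathbb R^{2m+1}}\bigl(f(u)-h(u)g(|\nabla_{H^m}u|)\bigr)\zeta,$$ where the integrand on the left is $0$ where $\nabla_{H^m}u=0$, the product $h(u)g(|\nabla_{H^m}u|)$ is $0$ where $u=0$ (there $\nabla_{H^m}u=0$, and $g(0)=0$ by ($G$)), and the inequality is no condition on $\zeta$ if the right-hand integral is $-\infty$. Then $u\equiv0$. -/

import Mathlib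

namespace Heisenberg

/-- The underlying manifold `ℝ^(2m+1)` of the Heisenberg group `H^m`, with points
`q = (x, y, t)`; it carries the Lebesgue measure `MeasureTheory.volume`. -/
abbrev Point (m : ℕ) : Type := (Fin m → ℝ) × (Fin m → ℝ) × ℝ

/-- The left-invariant field `X_j = ∂/∂x_j + 2 y_j ∂/∂t`, acting on `u` at `q`. -/
noncomputable def X {m : ℕ} (j : Fin m) (u : Point m → ℝ) (q : Point m) : ℝ :=
  fderiv ℝ u q (Pi.single j 1, 0, 2 * q.2.1 j)

/-- The left-invariant field `Y_j = ∂/∂y_j - 2 x_j ∂/∂t`, acting on `u` at `q`. -/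
noncomputable def Y {m : ℕ} (j : Fin m) (u : Point m → ℝ) (q : Point m) : ℝ :=
  fderiv ℝ u q (0, Pi.single j 1, -2 * q.1 j)

/-- The product `∇_H u · ∇_H v = ∑_j (X_j u)(X_j v) + (Y_j u)(Y_j v)` of Heisenberg gradients. -/
noncomputable def gradDot {m : ℕ} (u v : Point m → ℝ) (q : Point m) : ℝ :=
  ∑ j : Fin m, (X j u q * X j v q + Y j u q * Y j v q)

/-- The length `|∇_H u|` of the Heisenberg gradient. -/
noncomputable def gradNorm {m : ℕ} (u : Point m → ℝ) (q : Point m) : ℝ :=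
  Real.sqrt (gradDot u u q)

/-- `u` satisfies `Δ^φ u ≥ f(u) - h(u) g(|∇_H u|)` on `H^m` in the weak sense:
`∫ (f(u) - h(u) g(|∇_H u|)) ζ ≤ -∫ |∇_H u|⁻¹ φ(|∇_H u|) ∇_H u · ∇_H ζ`
for all smooth compactly supported `ζ ≥ 0`.

For `u ∈ C¹` the functions `f(u) ζ` and `|∇_H u|⁻¹ φ(|∇_H u|) ∇_H u · ∇_H ζ` (zero where
`∇_H u = 0`) are continuous with compact support, and `h(u) g(|∇_H u|) ζ ≥ 0`.  So the left
integral can only fail to converge by being `-∞` (when `h` is unbounded near `0`), in which case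
the inequality is no condition. -/
def IsWeakSolution {m : ℕ} (φ f h g : ℝ → ℝ) (u : Point m → ℝ) : Prop :=
  ∀ ζ : Point m → ℝ, ContDiff ℝ (⊤ : ℕ∞) ζ → HasCompactSupport ζ → (∀ q, 0 ≤ ζ q) →
    MeasureTheory.Integrable
      (fun q => (f (u q) - h (u q) * g (gradNorm u q)) * ζ q) MeasureTheory.volume →
    ∫ q, (f (u q) - h (u q) * g (gradNorm u q)) * ζ q ≤
      -∫ q, (gradNorm u q)⁻¹ * φ (gradNorm u q) * gradDot u ζ q

/-- Condition (Φ): `φ ∈ C⁰([0,∞)) ∩ C¹((0,∞))`, `φ(0) = 0`, `φ' > 0` on `(0,∞)`. -/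
structure CondPhi (φ : ℝ → ℝ) : Prop where
  continuousOn : ContinuousOn φ (Set.Ici 0)
  contDiffOn : ContDiffOn ℝ 1 φ (Set.Ioi 0)
  map_zero : φ 0 = 0
  deriv_pos : ∀ t : ℝ, 0 < t → 0 < deriv φ t

/-- Condition (F): `f ∈ C⁰([0,∞))`, `f > 0` on `(0,∞)`, `f` increasing on `[0,∞)`
(not necessarily strictly). -/
structure CondF (f : ℝ → ℝ) : Prop where
  continuousOn : ContinuousOn f (Set.Ici 0)
  pos : ∀ t : ℝ, 0 < t → 0 < f t
  monotoneOn : MonotoneOn f (Set.Ici 0)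

/-- Condition (H): `h ∈ C⁰((0,∞))`, `h ≥ 0`, `h ∈ L¹(0⁺)`, `h` non-increasing. -/
structure CondH (h : ℝ → ℝ) : Prop where
  continuousOn : ContinuousOn h (Set.Ioi 0)
  nonneg : ∀ t : ℝ, 0 < t → 0 ≤ h t
  integrable : MeasureTheory.IntegrableAtFilter h (nhdsWithin 0 (Set.Ioi 0))
    MeasureTheory.volume
  antitoneOn : AntitoneOn h (Set.Ioi 0)

/-- Condition (Φ0): `t φ'(t) ∈ L¹(0⁺)`. -/
def CondPhi0 (φ : ℝ → ℝ) : Prop :=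
  MeasureTheory.IntegrableAtFilter (fun t => t * deriv φ t) (nhdsWithin 0 (Set.Ioi 0))
    MeasureTheory.volume

/-- Condition (Φ2) with exponent `τ ≥ 0`: for some `D > 0`,
`s φ'(s t) ≤ D s^τ φ'(t)` for `s ∈ [0,1]`, `t > 0` (at `s = 0` the left side is `0`). -/
def CondPhi2 (φ : ℝ → ℝ) (τ : ℝ) : Prop :=
  0 ≤ τ ∧ ∃ D : ℝ, 0 < D ∧ ∀ s : ℝ, 0 ≤ s → s ≤ 1 → ∀ t : ℝ, 0 < t →
    s * deriv φ (s * t) ≤ D * s ^ τ * deriv φ t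

/-- Condition (Φ3) with exponent `θ < 2`: for some `B > 0`,
`φ'(t s) ≥ B φ'(t) s^(-θ)` for `t > 0`, `s ≥ 1`. -/
def CondPhi3 (φ : ℝ → ℝ) (θ : ℝ) : Prop :=
  θ < 2 ∧ ∃ B : ℝ, 0 < B ∧ ∀ t : ℝ, 0 < t → ∀ s : ℝ, 1 ≤ s →
    B * deriv φ t * s ^ (-θ) ≤ deriv φ (t * s)

/-- Condition (G) with the exponent `τ` of (Φ2), for a non-negative measurable function `g` on
`[0,∞)`: for some `C > 0`, `g(s t) ≤ C s^(τ+1) t² φ'(t)` for `s ∈ [0,1]`, `t > 0`. -/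
structure CondG (φ g : ℝ → ℝ) (τ : ℝ) : Prop where
  measurable : Measurable (fun t : Set.Ici (0 : ℝ) => g t)
  nonneg : ∀ t : ℝ, 0 ≤ t → 0 ≤ g t
  bound : ∃ C : ℝ, 0 < C ∧ ∀ s : ℝ, 0 ≤ s → s ≤ 1 → ∀ t : ℝ, 0 < t →
    g (s * t) ≤ C * s ^ (τ + 1) * t ^ 2 * deriv φ t

/-- `K(t) = ∫_0^t s φ'(s) ds`. -/
noncomputable def K (φ : ℝ → ℝ) (t : ℝ) : ℝ := ∫ s in (0 : ℝ)..t, s * deriv φ s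

/-- The inverse `K⁻¹ : [0,∞) → [0,∞)` of `K` (under (Φ), (Φ0), (Φ3) `K` is a bijection of
`[0,∞)`). -/
noncomputable def KInv (φ : ℝ → ℝ) : ℝ → ℝ := Function.invFunOn (K φ) (Set.Ici 0)

/-- `F̂(t) = ∫_0^t f(s) exp((2-θ) ∫_0^s h) ds`. -/
noncomputable def FHat (f h : ℝ → ℝ) (θ t : ℝ) : ℝ :=
  ∫ s in (0 : ℝ)..t, f s * Real.exp ((2 - θ) * ∫ x in (0 : ℝ)..s, h x)

/-- The adapted Keller–Osserman condition: `exp(∫_0^t h) / K⁻¹(F̂(t)) ∈ L¹(+∞)`. -/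
def KellerOsserman (φ f h : ℝ → ℝ) (θ : ℝ) : Prop :=
  MeasureTheory.IntegrableAtFilter
    (fun t : ℝ => Real.exp (∫ x in (0 : ℝ)..t, h x) / KInv φ (FHat f h θ t))
    Filter.atTop MeasureTheory.volume

end Heisenberg

namespace Heisenberg

open MeasureTheory Set Filter Topology

/-! The proof is the Keller–Osserman argument: a radial supersolution that blows up on a gauge
sphere bounds `u` from above, and such barriers can be made as flat as desired up to any given
point.

Suppose `u q₀ > 0` and put `ε = u q₀ / 2`. Write `H` for the primitive of `h` and `r` for the
Koranyi gauge. The barrier is `v = α(r)`, where `α = ε` for `r ≤ 1` and afterwards `α' = l q(α)`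
with `q(s) = e^{-H(s)} K⁻¹(F̂(s) - F̂(ε))`. The factor `e^{-H}` makes the derivative of `q` absorb
the gradient term, since `q q' + h q² = e^{-2H} k k'` for `k = e^H q`. Condition (Φ3) compares `φ'`
at `q` and at `e^H q`, which turns this identity into a bound by `f`; the exponent `2 - θ` in `F̂`
is what makes the exponentials cancel (`exists_slope`). The Keller–Osserman condition makes `1/q`
integrable on `(ε, ∞)`, so the solution leaves the rest point `ε` and blows up after a finite time
(`exists_blowup`). The parameter `l` slows the solution: as `l → 0` the blow-up radius tends to
infinity, the barrier flattens on bounded sets, and every term of the operator becomes at most a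
small multiple `κ` of `f(α)` (`exists_profile`).

On the Heisenberg group, `|∇_H v| = p σ` with `p = α'(r)` and `σ = |z|/r` in `[0,1]`. The number `σ`
does not change along the horizontal gradient of the gauge, so the divergence of the flux is `φ'(pσ)
p' σ² + (2m+1) φ(pσ) σ / r`. Condition (Φ2) removes the degenerate factor `σ`, and for small `κ` one
gets `Δ^φ v ≤ ½ f(v) - C h(v) |∇_H v|² φ'(|∇_H v|)` weakly (`IsProfile.supersolution`). The flux may
fail to be `C¹` where `∇_H v = 0`, so it is first truncated near zero.

For the comparison, suppose that `u - v` has a positive maximum in a gauge ball on whose boundary `u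
< v`. At a maximum the horizontal gradients agree, `f(u) ≥ f(v)` and `h(u) ≤ h(v)`, so the source
for `u` exceeds that for `v` by at least `½ f(v) > 0`. The same strict sign holds on a superlevel
set `u - v > c`. Testing both inequalities with `((u - v - c)⁺)²` contradicts the monotonicity of
the flux (`IsProfile.le_of_isWeakSolution`). Hence `u ≤ v`, while `v q₀ < u q₀` by flatness. -/

/-! ### One-dimensional preliminaries -/

/-- If `f` is strictly increasing and continuous on `[a, ∞)`, its inverse is continuous at
interior values. -/
theorem continuousAt_invFunOn_Ici {f : ℝ → ℝ} {a : ℝ} (hmono : StrictMonoOn f (Ici a))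
    (hcont : ContinuousOn f (Ici a)) {x : ℝ} (hx : a < x) :
    ContinuousAt (Function.invFunOn f (Ici a)) (f x) := by
  have hleft : ∀ z ∈ Ici a, Function.invFunOn f (Ici a) (f z) = z :=
    fun z hz => hmono.injOn.leftInvOn_invFunOn hz
  rw [Metric.continuousAt_iff]
  intro ε hε
  obtain ⟨l, hl1, hl2⟩ : ∃ l, max a (x - ε) < l ∧ l < x := exists_between (max_lt hx (by linarith))
  have hal : a < l := lt_of_le_of_lt (le_max_left _ _) hl1
  have hxl : x - ε < l := lt_of_le_of_lt (le_max_right _ _) hl1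
  obtain ⟨r, hr1, hr2⟩ : ∃ r, x < r ∧ r < x + ε := exists_between (by linarith)
  have h1 : f l < f x := hmono hal.le hx.le hl2
  have h2 : f x < f r := hmono hx.le (hx.trans hr1).le hr1
  refine ⟨min (f x - f l) (f r - f x), lt_min (by linarith) (by linarith), fun y hy => ?_⟩
  rw [Real.dist_eq, abs_lt] at hy
  have hy1 : f l ≤ y := by linarith [hy.1, min_le_left (f x - f l) (f r - f x)]
  have hy2 : y ≤ f r := by linarith [hy.2, min_le_right (f x - f l) (f r - f x)]
  obtain ⟨z, hz, rfl⟩ := intermediate_value_Icc (hl2.trans hr1).le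
    (hcont.mono (fun z hz => hal.le.trans hz.1)) ⟨hy1, hy2⟩
  rw [hleft z (hal.le.trans hz.1), hleft x hx.le, Real.dist_eq, abs_lt]
  constructor <;> linarith [hz.1, hz.2]

theorem continuousWithinAt_invFunOn_Ici {f : ℝ → ℝ} {a : ℝ} (hmono : StrictMonoOn f (Ici a))
    (hcont : ContinuousOn f (Ici a)) :
    ContinuousWithinAt (Function.invFunOn f (Ici a)) (Ici (f a)) (f a) := by
  have hleft : ∀ z ∈ Ici a, Function.invFunOn f (Ici a) (f z) = z :=
    fun z hz => hmono.injOn.leftInvOn_invFunOn hz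
  rw [Metric.continuousWithinAt_iff]
  intro ε hε
  obtain ⟨r, hr1, hr2⟩ : ∃ r, a < r ∧ r < a + ε := exists_between (by linarith)
  have h2 : f a < f r := hmono self_mem_Ici hr1.le hr1
  refine ⟨f r - f a, by linarith, fun y hya hy => ?_⟩
  rw [Real.dist_eq, abs_lt] at hy
  obtain ⟨z, hz, rfl⟩ := intermediate_value_Icc hr1.le
    (hcont.mono (fun z hz => hz.1)) ⟨hya, by linarith [hy.2]⟩
  rw [hleft z hz.1, hleft a self_mem_Ici, Real.dist_eq, abs_lt]
  constructor <;> linarith [hz.1, hz.2]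

theorem hasDerivAt_invFunOn_Ici {f : ℝ → ℝ} {a : ℝ} (hmono : StrictMonoOn f (Ici a))
    (hcont : ContinuousOn f (Ici a)) {x f' : ℝ} (hx : a < x) (hf : HasDerivAt f f' x)
    (hf' : f' ≠ 0) : HasDerivAt (Function.invFunOn f (Ici a)) f'⁻¹ (f x) := by
  have hleft : ∀ z ∈ Ici a, Function.invFunOn f (Ici a) (f z) = z :=
    fun z hz => hmono.injOn.leftInvOn_invFunOn hz
  refine HasDerivAt.of_local_left_inverse (continuousAt_invFunOn_Ici hmono hcont hx)
    (by rwa [hleft x hx.le]) hf' ?_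
  have h1 : f a < f x := hmono self_mem_Ici hx.le hx
  have h2 : f x < f (x + 1) := hmono hx.le (by simp; linarith) (by linarith)
  filter_upwards [Ioo_mem_nhds h1 h2] with y hy
  obtain ⟨z, hz, rfl⟩ := intermediate_value_Icc (by linarith : a ≤ x + 1)
    (hcont.mono (fun z hz => hz.1)) ⟨hy.1.le, hy.2.le⟩
  rw [hleft z hz.1]

/-- A function continuous on `(0, ∞)` and integrable at `0⁺` is integrable on `[0, t]`. -/
theorem intervalIntegrable_of_integrableAtFilter {k : ℝ → ℝ} (hc : ContinuousOn k (Ioi 0))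
    (hi : IntegrableAtFilter k (𝓝[>] 0) volume) {t : ℝ} (ht : 0 ≤ t) :
    IntervalIntegrable k volume 0 t := by
  obtain ⟨s, hs, hks⟩ := hi
  obtain ⟨b, hb, hbs⟩ := (mem_nhdsGT_iff_exists_Ioc_subset).1 hs
  have h1 : IntervalIntegrable k volume 0 b := by
    rw [intervalIntegrable_iff_integrableOn_Ioc_of_le (le_of_lt hb)]
    exact hks.mono_set hbs
  rcases ht.eq_or_lt with rfl | ht
  · exact IntervalIntegrable.refl
  refine h1.trans (ContinuousOn.intervalIntegrable (hc.mono ?_))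
  intro x hx
  exact lt_of_lt_of_le (lt_min hb ht) hx.1

theorem continuousOn_primitive_Ici {k : ℝ → ℝ} {a : ℝ}
    (hi : ∀ t, a ≤ t → IntervalIntegrable k volume a t) :
    ContinuousOn (fun t => ∫ x in a..t, k x) (Ici a) := by
  intro t ht
  have h0 : a ≤ t + 1 := by have : a ≤ t := ht; linarith
  have h := intervalIntegral.continuousOn_primitive_interval (μ := volume) (f := k) (a := a)
    (b := t + 1)
    (by rw [uIcc_of_le h0, integrableOn_Icc_iff_integrableOn_Ioc]
        exact (intervalIntegrable_iff_integrableOn_Ioc_of_le h0).1 (hi _ h0))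
  rw [uIcc_of_le h0] at h
  refine (h t ⟨ht, by linarith⟩).mono_of_mem_nhdsWithin ?_
  rw [← Ici_inter_Iic]
  exact inter_mem self_mem_nhdsWithin (mem_nhdsWithin_of_mem_nhds (Iic_mem_nhds (by linarith)))

theorem hasDerivAt_primitive_Ioi {k : ℝ → ℝ} {a : ℝ} (hc : ContinuousOn k (Ioi a))
    (hi : ∀ t, a ≤ t → IntervalIntegrable k volume a t) {t : ℝ} (ht : a < t) :
    HasDerivAt (fun t => ∫ x in a..t, k x) (k t) t :=
  intervalIntegral.integral_hasDerivAt_right (hi t ht.le)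
    (hc.stronglyMeasurableAtFilter isOpen_Ioi t ht) (hc.continuousAt (Ioi_mem_nhds ht))

/-- Comparison of increments from comparison of derivatives. -/
theorem sub_le_sub_of_hasDerivAt_le {F G F' G' : ℝ → ℝ} {a b : ℝ} (hab : a ≤ b)
    (hF : ContinuousOn F (Icc a b)) (hG : ContinuousOn G (Icc a b))
    (hF' : ∀ x ∈ Ioo a b, HasDerivAt F (F' x) x) (hG' : ∀ x ∈ Ioo a b, HasDerivAt G (G' x) x)
    (hle : ∀ x ∈ Ioo a b, F' x ≤ G' x) : F b - F a ≤ G b - G a := by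
  have h : MonotoneOn (fun x => G x - F x) (Icc a b) := by
    refine monotoneOn_of_deriv_nonneg (convex_Icc a b) (hG.sub hF) ?_ ?_
    · rw [interior_Icc]
      exact fun x hx => ((hG' x hx).sub (hF' x hx)).differentiableAt.differentiableWithinAt
    · rw [interior_Icc]
      intro x hx
      have := ((hG' x hx).sub (hF' x hx)).deriv
      rw [show (fun x => G x - F x) = G - F from rfl, this]
      linarith [hle x hx]
  have := h (left_mem_Icc.2 hab) (right_mem_Icc.2 hab) hab
  simp only at this
  linarith

/-! ### The functions `φ` and `K` -/

theorem CondPhi.continuousOn_deriv {φ : ℝ → ℝ} (hφ : CondPhi φ) :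
    ContinuousOn (deriv φ) (Ioi 0) :=
  hφ.contDiffOn.continuousOn_deriv_of_isOpen isOpen_Ioi le_rfl

theorem CondPhi.hasDerivAt {φ : ℝ → ℝ} (hφ : CondPhi φ) {t : ℝ} (ht : 0 < t) :
    HasDerivAt φ (deriv φ t) t :=
  ((hφ.contDiffOn.differentiableOn one_ne_zero).differentiableAt (Ioi_mem_nhds ht)).hasDerivAt

theorem CondPhi.strictMonoOn {φ : ℝ → ℝ} (hφ : CondPhi φ) : StrictMonoOn φ (Ici 0) :=
  strictMonoOn_of_deriv_pos (convex_Ici 0) hφ.continuousOn (by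
    rw [interior_Ici]; exact fun x hx => hφ.deriv_pos x hx)

theorem CondPhi.nonneg {φ : ℝ → ℝ} (hφ : CondPhi φ) {t : ℝ} (ht : 0 ≤ t) : 0 ≤ φ t := by
  rw [← hφ.map_zero]
  exact hφ.strictMonoOn.monotoneOn self_mem_Ici ht ht

theorem CondPhi.continuousOn_mul_deriv {φ : ℝ → ℝ} (hφ : CondPhi φ) :
    ContinuousOn (fun t => t * deriv φ t) (Ioi 0) :=
  continuousOn_id.mul hφ.continuousOn_deriv

theorem CondPhi0.intervalIntegrable {φ : ℝ → ℝ} (hφ0 : CondPhi0 φ) (hφ : CondPhi φ) (t : ℝ)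
    (ht : 0 ≤ t) : IntervalIntegrable (fun t => t * deriv φ t) volume 0 t :=
  intervalIntegrable_of_integrableAtFilter hφ.continuousOn_mul_deriv hφ0 ht

theorem continuousOn_K {φ : ℝ → ℝ} (hφ : CondPhi φ) (hφ0 : CondPhi0 φ) :
    ContinuousOn (K φ) (Ici 0) :=
  continuousOn_primitive_Ici (hφ0.intervalIntegrable hφ)

theorem hasDerivAt_K {φ : ℝ → ℝ} (hφ : CondPhi φ) (hφ0 : CondPhi0 φ) {t : ℝ} (ht : 0 < t) :
    HasDerivAt (K φ) (t * deriv φ t) t :=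
  hasDerivAt_primitive_Ioi hφ.continuousOn_mul_deriv (hφ0.intervalIntegrable hφ) ht

theorem K_zero (φ : ℝ → ℝ) : K φ 0 = 0 := by simp [K]

theorem strictMonoOn_K {φ : ℝ → ℝ} (hφ : CondPhi φ) (hφ0 : CondPhi0 φ) :
    StrictMonoOn (K φ) (Ici 0) :=
  strictMonoOn_of_deriv_pos (convex_Ici 0) (continuousOn_K hφ hφ0) (by
    rw [interior_Ici]
    intro x hx
    rw [(hasDerivAt_K hφ hφ0 hx).deriv]
    exact mul_pos hx (hφ.deriv_pos x hx))

theorem K_nonneg {φ : ℝ → ℝ} (hφ : CondPhi φ) (hφ0 : CondPhi0 φ) {t : ℝ} (ht : 0 ≤ t) :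
    0 ≤ K φ t := by
  rw [← K_zero φ]
  exact (strictMonoOn_K hφ hφ0).monotoneOn self_mem_Ici ht ht

/-- The derivative of `t ↦ K(l t)` is `l² t φ'(l t)`, and (Φ3) bounds it below by `B l^(2-θ)` times
the derivative of `K`. Since `θ < 2`, this is a power growth of `K` under dilations. -/
theorem le_K_mul {φ : ℝ → ℝ} {θ B : ℝ} (hφ : CondPhi φ) (hφ0 : CondPhi0 φ)
    (hB : ∀ t : ℝ, 0 < t → ∀ s : ℝ, 1 ≤ s → B * deriv φ t * s ^ (-θ) ≤ deriv φ (t * s))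
    {l t : ℝ} (hl : 1 ≤ l) (ht : 0 ≤ t) : B * l ^ (2 - θ) * K φ t ≤ K φ (l * t) := by
  have hl0 : 0 < l := by linarith
  have hKc : ContinuousOn (fun t => K φ (l * t)) (Ici 0) :=
    (continuousOn_K hφ hφ0).comp (by fun_prop) (fun x hx => mul_nonneg hl0.le hx)
  have := sub_le_sub_of_hasDerivAt_le (F := fun t => B * l ^ (2 - θ) * K φ t)
    (G := fun t => K φ (l * t)) (F' := fun t => B * l ^ (2 - θ) * (t * deriv φ t))
    (G' := fun t => (l * t * deriv φ (l * t)) * l) ht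
    ((continuousOn_const.mul (continuousOn_K hφ hφ0)).mono (fun x hx => hx.1))
    (hKc.mono (fun x hx => hx.1))
    (fun x hx => (hasDerivAt_K hφ hφ0 hx.1).const_mul _)
    (fun x hx => by
      have h1 := hasDerivAt_K hφ hφ0 (mul_pos hl0 hx.1)
      exact HasDerivAt.comp x h1 (by simpa using (hasDerivAt_id x).const_mul l))
    (fun x hx => by
      have h1 := hB x hx.1 l hl
      have h2 : l ^ (2 - θ) = l * l * l ^ (-θ) := by
        rw [show (2 - θ) = 1 + 1 + -θ by ring, Real.rpow_add hl0, Real.rpow_add hl0, Real.rpow_one]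
      rw [h2, mul_comm l x]
      have h3 : 0 ≤ l * l * x := by have := hx.1; positivity
      nlinarith [mul_le_mul_of_nonneg_left h1 h3])
  simpa [K_zero] using this

/-- The dilation estimate `le_K_mul` makes `K` unbounded, and the intermediate value theorem does
the rest. This gives meaning to `KInv` on all of `[0,∞)`. -/
theorem exists_K_eq {φ : ℝ → ℝ} {θ B : ℝ} (hφ : CondPhi φ) (hφ0 : CondPhi0 φ) (hθ : θ < 2)
    (hBpos : 0 < B)
    (hB : ∀ t : ℝ, 0 < t → ∀ s : ℝ, 1 ≤ s → B * deriv φ t * s ^ (-θ) ≤ deriv φ (t * s))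
    {y : ℝ} (hy : 0 ≤ y) : ∃ t, 0 ≤ t ∧ K φ t = y := by
  have hK1 : 0 < K φ 1 := by
    rw [← K_zero φ]; exact strictMonoOn_K hφ hφ0 self_mem_Ici (by simp) one_pos
  have htop : Tendsto (fun l : ℝ => l ^ (2 - θ)) atTop atTop :=
    tendsto_rpow_atTop (by linarith)
  obtain ⟨l, hl1, hl⟩ := ((htop.eventually_ge_atTop (y / (B * K φ 1))).and
    (eventually_ge_atTop 1)).exists
  have h1 := le_K_mul hφ hφ0 hB hl zero_le_one
  have h2 : y ≤ K φ (l * 1) := by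
    rw [div_le_iff₀ (by positivity)] at hl1
    nlinarith
  rw [mul_one] at h2
  obtain ⟨z, hz, hzy⟩ := intermediate_value_Icc (by linarith : (0 : ℝ) ≤ l)
    ((continuousOn_K hφ hφ0).mono (fun z hz => hz.1)) ⟨by rwa [K_zero], h2⟩
  exact ⟨z, hz.1, hzy⟩

/-- The quantity `t² φ'(l t)` is controlled by `K(t)` for `l ≤ 1/2`. -/
theorem exists_sq_mul_deriv_le {φ : ℝ → ℝ} {θ B : ℝ} (hφ : CondPhi φ) (hφ0 : CondPhi0 φ)
    (hBpos : 0 < B)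
    (hB : ∀ t : ℝ, 0 < t → ∀ s : ℝ, 1 ≤ s → B * deriv φ t * s ^ (-θ) ≤ deriv φ (t * s)) :
    ∃ C : ℝ, 0 < C ∧ ∀ l t : ℝ, 0 < l → l ≤ 1 / 2 → 0 < t →
      (l * t) ^ 2 * deriv φ (l * t) ≤ C * l ^ (2 - θ) * K φ t := by
  -- A lower bound for `x^(-θ)` on `[1/2, 1]` that serves both signs of `θ`.
  set c : ℝ := min 1 (2 ^ θ) with hc
  have hcpos : 0 < c := lt_min one_pos (Real.rpow_pos_of_pos two_pos _)
  refine ⟨4 / (B * c), by positivity, fun l t hl hl2 ht => ?_⟩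
  have hlt : 0 < l * t := mul_pos hl ht
  have hd : 0 < deriv φ (l * t) := hφ.deriv_pos _ hlt
  have hxc : ∀ x : ℝ, 1 / 2 ≤ x → x ≤ 1 → c ≤ x ^ (-θ) := by
    intro x hx1 hx2
    have hx0 : 0 < x := by linarith
    rcases le_total 0 θ with h | h
    · exact (min_le_left _ _).trans
        (Real.one_le_rpow_of_pos_of_le_one_of_nonpos hx0 hx2 (by linarith))
    · refine (min_le_right _ _).trans ?_
      calc (2 : ℝ) ^ θ = (1 / 2 : ℝ) ^ (-θ) := by
            rw [one_div, Real.inv_rpow two_pos.le, Real.rpow_neg two_pos.le, inv_inv]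
        _ ≤ x ^ (-θ) := Real.rpow_le_rpow (by norm_num) hx1 (by linarith)
  -- Only the part of `K(t)` over `[t/2, t]` is kept. There `s / (l t) ≥ 1` because `l ≤ 1/2`, so
  -- (Φ3) applies from `l t` up to `s`.
  have key : ∀ s ∈ Ioo (t / 2) t,
      (t / 2) * (B * deriv φ (l * t) * (c * l ^ θ)) ≤ s * deriv φ s := by
    intro s hs
    have hs0 : 0 < s := by linarith [hs.1]
    have h1 := hB (l * t) hlt (s / (l * t)) (by
      rw [le_div_iff₀ hlt]; nlinarith [hs.1])
    rw [mul_div_cancel₀ _ hlt.ne'] at h1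
    have h2 : c * l ^ θ ≤ (s / (l * t)) ^ (-θ) := by
      have : s / (l * t) = (s / t) / l := by field_simp
      rw [this, Real.div_rpow (by positivity) hl.le, Real.rpow_neg hl.le θ, div_inv_eq_mul]
      refine mul_le_mul_of_nonneg_right (hxc _ ?_ ?_) (Real.rpow_nonneg hl.le _)
      · rw [le_div_iff₀ ht]; linarith [hs.1]
      · rw [div_le_one ht]; exact hs.2.le
    have h3 : B * deriv φ (l * t) * (c * l ^ θ) ≤ deriv φ s :=
      (mul_le_mul_of_nonneg_left h2 (by positivity)).trans h1
    exact mul_le_mul hs.1.le h3 (by positivity) hs0.le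
  have h1 := sub_le_sub_of_hasDerivAt_le
    (F := fun s => (t / 2) * (B * deriv φ (l * t) * (c * l ^ θ)) * s) (G := K φ)
    (F' := fun _ => (t / 2) * (B * deriv φ (l * t) * (c * l ^ θ)))
    (G' := fun s => s * deriv φ s) (by linarith : t / 2 ≤ t) (by fun_prop)
    ((continuousOn_K hφ hφ0).mono (fun x hx => by
      have h1 := hx.1; simp only [mem_Ici]; linarith))
    (fun x _ => by simpa using (hasDerivAt_id x).const_mul _)
    (fun x hx => hasDerivAt_K hφ hφ0 (by linarith [hx.1])) key
  have h2 : 0 ≤ K φ (t / 2) := K_nonneg hφ hφ0 (by linarith)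
  have h3 : l ^ (2 - θ) * l ^ θ = l ^ 2 := by
    rw [← Real.rpow_add hl]; norm_num
  have h4 : 0 < l ^ (2 - θ) := Real.rpow_pos_of_pos hl _
  have h5 : (t / 2) * (B * deriv φ (l * t) * (c * l ^ θ)) * (t / 2) ≤ K φ t := by
    linarith
  have h6 := mul_le_mul_of_nonneg_left h5 (by positivity : 0 ≤ 4 / (B * c) * l ^ (2 - θ))
  refine le_trans (le_of_eq ?_) h6
  calc (l * t) ^ 2 * deriv φ (l * t) = l ^ 2 * (t ^ 2 * deriv φ (l * t)) := by ring
    _ = l ^ (2 - θ) * l ^ θ * (t ^ 2 * deriv φ (l * t)) := by rw [h3]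
    _ = _ := by field_simp; ring

theorem KInv_K {φ : ℝ → ℝ} (hφ : CondPhi φ) (hφ0 : CondPhi0 φ) {t : ℝ} (ht : 0 ≤ t) :
    KInv φ (K φ t) = t :=
  (strictMonoOn_K hφ hφ0).injOn.leftInvOn_invFunOn ht

/-! ### The weight `exp(a ∫ h)` and the function `F̂`. -/

theorem CondH.continuousOn_exp {h : ℝ → ℝ} (hh : CondH h) (a : ℝ) :
    ContinuousOn (fun t => Real.exp (a * ∫ x in (0 : ℝ)..t, h x)) (Ici 0) :=
  Real.continuous_exp.comp_continuousOn (continuousOn_const.mul (continuousOn_primitive_Ici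
    (fun _ => intervalIntegrable_of_integrableAtFilter hh.continuousOn hh.integrable)))

theorem CondH.hasDerivAt {h : ℝ → ℝ} (hh : CondH h) {t : ℝ} (ht : 0 < t) :
    HasDerivAt (fun t => ∫ x in (0 : ℝ)..t, h x) (h t) t :=
  hasDerivAt_primitive_Ioi hh.continuousOn
    (fun _ => intervalIntegrable_of_integrableAtFilter hh.continuousOn hh.integrable) ht

theorem CondH.primitive_nonneg {h : ℝ → ℝ} (hh : CondH h) {t : ℝ} (ht : 0 ≤ t) :
    0 ≤ ∫ x in (0 : ℝ)..t, h x := by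
  have hc := continuousOn_primitive_Ici (k := h)
    (fun _ => intervalIntegrable_of_integrableAtFilter hh.continuousOn hh.integrable)
  have := sub_le_sub_of_hasDerivAt_le (F := fun _ => (0 : ℝ)) (F' := fun _ => 0) ht
    continuousOn_const (hc.mono (fun x hx => hx.1)) (fun x _ => hasDerivAt_const x 0)
    (fun x hx => hh.hasDerivAt hx.1) (fun x hx => hh.nonneg x hx.1)
  simpa using this

theorem continuousOn_FHat_integrand {f h : ℝ → ℝ} (hf : CondF f) (hh : CondH h) (θ : ℝ) :
    ContinuousOn (fun s => f s * Real.exp ((2 - θ) * ∫ x in (0 : ℝ)..s, h x)) (Ici 0) :=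
  hf.continuousOn.mul (hh.continuousOn_exp _)

theorem intervalIntegrable_FHat_integrand {f h : ℝ → ℝ} (hf : CondF f) (hh : CondH h) (θ t : ℝ)
    (ht : 0 ≤ t) :
    IntervalIntegrable (fun s => f s * Real.exp ((2 - θ) * ∫ x in (0 : ℝ)..s, h x)) volume 0 t :=
  ContinuousOn.intervalIntegrable ((continuousOn_FHat_integrand hf hh θ).mono (by
    rw [uIcc_of_le ht]; exact fun x hx => hx.1))

theorem continuousOn_FHat {f h : ℝ → ℝ} (hf : CondF f) (hh : CondH h) (θ : ℝ) :
    ContinuousOn (FHat f h θ) (Ici 0) :=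
  continuousOn_primitive_Ici (intervalIntegrable_FHat_integrand hf hh θ)

theorem hasDerivAt_FHat {f h : ℝ → ℝ} (hf : CondF f) (hh : CondH h) (θ : ℝ) {t : ℝ}
    (ht : 0 < t) :
    HasDerivAt (FHat f h θ) (f t * Real.exp ((2 - θ) * ∫ x in (0 : ℝ)..t, h x)) t :=
  hasDerivAt_primitive_Ioi ((continuousOn_FHat_integrand hf hh θ).mono Ioi_subset_Ici_self)
    (intervalIntegrable_FHat_integrand hf hh θ) ht

theorem CondF.nonneg {f : ℝ → ℝ} (hf : CondF f) {t : ℝ} (ht : 0 ≤ t) : 0 ≤ f t := by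
  rcases ht.eq_or_lt with rfl | ht
  · have h1 : Tendsto f (𝓝[>] 0) (𝓝 (f 0)) :=
      (hf.continuousOn 0 self_mem_Ici).mono_left (nhdsWithin_mono _ Ioi_subset_Ici_self)
    exact ge_of_tendsto h1 (eventually_nhdsWithin_of_forall fun x hx => (hf.pos x hx).le)
  · exact (hf.pos t ht).le

theorem strictMonoOn_FHat {f h : ℝ → ℝ} (hf : CondF f) (hh : CondH h) (θ : ℝ) :
    StrictMonoOn (FHat f h θ) (Ici 0) :=
  strictMonoOn_of_deriv_pos (convex_Ici 0) (continuousOn_FHat hf hh θ) (by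
    rw [interior_Ici]
    intro x hx
    rw [(hasDerivAt_FHat hf hh θ hx).deriv]
    exact mul_pos (hf.pos x hx) (Real.exp_pos _))

theorem FHat_zero (f h : ℝ → ℝ) (θ : ℝ) : FHat f h θ 0 = 0 := by simp [FHat]

/-- For `s ≤ t`, the monotonicity of `h` and of `f` gives `h(t) f(s) ≤ h(s) f(t)`. After this
exchange `h(s) e^{(2-θ)H(s)}`, with `H` the primitive of `h`, is an exact derivative up to the
factor `2 - θ`. -/
theorem mul_FHat_sub_le {f h : ℝ → ℝ} {θ : ℝ} (hf : CondF f) (hh : CondH h) (hθ : θ < 2)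
    {ε t : ℝ} (hε : 0 < ε) (ht : ε ≤ t) :
    h t * (FHat f h θ t - FHat f h θ ε) ≤
      f t * Real.exp ((2 - θ) * ∫ x in (0 : ℝ)..t, h x) / (2 - θ) := by
  have hθ' : 0 < 2 - θ := by linarith
  have ht0 : 0 < t := hε.trans_le ht
  have hsub : Icc ε t ⊆ Ici 0 := fun x hx => hε.le.trans hx.1
  have := sub_le_sub_of_hasDerivAt_le (F := fun s => h t * FHat f h θ s)
    (G := fun s => f t / (2 - θ) * Real.exp ((2 - θ) * ∫ x in (0 : ℝ)..s, h x))
    (F' := fun s => h t * (f s * Real.exp ((2 - θ) * ∫ x in (0 : ℝ)..s, h x)))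
    (G' := fun s => f t / (2 - θ) *
      (Real.exp ((2 - θ) * ∫ x in (0 : ℝ)..s, h x) * ((2 - θ) * h s))) ht
    (continuousOn_const.mul ((continuousOn_FHat hf hh θ).mono hsub))
    (continuousOn_const.mul ((hh.continuousOn_exp _).mono hsub))
    (fun x hx => (hasDerivAt_FHat hf hh θ (hε.trans hx.1)).const_mul _)
    (fun x hx => (((hh.hasDerivAt (hε.trans hx.1)).const_mul _).exp).const_mul _)
    (fun x hx => by
      have hx0 : 0 < x := hε.trans hx.1
      have h1 : h t ≤ h x := hh.antitoneOn hx0 ht0 hx.2.le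
      have h2 : f x ≤ f t := hf.monotoneOn hx0.le ht0.le hx.2.le
      have h3 := mul_le_mul h1 h2 (hf.pos x hx0).le (hh.nonneg x hx0)
      have h4 := Real.exp_pos ((2 - θ) * ∫ x in (0 : ℝ)..x, h x)
      calc h t * (f x * Real.exp ((2 - θ) * ∫ x in (0 : ℝ)..x, h x))
          = (h t * f x) * Real.exp ((2 - θ) * ∫ x in (0 : ℝ)..x, h x) := by ring
        _ ≤ (h x * f t) * Real.exp ((2 - θ) * ∫ x in (0 : ℝ)..x, h x) :=
          mul_le_mul_of_nonneg_right h3 h4.le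
        _ = _ := by field_simp)
  have h5 : 0 ≤ f t / (2 - θ) * Real.exp ((2 - θ) * ∫ x in (0 : ℝ)..ε, h x) := by
    have := hf.pos t ht0; positivity
  calc _ ≤ f t / (2 - θ) * Real.exp ((2 - θ) * ∫ x in (0 : ℝ)..t, h x) := by
        linarith
    _ = _ := by ring

/-! ### The one-dimensional barrier: slope, finite-time blow-up, radial profile. -/

/-- The slope `q` of the Keller-Osserman barrier as a function of its height, together with the
differential inequalities it satisfies. -/
theorem exists_slope {φ f h : ℝ → ℝ} {τ θ ε : ℝ} (hφ : CondPhi φ) (hf : CondF f) (hh : CondH h)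
    (hφ0 : CondPhi0 φ) (hφ2 : CondPhi2 φ τ) (hφ3 : CondPhi3 φ θ)
    (hKO : KellerOsserman φ f h θ) (hε : 0 < ε) :
    ∃ q q' : ℝ → ℝ, ContinuousOn q (Ici ε) ∧ q ε = 0 ∧ (∀ s, ε < s → 0 < q s) ∧
      (∀ s, ε < s → HasDerivAt q (q' s) s) ∧ ContinuousOn q' (Ioi ε) ∧
      IntegrableOn (fun s => (q s)⁻¹) (Ioi ε) volume ∧
      ∃ C : ℝ, 0 < C ∧ ∀ l : ℝ, 0 < l → l ≤ 1 / 2 → ∀ s, ε < s →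
        deriv φ (l * q s) * (l ^ 2 * (q s * q' s + h s * q s ^ 2)) ≤ C * l * f s ∧
        h s * ((l * q s) ^ 2 * deriv φ (l * q s)) ≤ C * l ^ (2 - θ) * f s := by
  obtain ⟨hτ, D, hDpos, hD⟩ := hφ2
  obtain ⟨hθ, B, hBpos, hB⟩ := hφ3
  obtain ⟨C₁, hC₁, hC⟩ := exists_sq_mul_deriv_le hφ hφ0 hBpos hB
  have hθ' : 0 < 2 - θ := by linarith
  set H : ℝ → ℝ := fun t => ∫ x in (0 : ℝ)..t, h x with hH
  set k : ℝ → ℝ := fun s => KInv φ (FHat f h θ s - FHat f h θ ε) with hk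
  have hFpos : ∀ s, ε < s → 0 < FHat f h θ s - FHat f h θ ε := fun s hs =>
    sub_pos.2 (strictMonoOn_FHat hf hh θ hε.le (hε.trans hs).le hs)
  have hkK : ∀ s, ε < s → 0 < k s ∧ K φ (k s) = FHat f h θ s - FHat f h θ ε := by
    intro s hs
    obtain ⟨t, ht, hKt⟩ := exists_K_eq hφ hφ0 hθ hBpos hB (hFpos s hs).le
    have : k s = t := by simp only [hk, ← hKt]; exact KInv_K hφ hφ0 ht
    rw [this]
    refine ⟨lt_of_le_of_ne ht ?_, hKt⟩
    rintro rfl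
    rw [K_zero] at hKt
    exact (hFpos s hs).ne hKt
  have hkε : k ε = 0 := by
    simp only [hk, sub_self]
    exact (congrArg _ (K_zero φ).symm).trans (KInv_K hφ hφ0 le_rfl)
  set F' : ℝ → ℝ := fun t => f t * Real.exp ((2 - θ) * H t) with hF'
  set k' : ℝ → ℝ := fun s => (k s * deriv φ (k s))⁻¹ * F' s with hk'
  have hkd : ∀ s, ε < s → HasDerivAt k (k' s) s := by
    intro s hs
    obtain ⟨h1, h2⟩ := hkK s hs
    have h3 := hasDerivAt_invFunOn_Ici (strictMonoOn_K hφ hφ0) (continuousOn_K hφ hφ0) h1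
      (hasDerivAt_K hφ hφ0 h1) (mul_pos h1 (hφ.deriv_pos _ h1)).ne'
    rw [h2] at h3
    exact HasDerivAt.comp s (h₂ := KInv φ) h3
      ((hasDerivAt_FHat hf hh θ (hε.trans hs)).sub_const _)
  have hkc : ContinuousOn k (Ici ε) := by
    intro s hs
    rcases (show ε ≤ s from hs).eq_or_lt with rfl | hs
    · have h1 := continuousWithinAt_invFunOn_Ici (strictMonoOn_K hφ hφ0) (continuousOn_K hφ hφ0)
      rw [K_zero] at h1
      have h2 : ContinuousWithinAt (fun s => FHat f h θ s - FHat f h θ ε) (Ici ε) ε :=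
        (((continuousOn_FHat hf hh θ) ε hε.le).mono (Ici_subset_Ici.2 hε.le)).sub
          continuousWithinAt_const
      refine ContinuousWithinAt.comp (g := KInv φ) (t := Ici 0) ?_ h2 ?_
      · rwa [sub_self]
      · intro x hx
        exact sub_nonneg.2 ((strictMonoOn_FHat hf hh θ).monotoneOn hε.le
          (hε.le.trans hx) hx)
    · exact (hkd s hs).continuousAt.continuousWithinAt
  have hHc : ContinuousOn H (Ici 0) := continuousOn_primitive_Ici
    (fun _ => intervalIntegrable_of_integrableAtFilter hh.continuousOn hh.integrable)
  have hHε : ContinuousOn H (Ici ε) := hHc.mono (Ici_subset_Ici.2 hε.le)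
  have hsub0 : Ioi ε ⊆ Ioi (0 : ℝ) := Ioi_subset_Ioi hε.le
  have hk'c : ContinuousOn k' (Ioi ε) := by
    have h1 : ContinuousOn k (Ioi ε) := hkc.mono Ioi_subset_Ici_self
    refine ContinuousOn.mul (ContinuousOn.inv₀ (h1.mul
      (hφ.continuousOn_deriv.comp h1 fun x hx => (hkK x hx).1)) fun x hx =>
        (mul_pos (hkK x hx).1 (hφ.deriv_pos _ (hkK x hx).1)).ne') ?_
    exact (continuousOn_FHat_integrand hf hh θ).mono (hsub0.trans Ioi_subset_Ici_self)
  have hkk' : ∀ s, ε < s → deriv φ (k s) * k s * k' s = F' s := by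
    intro s hs
    have h1 := (hkK s hs).1
    have h2 := hφ.deriv_pos _ h1
    simp only [hk']
    field_simp
  -- The slope is `q = k e^{-H}`. The two entries of the maximum are the constants produced by the
  -- two final inequalities.
  refine ⟨fun s => k s * Real.exp (-H s),
    fun s => k' s * Real.exp (-H s) + k s * (Real.exp (-H s) * (-h s)), ?_, ?_, ?_, ?_, ?_, ?_,
    max (D / B) (C₁ / (B * (2 - θ))), lt_max_of_lt_left (by positivity), ?_⟩
  · exact hkc.mul (Real.continuous_exp.comp_continuousOn hHε.neg)
  · simp [hkε]
  · exact fun s hs => mul_pos (hkK s hs).1 (Real.exp_pos _)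
  · exact fun s hs => (hkd s hs).mul ((hh.hasDerivAt (hε.trans hs)).neg.exp)
  · have h1 : ContinuousOn (fun s => Real.exp (-H s)) (Ioi ε) :=
      Real.continuous_exp.comp_continuousOn (hHε.mono Ioi_subset_Ici_self).neg
    exact (hk'c.mul h1).add ((hkc.mono Ioi_subset_Ici_self).mul
      (h1.mul (hh.continuousOn.mono hsub0).neg))
  · have hqc : ContinuousOn (fun s => (k s * Real.exp (-H s))⁻¹) (Ioi ε) := by
      refine ContinuousOn.inv₀ ((hkc.mul (Real.continuous_exp.comp_continuousOn hHε.neg)).mono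
        Ioi_subset_Ici_self) fun s hs => (mul_pos (hkK s hs).1 (Real.exp_pos _)).ne'
    -- large values of `s`
    obtain ⟨S, hS, hSi⟩ := hKO
    obtain ⟨a, ha⟩ := mem_atTop_sets.1 hS
    -- With `B L^(2-θ) ≥ 2`, the dilation estimate gives `K(L k) ≥ 2 K(k)`. Once `F̂(s) ≥ 2 F̂(ε)`,
    -- this yields `K⁻¹(F̂(s)) ≤ L k(s)`, so the shift by `F̂(ε)` costs only the factor `L`.
    obtain ⟨L, hL1, hL⟩ : ∃ L : ℝ, 2 / B ≤ L ^ (2 - θ) ∧ 1 ≤ L :=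
      (((tendsto_rpow_atTop hθ').eventually_ge_atTop (2 / B)).and (eventually_ge_atTop 1)).exists
    have hFlow : ∀ s, 1 ≤ s → f 1 * (s - 1) ≤ FHat f h θ s := by
      intro s hs
      have := sub_le_sub_of_hasDerivAt_le (F := fun s => f 1 * s) (F' := fun _ => f 1)
        (G := FHat f h θ) (G' := F') hs (by fun_prop)
        ((continuousOn_FHat hf hh θ).mono (fun x hx => zero_le_one.trans hx.1))
        (fun x _ => by simpa using (hasDerivAt_id x).const_mul (f 1))
        (fun x hx => hasDerivAt_FHat hf hh θ (zero_lt_one.trans hx.1))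
        (fun x hx => by
          have hx0 : 0 < x := zero_lt_one.trans hx.1
          have h1 : f 1 ≤ f x := hf.monotoneOn (zero_le_one' ℝ) hx0.le hx.1.le
          have h2 : 1 ≤ Real.exp ((2 - θ) * H x) :=
            Real.one_le_exp (mul_nonneg hθ'.le (hh.primitive_nonneg hx0.le))
          have := hf.pos 1 one_pos
          simp only [hF']
          nlinarith)
      have h0 : 0 ≤ FHat f h θ 1 := by
        rw [← FHat_zero f h θ]
        exact (strictMonoOn_FHat hf hh θ).monotoneOn self_mem_Ici (zero_le_one' ℝ) zero_le_one
      linarith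
    -- Beyond `a` the Keller–Osserman integrability is available. Beyond the last entry, the linear
    -- lower bound `hFlow` gives `F̂(s) ≥ 2 F̂(ε)`.
    set b : ℝ := max (max a (ε + 1)) (1 + 2 * FHat f h θ ε / f 1) with hb
    have hf1 := hf.pos 1 one_pos
    have hFε : 0 < FHat f h θ ε := by
      rw [← FHat_zero f h θ]; exact strictMonoOn_FHat hf hh θ self_mem_Ici hε.le hε
    have hεb : ε + 1 ≤ b := (le_max_right _ _).trans (le_max_left _ _)
    have hab : a ≤ b := (le_max_left _ _).trans (le_max_left _ _)
    have hlarge : IntegrableOn (fun s => (k s * Real.exp (-H s))⁻¹) (Ioi b) volume := by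
      have hi : IntegrableOn (fun t => L * (Real.exp (H t) / KInv φ (FHat f h θ t))) (Ioi b)
          volume :=
        (hSi.mono_set (fun x hx => ha x (hab.trans (le_of_lt hx)))).const_mul L
      refine Integrable.mono' hi ((hqc.mono (Ioi_subset_Ioi (by linarith))).aestronglyMeasurable
        measurableSet_Ioi) ?_
      refine (ae_restrict_iff' measurableSet_Ioi).2 (Eventually.of_forall fun s hs => ?_)
      have hsb : b < s := hs
      have hεs : ε < s := by linarith
      have hs1 : 1 + 2 * FHat f h θ ε / f 1 < s := (le_max_right _ _).trans_lt hsb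
      obtain ⟨hk1, hk2⟩ := hkK s hεs
      have hF2 : 2 * FHat f h θ ε ≤ FHat f h θ s := by
        have h1 : (1 : ℝ) ≤ s := by
          have : 0 ≤ 2 * FHat f h θ ε / f 1 := by positivity
          linarith
        refine le_trans ?_ (hFlow s h1)
        have := (div_lt_iff₀ hf1).1 (by linarith : 2 * FHat f h θ ε / f 1 < s - 1)
        linarith
      have hKL : FHat f h θ s ≤ K φ (L * k s) := by
        have h1 := le_K_mul hφ hφ0 hB hL hk1.le
        have h2 : 2 ≤ B * L ^ (2 - θ) := by
          rw [div_le_iff₀ hBpos] at hL1; linarith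
        have h3 := mul_le_mul_of_nonneg_right h2 (K_nonneg hφ hφ0 hk1.le)
        rw [hk2] at h3 h1
        linarith
      obtain ⟨t, ht, hKt⟩ := exists_K_eq hφ hφ0 hθ hBpos hB (by linarith : 0 ≤ FHat f h θ s)
      have hKI : KInv φ (FHat f h θ s) = t := by rw [← hKt]; exact KInv_K hφ hφ0 ht
      have htL : t ≤ L * k s := by
        rw [← hKt] at hKL
        exact (strictMonoOn_K hφ hφ0).le_iff_le ht
          (show (0 : ℝ) ≤ L * k s by positivity) |>.1 hKL
      have htpos : 0 < t := by
        refine lt_of_le_of_ne ht ?_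
        rintro rfl
        rw [K_zero] at hKt
        linarith
      rw [Real.norm_of_nonneg (by positivity), hKI, mul_inv, ← Real.exp_neg, neg_neg,
        mul_div_assoc', div_eq_mul_inv, mul_comm L, mul_assoc, mul_comm (k s)⁻¹]
      refine mul_le_mul_of_nonneg_left ?_ (Real.exp_pos _).le
      rw [← div_eq_mul_inv, le_div_iff₀ htpos, inv_mul_le_iff₀ hk1, mul_comm]
      exact htL
    -- values of `s` near `ε`
    have hsmall : IntegrableOn (fun s => (k s * Real.exp (-H s))⁻¹) (Ioc ε b) volume := by
      have hsubI : Icc ε b ⊆ Ici ε := fun x hx => hx.1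
      have hmem : ∀ x ∈ Icc ε b, k x ∈ Ici (0 : ℝ) := fun x hx => by
        rcases hx.1.eq_or_lt with rfl | h
        · simp [hkε]
        · exact (hkK x h).1.le
      -- The singularity of `1/k` at `ε` is integrable because `(φ ∘ k)' = φ'(k) k' = F'/k`
      -- dominates a multiple of `1/k`, and a nonnegative derivative of a function continuous up to
      -- `ε` is integrable.
      have h1 : IntegrableOn (fun s => deriv φ (k s) * k' s) (Ioc ε b) volume := by
        refine intervalIntegral.integrableOn_deriv_of_nonneg (g := fun s => φ (k s))
          (hφ.continuousOn.comp (hkc.mono hsubI) hmem)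
          (fun x hx => HasDerivAt.comp x (hφ.hasDerivAt (hkK x hx.1).1) (hkd x hx.1))
          (fun x hx => ?_)
        obtain ⟨h1, _⟩ := hkK x hx.1
        have h2 := hφ.deriv_pos _ h1
        have h3 := hf.pos x (hε.trans hx.1)
        simp only [hk', hF']
        positivity
      have hfε := hf.pos ε hε
      have h2 : IntegrableOn (fun s => Real.exp (H b) / f ε * (deriv φ (k s) * k' s))
          (Ioc ε b) volume := h1.const_mul _
      refine Integrable.mono' h2 ((hqc.mono Ioc_subset_Ioi_self).aestronglyMeasurable
        measurableSet_Ioc) ?_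
      refine (ae_restrict_iff' measurableSet_Ioc).2 (Eventually.of_forall fun s hs => ?_)
      obtain ⟨hk1, _⟩ := hkK s hs.1
      have hs0 : 0 < s := hε.trans hs.1
      have hHm : H s ≤ H b := by
        have := sub_le_sub_of_hasDerivAt_le (F := fun _ => (0 : ℝ)) (F' := fun _ => 0) (G := H)
          (G' := h) hs.2 continuousOn_const (hHc.mono fun x hx => hs0.le.trans hx.1)
          (fun x _ => hasDerivAt_const x 0) (fun x hx => hh.hasDerivAt (hs0.trans hx.1))
          (fun x hx => hh.nonneg x (hs0.trans hx.1))
        linarith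
      have h3 : f ε ≤ F' s := by
        have h1 : f ε ≤ f s := hf.monotoneOn hε.le hs0.le hs.1.le
        have h2 : 1 ≤ Real.exp ((2 - θ) * H s) :=
          Real.one_le_exp (mul_nonneg hθ'.le (hh.primitive_nonneg hs0.le))
        simp only [hF']
        nlinarith
      have h4 : deriv φ (k s) * k' s = F' s / k s := by
        rw [← hkk' s hs.1]; field_simp
      rw [h4, Real.norm_of_nonneg (by positivity), mul_inv, ← Real.exp_neg, neg_neg]
      have h5 : Real.exp (H s) ≤ Real.exp (H b) := Real.exp_le_exp.2 hHm
      calc (k s)⁻¹ * Real.exp (H s) ≤ (k s)⁻¹ * Real.exp (H b) := by gcongr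
        _ = Real.exp (H b) / f ε * (f ε / k s) := by field_simp
        _ ≤ _ := by gcongr
    have := hsmall.union hlarge
    rwa [Ioc_union_Ioi_eq_Ioi (by linarith)] at this
  · intro l hl hl2 s hs
    obtain ⟨hk1, hk2⟩ := hkK s hs
    have hs0 : 0 < s := hε.trans hs
    have hfs := hf.pos s hs0
    set e := Real.exp (-H s) with he
    have hepos : 0 < e := Real.exp_pos _
    have hq : 0 < k s * e := mul_pos hk1 hepos
    have hexp : 1 ≤ Real.exp (H s) := Real.one_le_exp (hh.primitive_nonneg hs0.le)
    have hee : e * Real.exp (H s) = 1 := by rw [he, ← Real.exp_add]; simp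
    constructor
    · have h1 : l * deriv φ (l * (k s * e)) ≤ D * deriv φ (k s * e) := by
        refine (hD l hl.le (by linarith) _ hq).trans ?_
        have : l ^ τ ≤ 1 := Real.rpow_le_one hl.le (by linarith) hτ
        have h2 := hφ.deriv_pos _ hq
        nlinarith [mul_le_mul_of_nonneg_left this (mul_pos hDpos h2).le]
      have h2 := hB _ hq (Real.exp (H s)) hexp
      rw [mul_assoc (k s), hee, mul_one, ← Real.exp_mul] at h2
      -- The term `h q²` cancels exactly the contribution of the derivative of `e^{-H}`.
      have h3 : k s * e * (k' s * e + k s * (e * -h s)) + h s * (k s * e) ^ 2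
          = k s * k' s * (e * e) := by ring
      have h3' : 0 < k s * k' s * (e * e) := by
        have : 0 < deriv φ (k s) := hφ.deriv_pos _ hk1
        simp only [hk', hF']; positivity
      have hE : Real.exp ((2 - θ) * H s) * (e * e) = Real.exp (H s * -θ) := by
        rw [he, ← Real.exp_add, ← Real.exp_add]; ring_nf
      -- Since `k = e^H q`, (Φ3) gives `B φ'(q) e^{-θH} ≤ φ'(k)`, while `φ'(k) k k' e^{-2H} = f
      -- e^{-θH}`. The common exponential is then cancelled.
      have h4 : B * deriv φ (k s * e) * (k s * k' s * (e * e)) ≤ f s := by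
        have h5 := mul_le_mul_of_nonneg_right h2 h3'.le
        have h6 : deriv φ (k s) * (k s * k' s * (e * e)) = f s * Real.exp (H s * -θ) := by
          rw [← hE, ← mul_assoc, ← mul_assoc (deriv φ (k s)), hkk' s hs]
          simp only [hF']; ring
        rw [h6] at h5
        have h7 := Real.exp_pos (H s * -θ)
        refine le_of_mul_le_mul_right ?_ h7
        linarith
      show deriv φ (l * (k s * e)) * (l ^ 2 * (k s * e * (k' s * e + k s * (e * -h s)) +
        h s * (k s * e) ^ 2)) ≤ max (D / B) (C₁ / (B * (2 - θ))) * l * f s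
      rw [h3]
      calc deriv φ (l * (k s * e)) * (l ^ 2 * (k s * k' s * (e * e)))
          = (l * deriv φ (l * (k s * e))) * (l * (k s * k' s * (e * e))) := by ring
        _ ≤ (D * deriv φ (k s * e)) * (l * (k s * k' s * (e * e))) := by gcongr
        _ = (D / B) * l * (B * deriv φ (k s * e) * (k s * k' s * (e * e))) := by field_simp
        _ ≤ (D / B) * l * f s := by gcongr
        _ ≤ _ := by gcongr; exact le_max_left _ _
    · have h1 := hC l _ hl hl2 hq
      have h2 := le_K_mul hφ hφ0 hB hexp hq.le
      rw [show Real.exp (H s) * (k s * e) = k s * (e * Real.exp (H s)) by ring, hee, mul_one,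
        hk2, ← Real.exp_mul] at h2
      have h3 := mul_FHat_sub_le hf hh hθ hε hs.le
      have hhs := hh.nonneg s hs0
      have h4 := mul_le_mul_of_nonneg_left h2 hhs
      have hE : Real.exp (H s * (2 - θ)) = Real.exp ((2 - θ) * H s) := by rw [mul_comm]
      -- `K(k) ≥ B e^{(2-θ)H} K(q)` is set against the bound of `mul_FHat_sub_le`, and the
      -- exponentials cancel.
      have h5 : h s * K φ (k s * e) ≤ f s / (B * (2 - θ)) := by
        have h6 := h4.trans h3
        rw [hE] at h6
        have h7 := Real.exp_pos ((2 - θ) * H s)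
        rw [le_div_iff₀ (by positivity)]
        refine le_of_mul_le_mul_right ?_ h7
        rw [le_div_iff₀ hθ'] at h6
        linarith
      calc h s * ((l * (k s * e)) ^ 2 * deriv φ (l * (k s * e)))
          ≤ h s * (C₁ * l ^ (2 - θ) * K φ (k s * e)) := by gcongr
        _ = C₁ * l ^ (2 - θ) * (h s * K φ (k s * e)) := by ring
        _ ≤ C₁ * l ^ (2 - θ) * (f s / (B * (2 - θ))) := by gcongr
        _ = (C₁ / (B * (2 - θ))) * l ^ (2 - θ) * f s := by field_simp
        _ ≤ _ := by gcongr; exact le_max_right _ _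

/-- The equation `A' = q(A)` with `q(ε) = 0` and `1/q` integrable on `(ε, ∞)` has a solution that
leaves the rest point `ε` at time `0` and blows up in finite time. -/
theorem exists_blowup {q : ℝ → ℝ} {ε : ℝ} (hq : ContinuousOn q (Ici ε)) (hqε : q ε = 0)
    (hpos : ∀ s, ε < s → 0 < q s) (hi : IntegrableOn (fun s => (q s)⁻¹) (Ioi ε) volume) :
    ∃ (L : ℝ) (A : ℝ → ℝ), 0 < L ∧ (∀ x, x ≤ 0 → A x = ε) ∧
      (∀ x, 0 < x → x < L → ε < A x) ∧ (∀ x, x < L → HasDerivAt A (q (A x)) x) ∧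
      ∀ M, ∃ x, x < L ∧ M < A x := by
  have hint : ∀ t, ε ≤ t → IntervalIntegrable (fun s => (q s)⁻¹) volume ε t := fun t ht => by
    rw [intervalIntegrable_iff_integrableOn_Ioc_of_le ht]
    exact hi.mono_set Ioc_subset_Ioi_self
  -- The equation is separable: `T` is the time needed to climb from `ε` to a given height, `A` is
  -- its inverse, and the blow-up time is the total integral `L`.
  set T : ℝ → ℝ := fun t => ∫ s in ε..t, (q s)⁻¹ with hT
  have hTc : ContinuousOn T (Ici ε) := continuousOn_primitive_Ici hint
  have hTd : ∀ t, ε < t → HasDerivAt T (q t)⁻¹ t := fun t ht =>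
    hasDerivAt_primitive_Ioi ((hq.mono Ioi_subset_Ici_self).inv₀ fun s hs => (hpos s hs).ne')
      hint ht
  have hTm : StrictMonoOn T (Ici ε) := strictMonoOn_of_deriv_pos (convex_Ici ε) hTc (by
    rw [interior_Ici]
    intro x hx
    rw [(hTd x hx).deriv]
    exact inv_pos.2 (hpos x hx))
  have hT0 : T ε = 0 := by simp [hT]
  set L : ℝ := ∫ s in Ioi ε, (q s)⁻¹ with hL
  have hTL : Tendsto T atTop (𝓝 L) :=
    intervalIntegral_tendsto_integral_Ioi ε hi tendsto_id
  have hTlt : ∀ t, ε ≤ t → T t < L := by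
    intro t ht
    have h1 : T t < T (t + 1) := hTm ht (by simp; linarith) (by linarith)
    refine h1.trans_le (ge_of_tendsto hTL ?_)
    filter_upwards [eventually_ge_atTop (t + 1)] with s hs
    exact hTm.monotoneOn (by simp; linarith) (by simp; linarith) hs
  have hsurj : ∀ x, 0 < x → x < L → ∃ z, ε < z ∧ T z = x := by
    intro x hx hxL
    obtain ⟨b, hb1, hb2⟩ := ((hTL.eventually_const_lt hxL).and (eventually_ge_atTop ε)).exists
    obtain ⟨z, hz, hzx⟩ := intermediate_value_Icc hb2 (hTc.mono fun z hz => hz.1)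
      ⟨by rw [hT0]; exact hx.le, hb1.le⟩
    refine ⟨z, lt_of_le_of_ne hz.1 ?_, hzx⟩
    rintro rfl
    linarith
  set I : ℝ → ℝ := Function.invFunOn T (Ici ε) with hI
  have hIT : ∀ z, ε ≤ z → I (T z) = z := fun z hz => hTm.injOn.leftInvOn_invFunOn hz
  set A : ℝ → ℝ := fun x => if x ≤ 0 then ε else I x with hA
  have hA0 : ∀ x, x ≤ 0 → A x = ε := fun x hx => if_pos hx
  have hAI : ∀ x, 0 ≤ x → A x = I x := by
    intro x hx
    rcases hx.eq_or_lt with rfl | hx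
    · rw [hA0 0 le_rfl, ← hT0, hIT ε le_rfl]
    · exact if_neg (not_le.2 hx)
  have hAd : ∀ x, 0 < x → x < L → HasDerivAt A (q (A x)) x := by
    intro x hx hxL
    obtain ⟨z, hz, rfl⟩ := hsurj x hx hxL
    have h1 := hasDerivAt_invFunOn_Ici hTm hTc hz (hTd z hz) (inv_pos.2 (hpos z hz)).ne'
    rw [inv_inv] at h1
    rw [hAI _ hx.le, hIT z hz.le]
    refine h1.congr_of_eventuallyEq ?_
    filter_upwards [Ioi_mem_nhds hx] with y hy
    exact hAI y (le_of_lt hy)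
  have hLpos : 0 < L := by rw [← hT0]; exact hTlt ε le_rfl
  refine ⟨L, A, hLpos, hA0, ?_, ?_, ?_⟩
  · intro x hx hxL
    obtain ⟨z, hz, rfl⟩ := hsurj x hx hxL
    rwa [hAI _ hx.le, hIT z hz.le]
  · intro x hxL
    rcases lt_trichotomy x 0 with hx | rfl | hx
    · rw [hA0 x hx.le, hqε]
      refine (hasDerivAt_const x ε).congr_of_eventuallyEq ?_
      filter_upwards [Iio_mem_nhds hx] with y hy
      exact hA0 y (le_of_lt hy)
    · have hcI : ContinuousWithinAt A (Ici 0) 0 := by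
        have h1 := continuousWithinAt_invFunOn_Ici hTm hTc
        rw [hT0] at h1
        exact h1.congr (fun y hy => hAI y hy) (hAI 0 le_rfl)
      have hmem : ∀ x ∈ Ioo 0 L, ε < A x := by
        intro x hx
        obtain ⟨z, hz, rfl⟩ := hsurj x hx.1 hx.2
        rwa [hAI _ hx.1.le, hIT z hz.le]
      -- The right derivative at `0` is the limit of `q(A x)`, which is `q ε = 0`. It therefore
      -- matches the constant branch on the left.
      have hright : HasDerivWithinAt A 0 (Ici 0) 0 := by
        refine hasDerivWithinAt_Ici_of_tendsto_deriv (s := Ioo 0 L)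
          (fun y hy => (hAd y hy.1 hy.2).differentiableAt.differentiableWithinAt)
          (hcI.mono fun y hy => hy.1.le) (Ioo_mem_nhdsGT hLpos) ?_
        have h2 : Tendsto A (𝓝[>] 0) (𝓝[Ici ε] ε) := by
          refine tendsto_nhdsWithin_iff.2 ⟨?_, ?_⟩
          · have := hcI.mono_left (nhdsWithin_mono 0 (Ioi_subset_Ici_self))
            rwa [hA0 0 le_rfl] at this
          · filter_upwards [Ioo_mem_nhdsGT hLpos] with y hy
            exact (hmem y hy).le
        have h3 : Tendsto (fun x => q (A x)) (𝓝[>] 0) (𝓝 0) := by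
          have := (hq ε self_mem_Ici).tendsto.comp h2
          rwa [hqε] at this
        refine h3.congr' ?_
        filter_upwards [Ioo_mem_nhdsGT hLpos] with y hy
        exact (hAd y hy.1 hy.2).deriv.symm
      have hleft : HasDerivWithinAt A 0 (Iic 0) 0 :=
        (hasDerivWithinAt_const 0 (Iic 0) ε).congr (fun y hy => hA0 y hy) (hA0 0 le_rfl)
      rw [hA0 0 le_rfl, hqε]
      have := hleft.union hright
      rwa [Iic_union_Ici, hasDerivWithinAt_univ] at this
    · exact hAd x hx hxL
  · intro M
    have hz : ε < max M ε + 1 := by linarith [le_max_right M ε]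
    refine ⟨T (max M ε + 1), hTlt _ hz.le, ?_⟩
    rw [hAI _ (by rw [← hT0]; exact (hTm self_mem_Ici hz.le hz).le), hIT _ hz.le]
    linarith [le_max_left M ε]

/-- The radial profile of the barrier: constant on `(-∞, 1]`, blowing up at `R`, as flat as
desired on any given interval, and satisfying the differential inequalities that make it a
supersolution. -/
theorem exists_profile {φ f h : ℝ → ℝ} {τ θ ε : ℝ} (hφ : CondPhi φ) (hf : CondF f) (hh : CondH h)
    (hφ0 : CondPhi0 φ) (hφ2 : CondPhi2 φ τ) (hφ3 : CondPhi3 φ θ)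
    (hKO : KellerOsserman φ f h θ) (hε : 0 < ε) {κ ρ η : ℝ} (hκ : 0 < κ) (hη : ε < η) :
    ∃ (R : ℝ) (α p p' : ℝ → ℝ), 1 < R ∧ ρ < R ∧ (∀ r, r ≤ 1 → α r = ε ∧ p r = 0) ∧
      (∀ r, r < R → HasDerivAt α (p r) r) ∧ ContinuousOn p (Iio R) ∧
      ContinuousOn p' (Ioo 1 R) ∧ α ρ < η ∧ (∀ M, ∃ r, 1 < r ∧ ρ < r ∧ r < R ∧ M < α r) ∧
      ∀ r, 1 < r → r < R → ε < α r ∧ 0 < p r ∧ HasDerivAt p (p' r) r ∧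
        deriv φ (p r) * (p' r + h (α r) * p r ^ 2) ≤ κ * f (α r) ∧
        h (α r) * (p r ^ 2 * deriv φ (p r)) ≤ κ * f (α r) ∧
        φ (p r) ≤ κ * r * f (α r) := by
  have hθ' : 0 < 2 - θ := by linarith [hφ3.1]
  obtain ⟨q, q', hqc, hqε, hqpos, hqd, hq'c, hqi, C, hC, hineq⟩ :=
    exists_slope hφ hf hh hφ0 hφ2 hφ3 hKO hε
  obtain ⟨L, A, hL, hA0, hAε, hAd, hAM⟩ := exists_blowup hqc hqε hqpos hqi
  have hAge : ∀ x, x < L → ε ≤ A x := fun x hx => by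
    rcases le_or_gt x 0 with h | h
    · exact (hA0 x h).ge
    · exact (hAε x h hx).le
  have hAmono : MonotoneOn A (Iio L) := by
    refine monotoneOn_of_deriv_nonneg (convex_Iio L)
      (fun x hx => (hAd x hx).continuousAt.continuousWithinAt) ?_ ?_
    · rw [interior_Iio]
      exact fun x hx => (hAd x hx).differentiableAt.differentiableWithinAt
    · rw [interior_Iio]
      intro x hx
      rw [(hAd x hx).deriv]
      rcases (hAge x hx).eq_or_lt with h | h
      · rw [← h, hqε]
      · exact (hqpos _ h).le
  -- choice of the time scale
  obtain ⟨l, hl0, hl2, hl3, hl4, hl5, hl6⟩ : ∃ l : ℝ, 0 < l ∧ l ≤ 1 / 2 ∧ C * l ≤ κ ∧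
      C * l ^ (2 - θ) ≤ κ ∧ A (l * (ρ - 1)) < η ∧ l * (ρ - 1) < L := by
    have hlin : Tendsto (fun l : ℝ => l * (ρ - 1)) (𝓝[>] 0) (𝓝 0) := by
      have : Tendsto (fun l : ℝ => l * (ρ - 1)) (𝓝 0) (𝓝 (0 * (ρ - 1))) :=
        tendsto_id.mul_const _
      rw [zero_mul] at this
      exact this.mono_left nhdsWithin_le_nhds
    have hid : Tendsto (fun l : ℝ => l) (𝓝[>] 0) (𝓝 0) := tendsto_id.mono_left nhdsWithin_le_nhds
    have h1 : ∀ᶠ l : ℝ in 𝓝[>] 0, 0 < l := self_mem_nhdsWithin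
    have h2 : ∀ᶠ l : ℝ in 𝓝[>] 0, l ≤ 1 / 2 := hid.eventually_le_const (by norm_num)
    have h3 : ∀ᶠ l : ℝ in 𝓝[>] 0, C * l ≤ κ :=
      (hid.const_mul C).eventually_le_const (by simpa using hκ)
    have h4 : ∀ᶠ l : ℝ in 𝓝[>] 0, C * l ^ (2 - θ) ≤ κ := by
      have : Tendsto (fun l : ℝ => l ^ (2 - θ)) (𝓝[>] 0) (𝓝 (0 ^ (2 - θ))) :=
        hid.rpow_const (Or.inr hθ'.le)
      rw [Real.zero_rpow hθ'.ne'] at this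
      exact (this.const_mul C).eventually_le_const (by simpa using hκ)
    have h5 : ∀ᶠ l : ℝ in 𝓝[>] 0, A (l * (ρ - 1)) < η :=
      ((hAd 0 hL).continuousAt.tendsto.comp hlin).eventually_lt_const (by rwa [hA0 0 le_rfl])
    have h6 : ∀ᶠ l : ℝ in 𝓝[>] 0, l * (ρ - 1) < L := hlin.eventually_lt_const hL
    obtain ⟨l, h⟩ := (h1.and (h2.and (h3.and (h4.and (h5.and h6))))).exists
    exact ⟨l, h⟩
  have hlR : ∀ r, r < 1 + L / l ↔ l * (r - 1) < L := fun r => by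
    rw [← sub_lt_iff_lt_add', lt_div_iff₀ hl0, mul_comm]
  set α : ℝ → ℝ := fun r => A (l * (r - 1)) with hα
  have hlind : ∀ r : ℝ, HasDerivAt (fun r => l * (r - 1)) l r := fun r => by
    simpa using ((hasDerivAt_id r).sub_const 1).const_mul l
  have hαd : ∀ r, r < 1 + L / l → HasDerivAt α (l * q (α r)) r := by
    intro r hr
    have := HasDerivAt.comp r (hAd _ ((hlR r).1 hr)) (hlind r)
    rwa [mul_comm] at this
  have hαε : ∀ r, 1 < r → r < 1 + L / l → ε < α r := fun r hr hrR =>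
    hAε _ (mul_pos hl0 (by linarith)) ((hlR r).1 hrR)
  have hαc : ContinuousOn α (Iio (1 + L / l)) := fun r hr =>
    (hαd r hr).continuousAt.continuousWithinAt
  have hqαc : ContinuousOn (fun r => l * q (α r)) (Iio (1 + L / l)) :=
    continuousOn_const.mul (hqc.comp hαc fun r hr => hAge _ ((hlR r).1 hr))
  have hpd : ∀ r, 1 < r → r < 1 + L / l →
      HasDerivAt (fun r => l * q (α r)) (l ^ 2 * (q (α r) * q' (α r))) r := by
    intro r hr hrR
    have := (HasDerivAt.comp r (hqd _ (hαε r hr hrR)) (hαd r hrR)).const_mul l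
    exact this.congr_deriv (by ring)
  have hone : ∀ r, r ≤ 1 → α r = ε := fun r hr => hA0 _ (by nlinarith)
  have hκ1 : ∀ r, 1 < r → r < 1 + L / l → deriv φ (l * q (α r)) *
      (l ^ 2 * (q (α r) * q' (α r)) + h (α r) * (l * q (α r)) ^ 2) ≤ κ * f (α r) := by
    intro r hr hrR
    have h1 := hαε r hr hrR
    refine le_trans (le_of_eq ?_) (((hineq l hl0 hl2 _ h1).1).trans
      (mul_le_mul_of_nonneg_right hl3 (hf.pos _ (hε.trans h1)).le))
    ring
  refine ⟨1 + L / l, α, fun r => l * q (α r), fun r => l ^ 2 * (q (α r) * q' (α r)),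
    by have : 0 < L / l := by positivity
       linarith, (hlR ρ).2 hl6, fun r hr => ⟨hone r hr, by simp [hone r hr, hqε]⟩, hαd, hqαc, ?_,
    hl5, ?_, ?_⟩
  · have h1 : ContinuousOn α (Ioo 1 (1 + L / l)) := hαc.mono fun r hr => hr.2
    exact continuousOn_const.mul ((hqc.comp h1 fun r hr => (hαε r hr.1 hr.2).le).mul
      (hq'c.comp h1 fun r hr => hαε r hr.1 hr.2))
  · intro M
    -- Exceeding `ε` forces `x > 0`, hence a radius above `1`; exceeding `α ρ` forces the radius
    -- beyond `ρ`, since `A` is monotone.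
    obtain ⟨x, hxL, hx⟩ := hAM (max M (max ε (α ρ)))
    have hx1 : M < A x := (le_max_left _ _).trans_lt hx
    have hx2 : ε < A x := ((le_max_left _ _).trans (le_max_right _ _)).trans_lt hx
    have hx3 : α ρ < A x := ((le_max_right _ _).trans (le_max_right _ _)).trans_lt hx
    have hx0 : 0 < x := by
      by_contra h
      rw [hA0 x (not_lt.1 h)] at hx2
      exact lt_irrefl _ hx2
    have hlx : l * ((1 + x / l) - 1) = x := by field_simp; ring
    refine ⟨1 + x / l, by have : 0 < x / l := by positivity
                          linarith, ?_, (hlR _).2 (by rwa [hlx]), by simpa only [hα, hlx]⟩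
    by_contra h
    have h1 : x ≤ l * (ρ - 1) := by
      rw [not_lt, ← le_sub_iff_add_le', div_le_iff₀ hl0] at h
      linarith
    exact absurd (hAmono hxL hl6 h1) (not_le.2 hx3)
  · intro r hr hrR
    have h1 := hαε r hr hrR
    have hfα := hf.pos _ (hε.trans h1)
    refine ⟨h1, mul_pos hl0 (hqpos _ h1), hpd r hr hrR, hκ1 r hr hrR,
      ((hineq l hl0 hl2 _ h1).2).trans (mul_le_mul_of_nonneg_right hl4 hfα.le), ?_⟩
    have hpnn : ∀ x, x < 1 + L / l → 0 ≤ l * q (α x) := fun x hx => by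
      rcases le_or_gt x 1 with h | h
      · simp [hone x h, hqε]
      · exact (mul_pos hl0 (hqpos _ (hαε x h hx))).le
    -- The bound on `φ(p)` is the integral of the one on its derivative: on `(1, r)` one has `φ'(p)
    -- p' ≤ κ f(α x) ≤ κ f(α r)`, after dropping the nonnegative `h` term, and `φ(p 1) = 0`.
    have h2 := sub_le_sub_of_hasDerivAt_le (F := fun x => φ (l * q (α x)))
      (G := fun x => κ * f (α r) * x)
      (F' := fun x => deriv φ (l * q (α x)) * (l ^ 2 * (q (α x) * q' (α x))))
      (G' := fun _ => κ * f (α r)) hr.le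
      (hφ.continuousOn.comp (hqαc.mono fun x hx => hx.2.trans_lt hrR)
        fun x hx => hpnn x (hx.2.trans_lt hrR))
      (by fun_prop)
      (fun x hx => by
        have hxR := hx.2.trans hrR
        exact HasDerivAt.comp x (hφ.hasDerivAt (mul_pos hl0 (hqpos _ (hαε x hx.1 hxR))))
          (hpd x hx.1 hxR))
      (fun x _ => by simpa using (hasDerivAt_id x).const_mul (κ * f (α r)))
      (fun x hx => by
        have hxR := hx.2.trans hrR
        have h3 := hαε x hx.1 hxR
        have h4 := hκ1 x hx.1 hxR
        have h5 : f (α x) ≤ f (α r) := hf.monotoneOn (hε.trans h3).le (hε.trans h1).le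
          (hAmono ((hlR x).1 hxR) ((hlR r).1 hrR)
            (mul_le_mul_of_nonneg_left (by linarith [hx.2]) hl0.le))
        have h6 := hφ.deriv_pos _ (mul_pos hl0 (hqpos _ h3))
        have h7 : 0 ≤ deriv φ (l * q (α x)) * (h (α x) * (l * q (α x)) ^ 2) :=
          mul_nonneg h6.le (mul_nonneg (hh.nonneg _ (hε.trans h3)) (sq_nonneg _))
        nlinarith [mul_le_mul_of_nonneg_left h5 hκ.le])
    simp only [hone 1 le_rfl, hqε, mul_zero, hφ.map_zero, sub_zero, mul_one] at h2
    have := mul_pos hκ hfα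
    nlinarith

/-! ### Integration by parts on `C¹` test functions -/

theorem continuous_mul_of_tsupport_subset {E : Type*} [TopologicalSpace E] {F ζ : E → ℝ}
    {U : Set E} (hU : IsOpen U) (hF : ContinuousOn F U) (hζ : Continuous ζ)
    (hsub : tsupport ζ ⊆ U) : Continuous fun q => F q * ζ q :=
  (hF.mul hζ.continuousOn).continuous_of_tsupport_subset hU
    ((closure_mono (Function.support_mul_subset_right F ζ)).trans hsub)

theorem integrable_mul_of_tsupport_subset {E : Type*} [NormedAddCommGroup E] [MeasurableSpace E]
    [BorelSpace E] {μ : Measure E} [IsFiniteMeasureOnCompacts μ] {F ζ : E → ℝ} {U : Set E}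
    (hU : IsOpen U) (hF : ContinuousOn F U) (hζ : Continuous ζ) (hc : HasCompactSupport ζ)
    (hsub : tsupport ζ ⊆ U) : Integrable (fun q => F q * ζ q) μ :=
  (continuous_mul_of_tsupport_subset hU hF hζ hsub).integrable_of_hasCompactSupport hc.mul_left

section IntegrationByParts

variable {E : Type*} [NormedAddCommGroup E] [NormedSpace ℝ E]

theorem tsupport_fderiv_apply_subset' {ζ : E → ℝ} (V : E → E) :
    tsupport (fun q => fderiv ℝ ζ q (V q)) ⊆ tsupport ζ := by
  refine closure_minimal ?_ (isClosed_tsupport ζ)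
  intro q hq
  by_contra h
  refine hq ?_
  have : fderiv ℝ ζ q = 0 := by
    by_contra h'
    exact h (support_fderiv_subset ℝ h')
  simp [this]

theorem hasCompactSupport_fderiv_apply {ζ : E → ℝ} (hc : HasCompactSupport ζ) (V : E → E) :
    HasCompactSupport (fun q => fderiv ℝ ζ q (V q)) :=
  hc.of_isClosed_subset (isClosed_tsupport _) (tsupport_fderiv_apply_subset' V)

theorem integral_mul_fderiv_eq_neg [FiniteDimensional ℝ E] [MeasurableSpace E] [BorelSpace E]
    {μ : Measure E} [μ.IsAddHaarMeasure] {W ζ : E → ℝ} {U : Set E} (hU : IsOpen U)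
    (hW : ContDiffOn ℝ 1 W U) (hζ : ContDiff ℝ 1 ζ) (hc : HasCompactSupport ζ)
    (hsub : tsupport ζ ⊆ U) (v : E) :
    ∫ q, W q * fderiv ℝ ζ q v ∂μ = -∫ q, fderiv ℝ W q v * ζ q ∂μ := by
  have hζc : Continuous fun q => fderiv ℝ ζ q v :=
    (hζ.continuous_fderiv one_ne_zero).clm_apply continuous_const
  have hWc : ContinuousOn (fun q => fderiv ℝ W q v) U :=
    (hW.continuousOn_fderiv_of_isOpen hU le_rfl).clm_apply continuousOn_const
  refine integral_bilinear_hasLineDerivAt_right_eq_neg_left_of_integrable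
    (B := ContinuousLinearMap.mul ℝ ℝ) (v := v) (f := W) (g := ζ)
    (f' := fun q => fderiv ℝ W q v) (g' := fun q => fderiv ℝ ζ q v) ?_ ?_ ?_ ?_ ?_
  · exact integrable_mul_of_tsupport_subset hU hWc hζ.continuous hc hsub
  · exact integrable_mul_of_tsupport_subset hU hW.continuousOn hζc
      (hasCompactSupport_fderiv_apply hc _) ((tsupport_fderiv_apply_subset' _).trans hsub)
  · exact integrable_mul_of_tsupport_subset hU hW.continuousOn hζ.continuous hc hsub
  · intro x hx
    exact (((hW.contDiffAt (hU.mem_nhds (hsub hx))).differentiableAt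
      one_ne_zero).hasFDerivAt).hasLineDerivAt v
  · intro x _
    exact ((hζ.differentiable one_ne_zero x).hasFDerivAt).hasLineDerivAt v

end IntegrationByParts

/-! ### The horizontal gradient -/

/-- The horizontal frame: `X_j` for `Sum.inl j`, `Y_j` for `Sum.inr j`. -/
noncomputable def frame {m : ℕ} (i : Fin m ⊕ Fin m) (q : Point m) : Point m :=
  Sum.elim (fun j => (Pi.single j 1, 0, 2 * q.2.1 j)) (fun j => (0, Pi.single j 1, -2 * q.1 j)) i

/-- The horizontal gradient in the frame `X_j, Y_j`. -/
noncomputable def hgrad {m : ℕ} (u : Point m → ℝ) (q : Point m) :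
    EuclideanSpace ℝ (Fin m ⊕ Fin m) :=
  WithLp.toLp 2 fun i => fderiv ℝ u q (frame i q)

theorem hgrad_apply {m : ℕ} (u : Point m → ℝ) (q : Point m) (i : Fin m ⊕ Fin m) :
    hgrad u q i = fderiv ℝ u q (frame i q) := rfl

theorem gradDot_eq_inner {m : ℕ} (u v : Point m → ℝ) (q : Point m) :
    gradDot u v q = inner ℝ (hgrad u q) (hgrad v q) := by
  simp [gradDot, PiLp.inner_apply, hgrad_apply, frame, X, Y, Finset.sum_add_distrib, mul_comm]

theorem gradNorm_eq_norm {m : ℕ} (u : Point m → ℝ) (q : Point m) :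
    gradNorm u q = ‖hgrad u q‖ := by
  rw [gradNorm, gradDot_eq_inner, real_inner_self_eq_norm_sq, Real.sqrt_sq (norm_nonneg _)]

theorem continuous_frame {m : ℕ} (i : Fin m ⊕ Fin m) : Continuous (frame (m := m) i) := by
  unfold frame
  rcases i with j | j <;> simp only [Sum.elim_inl, Sum.elim_inr] <;> fun_prop

theorem continuousOn_hgrad {m : ℕ} {u : Point m → ℝ} {U : Set (Point m)} (hU : IsOpen U)
    (hu : ContDiffOn ℝ 1 u U) : ContinuousOn (hgrad u) U := by
  refine (PiLp.continuous_toLp 2 _).comp_continuousOn (continuousOn_pi.2 fun i => ?_)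
  exact (hu.continuousOn_fderiv_of_isOpen hU le_rfl).clm_apply (continuous_frame i).continuousOn

/-- The vertical coefficient of the field `frame i`. -/
noncomputable def frameCoeff {m : ℕ} (i : Fin m ⊕ Fin m) (q : Point m) : ℝ :=
  Sum.elim (fun j => 2 * q.2.1 j) (fun j => -2 * q.1 j) i

theorem frame_eq {m : ℕ} (i : Fin m ⊕ Fin m) (q : Point m) :
    frame i q = frame i 0 + frameCoeff i q • ((0, 0, 1) : Point m) := by
  rcases i with j | j <;> simp [frame, frameCoeff]

theorem contDiff_frameCoeff {m : ℕ} (i : Fin m ⊕ Fin m) : ContDiff ℝ 1 (frameCoeff (m := m) i) := by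
  unfold frameCoeff
  rcases i with j | j <;> simp only [Sum.elim_inl, Sum.elim_inr] <;> fun_prop

theorem fderiv_frameCoeff {m : ℕ} (i : Fin m ⊕ Fin m) (q : Point m) :
    fderiv ℝ (frameCoeff i) q ((0, 0, 1) : Point m) = 0 := by
  have h : HasLineDerivAt ℝ (frameCoeff i) (0 : ℝ) q ((0, 0, 1) : Point m) := by
    have : (fun t : ℝ => frameCoeff i (q + t • ((0, 0, 1) : Point m))) =
        fun _ => frameCoeff i q := by
      ext t
      rcases i with j | j <;> simp [frameCoeff]
    unfold HasLineDerivAt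
    rw [this]
    exact hasDerivAt_const _ _
  exact (((contDiff_frameCoeff i).differentiable one_ne_zero q).hasFDerivAt.hasLineDerivAt
    _).unique h

instance isAddHaarMeasure_volume_point (m : ℕ) :
    (volume : Measure (Point m)).IsAddHaarMeasure :=
  haveI : (volume : Measure ((Fin m → ℝ) × ℝ)).IsAddHaarMeasure :=
    Measure.prod.instIsAddHaarMeasure volume volume
  Measure.prod.instIsAddHaarMeasure volume volume

/-- Each field is a constant vector plus a coefficient times `∂_t`, and the coefficient does not
depend on `t`. The field is thus divergence free, and no zero-order term appears. -/
theorem integral_mul_frame_eq_neg {m : ℕ} {W ζ : Point m → ℝ} {U : Set (Point m)} (hU : IsOpen U)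
    (hW : ContDiffOn ℝ 1 W U) (hζ : ContDiff ℝ 1 ζ) (hc : HasCompactSupport ζ)
    (hsub : tsupport ζ ⊆ U) (i : Fin m ⊕ Fin m) :
    ∫ q, W q * fderiv ℝ ζ q (frame i q) = -∫ q, fderiv ℝ W q (frame i q) * ζ q := by
  have hζc : ∀ v, Continuous fun q => fderiv ℝ ζ q v := fun v =>
    (hζ.continuous_fderiv one_ne_zero).clm_apply continuous_const
  have hWc : ∀ v, ContinuousOn (fun q => fderiv ℝ W q v) U := fun v =>
    (hW.continuousOn_fderiv_of_isOpen hU le_rfl).clm_apply continuousOn_const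
  have hcW : ContDiffOn ℝ 1 (fun q => frameCoeff i q * W q) U :=
    (contDiff_frameCoeff i).contDiffOn.mul hW
  have h1 := integral_mul_fderiv_eq_neg (μ := volume) hU hW hζ hc hsub (frame i 0)
  have h2 := integral_mul_fderiv_eq_neg (μ := volume) hU hcW hζ hc hsub ((0, 0, 1) : Point m)
  have hsubd : ∀ v : Point m, tsupport (fun q => fderiv ℝ ζ q v) ⊆ U := fun v =>
    (tsupport_fderiv_apply_subset' fun _ => v).trans hsub
  calc ∫ q, W q * fderiv ℝ ζ q (frame i q)
      = ∫ q, (W q * fderiv ℝ ζ q (frame i 0) +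
          frameCoeff i q * W q * fderiv ℝ ζ q ((0, 0, 1) : Point m)) := by
        refine integral_congr_ae (Eventually.of_forall fun q => ?_)
        simp only [frame_eq i q, map_add, map_smul, smul_eq_mul]
        ring
    _ = (-∫ q, fderiv ℝ W q (frame i 0) * ζ q) +
        -∫ q, fderiv ℝ (fun q => frameCoeff i q * W q) q ((0, 0, 1) : Point m) * ζ q := by
        rw [integral_add, h1, h2]
        · exact integrable_mul_of_tsupport_subset hU hW.continuousOn (hζc _)
            (hasCompactSupport_fderiv_apply hc _) (hsubd _)
        · exact integrable_mul_of_tsupport_subset hU hcW.continuousOn (hζc _)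
            (hasCompactSupport_fderiv_apply hc _) (hsubd _)
    _ = -∫ q, fderiv ℝ W q (frame i q) * ζ q := by
        rw [← neg_add, ← integral_add]
        · congr 1
          refine integral_congr_ae (Eventually.of_forall fun q => ?_)
          by_cases hq : q ∈ tsupport ζ
          · have hWd : DifferentiableAt ℝ W q :=
              (hW.contDiffAt (hU.mem_nhds (hsub hq))).differentiableAt one_ne_zero
            have := fderiv_fun_mul ((contDiff_frameCoeff i).differentiable one_ne_zero q) hWd
            simp only [this, frame_eq i q, map_add, map_smul, smul_eq_mul,
              add_apply, smul_apply, fderiv_frameCoeff]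
            ring
          · simp [image_eq_zero_of_notMem_tsupport hq]
        · exact integrable_mul_of_tsupport_subset hU (hWc _) hζ.continuous hc hsub
        · exact integrable_mul_of_tsupport_subset hU
            ((hcW.continuousOn_fderiv_of_isOpen hU le_rfl).clm_apply continuousOn_const)
            hζ.continuous hc hsub

/-! ### The Koranyi gauge -/

/-- `|z|²` for `z = (x, y)`. -/
noncomputable def zSq {m : ℕ} (q : Point m) : ℝ := ∑ j, (q.1 j ^ 2 + q.2.1 j ^ 2)

/-- The fourth power of the Koranyi gauge, `|z|⁴ + t²`. -/
noncomputable def gaugeFour {m : ℕ} (q : Point m) : ℝ := zSq q ^ 2 + q.2.2 ^ 2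

/-- The Koranyi gauge. -/
noncomputable def gauge {m : ℕ} (q : Point m) : ℝ := √(√(gaugeFour q))

/-- The components of the horizontal gradient of `gaugeFour`. -/
noncomputable def gaugeFourGrad {m : ℕ} (i : Fin m ⊕ Fin m) (q : Point m) : ℝ :=
  Sum.elim (fun j => 4 * (zSq q * q.1 j + q.2.2 * q.2.1 j))
    (fun j => 4 * (zSq q * q.2.1 j - q.2.2 * q.1 j)) i

theorem zSq_nonneg {m : ℕ} (q : Point m) : 0 ≤ zSq q :=
  Finset.sum_nonneg fun _ _ => by positivity

theorem gaugeFour_nonneg {m : ℕ} (q : Point m) : 0 ≤ gaugeFour q := by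
  unfold gaugeFour; positivity

theorem contDiff_zSq {m : ℕ} : ContDiff ℝ 1 (zSq (m := m)) := by
  unfold zSq
  refine ContDiff.sum fun j _ => ?_
  fun_prop

theorem contDiff_gaugeFour {m : ℕ} : ContDiff ℝ 1 (gaugeFour (m := m)) := by
  have := contDiff_zSq (m := m)
  unfold gaugeFour
  fun_prop

theorem continuous_gauge {m : ℕ} : Continuous (gauge (m := m)) :=
  Real.continuous_sqrt.comp (Real.continuous_sqrt.comp contDiff_gaugeFour.continuous)

theorem contDiff_gaugeFourGrad {m : ℕ} (i : Fin m ⊕ Fin m) :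
    ContDiff ℝ 1 (gaugeFourGrad (m := m) i) := by
  have := contDiff_zSq (m := m)
  unfold gaugeFourGrad
  rcases i with j | j <;> simp only [Sum.elim_inl, Sum.elim_inr] <;> fun_prop

theorem hasFDerivAt_coord_fst {m : ℕ} (j : Fin m) (q : Point m) :
    HasFDerivAt (fun q : Point m => q.1 j)
      ((ContinuousLinearMap.proj j).comp (ContinuousLinearMap.fst ℝ (Fin m → ℝ) _)) q :=
  ContinuousLinearMap.hasFDerivAt
    ((ContinuousLinearMap.proj j).comp (ContinuousLinearMap.fst ℝ (Fin m → ℝ) ((Fin m → ℝ) × ℝ)))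

theorem hasFDerivAt_coord_snd {m : ℕ} (j : Fin m) (q : Point m) :
    HasFDerivAt (fun q : Point m => q.2.1 j)
      ((ContinuousLinearMap.proj j).comp ((ContinuousLinearMap.fst ℝ (Fin m → ℝ) ℝ).comp
        (ContinuousLinearMap.snd ℝ (Fin m → ℝ) _))) q :=
  ContinuousLinearMap.hasFDerivAt ((ContinuousLinearMap.proj j).comp
    ((ContinuousLinearMap.fst ℝ (Fin m → ℝ) ℝ).comp
      (ContinuousLinearMap.snd ℝ (Fin m → ℝ) ((Fin m → ℝ) × ℝ))))

theorem hasFDerivAt_coord_vert {m : ℕ} (q : Point m) :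
    HasFDerivAt (fun q : Point m => q.2.2)
      ((ContinuousLinearMap.snd ℝ (Fin m → ℝ) ℝ).comp
        (ContinuousLinearMap.snd ℝ (Fin m → ℝ) _)) q :=
  ContinuousLinearMap.hasFDerivAt ((ContinuousLinearMap.snd ℝ (Fin m → ℝ) ℝ).comp
      (ContinuousLinearMap.snd ℝ (Fin m → ℝ) ((Fin m → ℝ) × ℝ)))

theorem fderiv_zSq {m : ℕ} (q v : Point m) :
    fderiv ℝ zSq q v = ∑ j, (2 * q.1 j * v.1 j + 2 * q.2.1 j * v.2.1 j) := by
  have h : HasFDerivAt (zSq (m := m)) _ q := HasFDerivAt.fun_sum (u := Finset.univ)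
    fun j _ => ((hasFDerivAt_coord_fst j q).pow 2).add ((hasFDerivAt_coord_snd j q).pow 2)
  rw [h.fderiv]
  simp

theorem fderiv_gaugeFour {m : ℕ} (q v : Point m) :
    fderiv ℝ gaugeFour q v = 2 * zSq q * fderiv ℝ zSq q v + 2 * q.2.2 * v.2.2 := by
  have h : HasFDerivAt (gaugeFour (m := m)) _ q :=
    (((contDiff_zSq.differentiable one_ne_zero q).hasFDerivAt).pow 2).add
      ((hasFDerivAt_coord_vert q).pow 2)
  rw [h.fderiv]
  simp

theorem fderiv_zSq_frame {m : ℕ} (q : Point m) (i : Fin m ⊕ Fin m) :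
    fderiv ℝ zSq q (frame i q) = Sum.elim (fun j => 2 * q.1 j) (fun j => 2 * q.2.1 j) i := by
  rw [fderiv_zSq]
  rcases i with j | j <;> simp [frame, Pi.single_apply]

theorem fderiv_gaugeFour_frame {m : ℕ} (q : Point m) (i : Fin m ⊕ Fin m) :
    fderiv ℝ gaugeFour q (frame i q) = gaugeFourGrad i q := by
  rw [fderiv_gaugeFour, fderiv_zSq_frame]
  rcases i with j | j <;> simp [frame, gaugeFourGrad] <;> ring

theorem fderiv_gaugeFourGrad_frame {m : ℕ} (q : Point m) (i : Fin m ⊕ Fin m) :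
    fderiv ℝ (gaugeFourGrad i) q (frame i q) =
      4 * zSq q + 8 * Sum.elim (fun j => q.1 j ^ 2 + q.2.1 j ^ 2)
        (fun j => q.1 j ^ 2 + q.2.1 j ^ 2) i := by
  have hz := (contDiff_zSq.differentiable one_ne_zero q).hasFDerivAt
  rcases i with j | j
  · have h : HasFDerivAt (gaugeFourGrad (m := m) (Sum.inl j)) _ q :=
      ((hz.mul (hasFDerivAt_coord_fst j q)).add
        ((hasFDerivAt_coord_vert q).mul (hasFDerivAt_coord_snd j q))).const_mul 4
    rw [h.fderiv]
    have := fderiv_zSq_frame q (Sum.inl j)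
    simp [this]
    simp [frame]
    ring
  · have h : HasFDerivAt (gaugeFourGrad (m := m) (Sum.inr j)) _ q :=
      ((hz.mul (hasFDerivAt_coord_snd j q)).sub
        ((hasFDerivAt_coord_vert q).mul (hasFDerivAt_coord_fst j q))).const_mul 4
    rw [h.fderiv]
    have := fderiv_zSq_frame q (Sum.inr j)
    simp [this]
    simp [frame]
    ring

/-- This is the sub-Laplacian of the fourth power of the gauge. Together with the next two
identities it supplies the geometric input for the divergence of the radial flux. -/
theorem sum_fderiv_gaugeFourGrad {m : ℕ} (q : Point m) :
    ∑ i, fderiv ℝ (gaugeFourGrad i) q (frame i q) = 8 * (m + 2) * zSq q := by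
  simp only [fderiv_gaugeFourGrad_frame, Fintype.sum_sum_type, Sum.elim_inl, Sum.elim_inr,
    Finset.sum_add_distrib, ← Finset.mul_sum, Finset.sum_const, Finset.card_univ,
    Fintype.card_sum, Fintype.card_fin, nsmul_eq_mul, Nat.cast_add]
  rw [← Finset.sum_add_distrib, show ∑ j, (q.1 j ^ 2 + q.2.1 j ^ 2) = zSq q from rfl]
  ring

theorem sum_gaugeFourGrad_sq {m : ℕ} (q : Point m) :
    ∑ i, gaugeFourGrad i q * gaugeFourGrad i q = 16 * zSq q * gaugeFour q := by
  simp only [Fintype.sum_sum_type, gaugeFourGrad, Sum.elim_inl, Sum.elim_inr]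
  rw [← Finset.sum_add_distrib]
  calc _ = ∑ j, 16 * gaugeFour q * (q.1 j ^ 2 + q.2.1 j ^ 2) :=
        Finset.sum_congr rfl fun j _ => by unfold gaugeFour; ring
    _ = _ := by rw [← Finset.mul_sum, show ∑ j, (q.1 j ^ 2 + q.2.1 j ^ 2) = zSq q from rfl]; ring

theorem sum_gaugeFourGrad_mul_fderiv_zSq {m : ℕ} (q : Point m) :
    ∑ i, gaugeFourGrad i q * fderiv ℝ zSq q (frame i q) = 8 * zSq q ^ 2 := by
  simp only [Fintype.sum_sum_type, gaugeFourGrad, Sum.elim_inl, Sum.elim_inr, fderiv_zSq_frame]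
  rw [← Finset.sum_add_distrib]
  calc _ = ∑ j, 8 * zSq q * (q.1 j ^ 2 + q.2.1 j ^ 2) :=
        Finset.sum_congr rfl fun j _ => by ring
    _ = _ := by rw [← Finset.mul_sum, show ∑ j, (q.1 j ^ 2 + q.2.1 j ^ 2) = zSq q from rfl]; ring

/-! ### Auxiliary real functions -/

theorem hasDerivAt_max_zero_sq (x : ℝ) :
    HasDerivAt (fun x : ℝ => (max x 0) ^ 2) (2 * max x 0) x := by
  rcases lt_trichotomy x 0 with h | rfl | h
  · rw [max_eq_right h.le, mul_zero]
    refine (hasDerivAt_const x (0 : ℝ)).congr_of_eventuallyEq ?_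
    filter_upwards [Iio_mem_nhds h] with y hy
    rw [max_eq_right (le_of_lt hy)]; norm_num
  · rw [hasDerivAt_iff_isLittleO_nhds_zero]
    simp only [zero_add, max_self, mul_zero, smul_zero, sub_zero, ne_eq, OfNat.ofNat_ne_zero,
      not_false_eq_true, zero_pow]
    refine Asymptotics.IsBigO.trans_isLittleO (g := fun h : ℝ => h ^ 2) ?_
      (Asymptotics.isLittleO_pow_id one_lt_two)
    refine Asymptotics.IsBigO.of_bound 1 (Eventually.of_forall fun h => ?_)
    rw [one_mul, norm_pow, norm_pow, Real.norm_eq_abs, Real.norm_eq_abs]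
    refine pow_le_pow_left₀ (abs_nonneg _) ?_ 2
    rw [abs_of_nonneg (le_max_right h 0)]
    exact max_le (le_abs_self h) (abs_nonneg h)
  · rw [max_eq_left h.le]
    refine HasDerivAt.congr_of_eventuallyEq (f := fun x : ℝ => x ^ 2)
      (by simpa using hasDerivAt_pow 2 x) ?_
    filter_upwards [Ioi_mem_nhds h] with y hy
    rw [max_eq_left (le_of_lt hy)]

theorem contDiff_max_zero_sq : ContDiff ℝ 1 (fun x : ℝ => (max x 0) ^ 2) := by
  rw [contDiff_one_iff_deriv]
  refine ⟨fun x => (hasDerivAt_max_zero_sq x).differentiableAt, ?_⟩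
  rw [show deriv (fun x : ℝ => (max x 0) ^ 2) = fun x => 2 * max x 0 from
    funext fun x => (hasDerivAt_max_zero_sq x).deriv]
  fun_prop

/-- A `C¹` approximation of the identity of `[0, ∞)` that vanishes near `0`. -/
theorem exists_truncation {δ : ℝ} (hδ : 0 < δ) :
    ∃ G : ℝ → ℝ, ContDiff ℝ 1 G ∧ (∀ y, 0 ≤ deriv G y ∧ deriv G y ≤ 1) ∧ (∀ y, y ≤ δ → G y = 0) ∧
      ∀ y, 0 ≤ y → 0 ≤ G y ∧ G y ≤ y ∧ y - 2 * δ ≤ G y := by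
  have hpos : ∀ y : ℝ, 0 < (max (y - δ) 0) ^ 2 + δ ^ 2 := fun y => by positivity
  have hd : ∀ y : ℝ, HasDerivAt (fun y : ℝ => √((max (y - δ) 0) ^ 2 + δ ^ 2) - δ)
      (2 * max (y - δ) 0 / (2 * √((max (y - δ) 0) ^ 2 + δ ^ 2))) y := by
    intro y
    have h1 := (hasDerivAt_max_zero_sq (y - δ)).comp y ((hasDerivAt_id y).sub_const δ)
    rw [mul_one] at h1
    exact ((h1.add_const (δ ^ 2)).sqrt (hpos y).ne').sub_const δ
  -- Squaring the positive part makes it `C¹`, and adding `δ²` keeps the root away from its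
  -- singularity. Subtracting `δ` gives the value `0` for `y ≤ δ`; the shift and the subtraction
  -- lose at most `2 δ`.
  refine ⟨fun y => √((max (y - δ) 0) ^ 2 + δ ^ 2) - δ, ?_, fun y => ?_, fun y hy => ?_,
    fun y hy => ⟨?_, ?_, ?_⟩⟩
  · refine ContDiff.sub (ContDiff.sqrt ?_ fun y => (hpos y).ne') contDiff_const
    exact (contDiff_max_zero_sq.comp (contDiff_id.sub contDiff_const)).add contDiff_const
  · rw [(hd y).deriv]
    have h1 : 0 ≤ max (y - δ) 0 := le_max_right _ _
    refine ⟨by positivity, ?_⟩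
    have h2 := Real.sqrt_pos.2 (hpos y)
    rw [div_le_one (by positivity)]
    have : max (y - δ) 0 ≤ √((max (y - δ) 0) ^ 2 + δ ^ 2) :=
      Real.le_sqrt_of_sq_le (by linarith [sq_nonneg δ])
    linarith
  · simp only [max_eq_right (sub_nonpos.2 hy)]
    rw [show (0 : ℝ) ^ 2 + δ ^ 2 = δ ^ 2 by ring, Real.sqrt_sq hδ.le, sub_self]
  · rw [sub_nonneg]
    exact Real.le_sqrt_of_sq_le (by linarith [sq_nonneg (max (y - δ) 0)])
  · rw [sub_le_iff_le_add]
    refine Real.sqrt_le_iff.2 ⟨by linarith, ?_⟩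
    rcases le_total (y - δ) 0 with h | h
    · rw [max_eq_right h]; nlinarith
    · rw [max_eq_left h]; nlinarith
  · have : y - δ ≤ √((max (y - δ) 0) ^ 2 + δ ^ 2) :=
      (le_max_left _ 0).trans (Real.le_sqrt_of_sq_le (by linarith [sq_nonneg δ]))
    linarith

/-! ### The flux `φ(|a|) a / |a|` -/

section Flux

variable {F : Type*} [NormedAddCommGroup F] [InnerProductSpace ℝ F]

/-- The flux `a ↦ φ(|a|) a / |a|`. -/
noncomputable def flux (φ : ℝ → ℝ) (a : F) : F := (‖a‖⁻¹ * φ ‖a‖) • a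

theorem norm_flux {φ : ℝ → ℝ} (hφ : CondPhi φ) (a : F) : ‖flux φ a‖ = φ ‖a‖ := by
  rw [flux, norm_smul, Real.norm_of_nonneg
    (mul_nonneg (inv_nonneg.2 (norm_nonneg a)) (hφ.nonneg (norm_nonneg a)))]
  rcases eq_or_ne a 0 with rfl | h
  · simp [hφ.map_zero]
  · have := norm_pos_iff.2 h
    field_simp

/-- The only delicate point is the origin, where the norm of the flux is `φ(|a|)` and `φ(0) = 0`. -/
theorem continuous_flux {φ : ℝ → ℝ} (hφ : CondPhi φ) : Continuous (flux φ : F → F) := by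
  have hc : Continuous fun a : F => φ ‖a‖ :=
    hφ.continuousOn.comp_continuous continuous_norm fun a => norm_nonneg a
  rw [continuous_iff_continuousAt]
  intro a
  rcases eq_or_ne a 0 with rfl | h
  · have h0 : flux φ (0 : F) = 0 := by simp [flux]
    rw [ContinuousAt, h0, tendsto_zero_iff_norm_tendsto_zero]
    simp only [norm_flux hφ]
    have := hc.tendsto 0
    rwa [norm_zero, hφ.map_zero] at this
  · exact ((continuous_norm.continuousAt.inv₀ (norm_ne_zero_iff.2 h)).mul hc.continuousAt).smul
      continuousAt_id

/-- The flux is a monotone vector field. -/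
theorem inner_flux_sub_nonneg {φ : ℝ → ℝ} (hφ : CondPhi φ) (a b : F) :
    0 ≤ inner ℝ (flux φ a - flux φ b) (a - b) := by
  have haa : ∀ a : F, inner ℝ (flux φ a) a = φ ‖a‖ * ‖a‖ := by
    intro a
    rw [flux, real_inner_smul_left, real_inner_self_eq_norm_sq]
    rcases eq_or_ne a 0 with rfl | h
    · simp
    · have := norm_pos_iff.2 h
      field_simp
  have h1 : inner ℝ (flux φ a) b ≤ φ ‖a‖ * ‖b‖ := by
    rw [← norm_flux hφ a]; exact real_inner_le_norm _ _
  have h2 : inner ℝ (flux φ b) a ≤ φ ‖b‖ * ‖a‖ := by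
    rw [← norm_flux hφ b]; exact real_inner_le_norm _ _
  rw [inner_sub_left, inner_sub_right, inner_sub_right, haa, haa]
  -- By Cauchy–Schwarz the inner product is at least this scalar quantity, whose two factors have
  -- the same sign.
  have hm : 0 ≤ (φ ‖a‖ - φ ‖b‖) * (‖a‖ - ‖b‖) := by
    rcases le_total ‖a‖ ‖b‖ with h | h
    · exact mul_nonneg_of_nonpos_of_nonpos
        (sub_nonpos.2 (hφ.strictMonoOn.monotoneOn (norm_nonneg _) (norm_nonneg _) h))
        (sub_nonpos.2 h)
    · exact mul_nonneg
        (sub_nonneg.2 (hφ.strictMonoOn.monotoneOn (norm_nonneg _) (norm_nonneg _) h))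
        (sub_nonneg.2 h)
  nlinarith

end Flux

/-! ### The barrier is a supersolution: pointwise computations -/

/-- The derivative of the flux coefficient along the gradient of the gauge, in terms of curves
`N, S` that move like `gaugeFour` and `zSq`. -/
theorem hasDerivAt_fluxCoeff {N S : ℝ → ℝ} {p Γ : ℝ → ℝ} {x N₀ S₀ p' γ : ℝ} (hN : N x = N₀)
    (hS : S x = S₀) (hN₀ : 0 < N₀) (hS₀ : 0 < S₀) (hNd : HasDerivAt N (16 * S₀ * N₀) x)
    (hSd : HasDerivAt S (8 * S₀ ^ 2) x) (hp : HasDerivAt p p' √√N₀)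
    (hΓ : HasDerivAt Γ γ (p √√N₀ * √S₀ / √√N₀)) :
    HasDerivAt (fun t => Γ (p √√(N t) * √(S t) / √√(N t)) / (4 * √√(N t) ^ 2 * √(S t)))
      (γ * p' * (S₀ / √√N₀ ^ 2) -
        Γ (p √√N₀ * √S₀ / √√N₀) * (3 * √S₀ / √√N₀ ^ 2)) x := by
  subst hN hS
  have hr0 : 0 < √√(N x) := Real.sqrt_pos.2 (Real.sqrt_pos.2 hN₀)
  have hz0 : 0 < √(S x) := Real.sqrt_pos.2 hS₀
  have hr4 : √√(N x) ^ 4 = N x := by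
    rw [show √√(N x) ^ 4 = (√√(N x) ^ 2) ^ 2 by ring, Real.sq_sqrt (Real.sqrt_nonneg _),
      Real.sq_sqrt hN₀.le]
  have hr2 : √(N x) = √√(N x) ^ 2 := (Real.sq_sqrt (Real.sqrt_nonneg _)).symm
  have hz2 : √(S x) ^ 2 = S x := Real.sq_sqrt hS₀.le
  have hrd : HasDerivAt (fun t => √√(N t)) (4 * √(S x) ^ 2 * √√(N x)) x := by
    refine ((hNd.sqrt hN₀.ne').sqrt (Real.sqrt_pos.2 hN₀).ne').congr_deriv ?_
    rw [hr2]
    nth_rewrite 1 [← hr4]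
    nth_rewrite 1 [← hz2]
    rw [Real.sqrt_sq hr0.le]
    field_simp
    ring
  have hzd : HasDerivAt (fun t => √(S t)) (4 * √(S x) ^ 3) x := by
    refine (hSd.sqrt hS₀.ne').congr_deriv ?_
    nth_rewrite 1 [← hz2]
    field_simp
    ring
  generalize hr : (fun t => √√(N t)) = r at *
  generalize hz : (fun t => √(S t)) = z at *
  have hrx : ∀ t, √√(N t) = r t := fun t => congrFun hr t
  have hzx : ∀ t, √(S t) = z t := fun t => congrFun hz t
  simp only [hrx, hzx] at *
  rw [← hz2]
  -- The quotient `z / r` has zero derivative here: the logarithmic derivatives of `z` and `r` are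
  -- both `4 z²`. Only `p` contributes to the derivative of the gradient length.
  have h1 : HasDerivAt (fun t => p (r t) * z t / r t) _ x :=
    ((HasDerivAt.comp x hp hrd).mul hzd).div hrd hr0.ne'
  have h2 : HasDerivAt (fun t => Γ (p (r t) * z t / r t)) _ x := HasDerivAt.comp x hΓ h1
  refine (h2.div (((hrd.pow 2).const_mul 4).mul hzd)
    (by simp only [Pi.mul_apply, Pi.pow_apply]; positivity)).congr_deriv ?_
  simp only [Function.comp, Pi.mul_apply, Pi.pow_apply]
  field_simp
  ring

/-- The differential inequality for the barrier at a point where the gradient is nonzero. -/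
theorem flux_divergence_le {φ : ℝ → ℝ} {D C κ p p' r σ H A γ G c : ℝ} (hφ : CondPhi φ)
    (hD : ∀ s : ℝ, 0 ≤ s → s ≤ 1 → ∀ t : ℝ, 0 < t → s * deriv φ (s * t) ≤ D * deriv φ t)
    (hD0 : 0 < D) (hC : 0 < C) (hp : 0 < p) (hr : 0 < r) (hσ : 0 < σ) (hσ1 : σ ≤ 1) (hH : 0 ≤ H)
    (hA : 0 < A) (hκ : 0 < κ) (hc : 0 ≤ c)
    (h1 : deriv φ p * (p' + H * p ^ 2) ≤ κ * A) (h2 : H * (p ^ 2 * deriv φ p) ≤ κ * A)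
    (h3 : φ p ≤ κ * r * A) (hγ0 : 0 ≤ γ) (hγ1 : γ ≤ 1) (hG : G ≤ φ (p * σ)) :
    γ * deriv φ (p * σ) * p' * σ ^ 2 + c * G * (σ / r) +
      H * (C * (p * σ) ^ 2 * deriv φ (p * σ)) ≤ (D + c + C * D) * κ * A := by
  have hd := hφ.deriv_pos (p * σ) (by positivity)
  have hdp := hφ.deriv_pos p hp
  have hDσ : σ * deriv φ (p * σ) ≤ D * deriv φ p := by
    rw [mul_comm p]; exact hD σ hσ.le hσ1 p hp
  have hκA : 0 < κ * A := mul_pos hκ hA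
  have hDσ2 : σ ^ 2 * deriv φ (p * σ) ≤ D * deriv φ p := by nlinarith [mul_pos hσ hd]
  have t1 : γ * deriv φ (p * σ) * p' * σ ^ 2 ≤ D * κ * A := by
    -- The sign of `p'` is unknown, so the bound on `σ² φ'(pσ)` cannot be multiplied by it. Adding
    -- `H p² ≥ 0` produces the quantity controlled by `h1`, and a negative value of it is harmless.
    have e1 : γ * deriv φ (p * σ) * p' * σ ^ 2 ≤
        (γ * (σ ^ 2 * deriv φ (p * σ))) * (p' + H * p ^ 2) := by
      have : 0 ≤ (γ * (σ ^ 2 * deriv φ (p * σ))) * (H * p ^ 2) := by positivity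
      nlinarith
    refine e1.trans ?_
    rcases le_total (p' + H * p ^ 2) 0 with h | h
    · have : 0 ≤ γ * (σ ^ 2 * deriv φ (p * σ)) := by positivity
      nlinarith [mul_pos hD0 hκA]
    · have e2 : γ * (σ ^ 2 * deriv φ (p * σ)) ≤ D * deriv φ p := by
        have : 0 < σ ^ 2 * deriv φ (p * σ) := by positivity
        nlinarith
      nlinarith [mul_le_mul_of_nonneg_right e2 h]
  have t2 : c * G * (σ / r) ≤ c * κ * A := by
    have e1 : G ≤ κ * r * A := by
      refine (hG.trans ?_).trans h3
      exact hφ.strictMonoOn.monotoneOn (mul_pos hp hσ).le hp.le (by nlinarith)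
    calc c * G * (σ / r) ≤ c * (κ * r * A) * (1 / r) := by gcongr
      _ = c * κ * A := by field_simp
  have t3 : H * (C * (p * σ) ^ 2 * deriv φ (p * σ)) ≤ C * D * κ * A := by
    calc H * (C * (p * σ) ^ 2 * deriv φ (p * σ))
        = C * (H * p ^ 2) * (σ ^ 2 * deriv φ (p * σ)) := by ring
      _ ≤ C * (H * p ^ 2) * (D * deriv φ p) := by gcongr
      _ = C * D * (H * (p ^ 2 * deriv φ p)) := by ring
      _ ≤ C * D * (κ * A) := by gcongr
      _ = C * D * κ * A := by ring
  linarith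

/-! ### The barrier -/

/-- A radial profile `α`, with derivative `p` and second derivative `p'`, that blows up at `R` and
satisfies the differential inequalities making `α(gauge)` a supersolution. -/
structure IsProfile (φ f h : ℝ → ℝ) (ε κ R : ℝ) (α p p' : ℝ → ℝ) : Prop where
  eps_pos : 0 < ε
  one_lt : 1 < R
  of_le_one : ∀ r, r ≤ 1 → α r = ε ∧ p r = 0
  hasDerivAt : ∀ r, r < R → HasDerivAt α (p r) r
  continuousOn : ContinuousOn p (Iio R)
  continuousOn' : ContinuousOn p' (Ioo 1 R)
  ineq : ∀ r, 1 < r → r < R → ε < α r ∧ 0 < p r ∧ HasDerivAt p (p' r) r ∧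
        deriv φ (p r) * (p' r + h (α r) * p r ^ 2) ≤ κ * f (α r) ∧
        h (α r) * (p r ^ 2 * deriv φ (p r)) ≤ κ * f (α r) ∧
        φ (p r) ≤ κ * r * f (α r)

theorem contDiffOn_one_of_hasDerivAt {k k' : ℝ → ℝ} {s : Set ℝ} (hs : IsOpen s)
    (hk : ∀ x ∈ s, HasDerivAt k (k' x) x) (hk' : ContinuousOn k' s) : ContDiffOn ℝ 1 k s := by
  rw [← zero_add (1 : WithTop ℕ∞), contDiffOn_succ_iff_deriv_of_isOpen hs]
  refine ⟨fun x hx => (hk x hx).differentiableAt.differentiableWithinAt, by simp, ?_⟩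
  rw [contDiffOn_zero]
  exact hk'.congr fun x hx => (hk x hx).deriv

section Barrier

variable {φ f h : ℝ → ℝ} {ε κ R : ℝ} {α p p' : ℝ → ℝ} {m : ℕ}

theorem gauge_pow_four (q : Point m) : gauge q ^ 4 = gaugeFour q := by
  rw [show gauge q ^ 4 = (gauge q ^ 2) ^ 2 by ring, gauge, Real.sq_sqrt (Real.sqrt_nonneg _),
    Real.sq_sqrt (gaugeFour_nonneg q)]

theorem gauge_nonneg (q : Point m) : 0 ≤ gauge q := Real.sqrt_nonneg _

theorem gaugeFour_pos {q : Point m} (hq : 0 < gauge q) : 0 < gaugeFour q := by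
  rw [← gauge_pow_four]; positivity

theorem contDiffAt_gauge {q : Point m} (hq : 0 < gauge q) : ContDiffAt ℝ 1 gauge q := by
  have h := gaugeFour_pos hq
  exact (contDiff_gaugeFour.contDiffAt.sqrt h.ne').sqrt (Real.sqrt_pos.2 h).ne'

theorem fderiv_gauge {q : Point m} (hq : 0 < gauge q) (w : Point m) :
    fderiv ℝ gauge q w = fderiv ℝ gaugeFour q w / (4 * gauge q ^ 3) := by
  have h := gaugeFour_pos hq
  have h2 : √(gaugeFour q) = gauge q ^ 2 := (Real.sq_sqrt (Real.sqrt_nonneg _)).symm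
  have hd : HasFDerivAt (gauge (m := m)) _ q :=
    ((contDiff_gaugeFour.differentiable one_ne_zero q).hasFDerivAt.sqrt h.ne').sqrt
      (Real.sqrt_pos.2 h).ne'
  rw [hd.fderiv]
  simp only [smul_apply, smul_eq_mul, h2, Real.sqrt_sq (gauge_nonneg q)]
  field_simp
  ring

/-- This puts the ratio `√zSq / gauge` in `[0,1]`, the range of the scaling parameter in (Φ2). -/
theorem zSq_le_gauge_sq (q : Point m) : zSq q ≤ gauge q ^ 2 := by
  have h2 : √(gaugeFour q) = gauge q ^ 2 := (Real.sq_sqrt (Real.sqrt_nonneg _)).symm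
  rw [← h2]
  refine Real.le_sqrt_of_sq_le ?_
  unfold gaugeFour
  nlinarith [sq_nonneg q.2.2]

theorem isOpen_gauge_lt (R : ℝ) : IsOpen {q : Point m | gauge q < R} :=
  isOpen_lt continuous_gauge continuous_const

theorem IsProfile.eventuallyEq_const (hP : IsProfile φ f h ε κ R α p p') {q : Point m}
    (hq : gauge q < 1) : (fun q : Point m => α (gauge q)) =ᶠ[𝓝 q] fun _ => ε := by
  filter_upwards [(isOpen_gauge_lt 1).mem_nhds hq] with y hy
  exact (hP.of_le_one _ (le_of_lt hy)).1

/-- The gauge is not differentiable at the origin, but `α` is constant for `r ≤ 1`, so the barrier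
is constant there; elsewhere the chain rule applies. -/
theorem IsProfile.contDiffOn (hP : IsProfile φ f h ε κ R α p p') :
    ContDiffOn ℝ 1 (fun q : Point m => α (gauge q)) {q | gauge q < R} := by
  intro q hq
  refine ContDiffAt.contDiffWithinAt ?_
  rcases lt_or_ge (gauge q) 1 with h1 | h1
  · exact contDiffAt_const.congr_of_eventuallyEq (hP.eventuallyEq_const h1)
  · exact ((contDiffOn_one_of_hasDerivAt isOpen_Iio hP.hasDerivAt
      hP.continuousOn).contDiffAt (Iio_mem_nhds hq)).comp q
        (contDiffAt_gauge (zero_lt_one.trans_le h1))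

theorem IsProfile.hgrad_eq (hP : IsProfile φ f h ε κ R α p p') {q : Point m}
    (hq0 : 0 < gauge q) (hq : gauge q < R) :
    hgrad (fun q : Point m => α (gauge q)) q =
      (p (gauge q) / (4 * gauge q ^ 3)) • WithLp.toLp 2 (fun i => gaugeFourGrad i q) := by
  have hd := (hP.hasDerivAt _ hq).comp_hasFDerivAt q
    ((contDiffAt_gauge hq0).differentiableAt one_ne_zero).hasFDerivAt
  ext i
  rw [hgrad_apply]
  change fderiv ℝ (α ∘ gauge) q (frame i q) = _
  rw [hd.fderiv]
  simp only [smul_apply, smul_eq_mul, fderiv_gauge hq0, fderiv_gaugeFour_frame, PiLp.smul_apply]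
  ring

theorem IsProfile.hgrad_eq_zero (hP : IsProfile φ f h ε κ R α p p') {q : Point m}
    (hq : gauge q ≤ 1) : hgrad (fun q : Point m => α (gauge q)) q = 0 := by
  rcases hq.lt_or_eq with h1 | h1
  · ext i
    rw [hgrad_apply, (hP.eventuallyEq_const h1).fderiv_eq]
    simp
  · rw [hP.hgrad_eq (by linarith) (by linarith [hP.one_lt]), (hP.of_le_one _ hq).2]
    simp

theorem norm_gaugeFourGrad {q : Point m} :
    ‖(WithLp.toLp 2 (fun i => gaugeFourGrad i q) : EuclideanSpace ℝ (Fin m ⊕ Fin m))‖ =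
      4 * √(zSq q) * gauge q ^ 2 := by
  rw [EuclideanSpace.norm_eq]
  simp only [Real.norm_eq_abs, sq_abs, pow_two (gaugeFourGrad _ _)]
  rw [sum_gaugeFourGrad_sq, Real.sqrt_mul (by have := zSq_nonneg q; positivity),
    Real.sqrt_mul (by norm_num), gauge, Real.sq_sqrt (Real.sqrt_nonneg _)]
  congr 2
  rw [show (16 : ℝ) = 4 ^ 2 by norm_num, Real.sqrt_sq (by norm_num)]

/-- The barrier gradient is shorter than `p` by the factor `|z| / gauge`, which vanishes on the
vertical axis. The axis is thus a second degenerate set, besides the unit gauge ball. -/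
theorem IsProfile.norm_hgrad (hP : IsProfile φ f h ε κ R α p p') {q : Point m}
    (hq1 : 1 < gauge q) (hq : gauge q < R) :
    ‖hgrad (fun q : Point m => α (gauge q)) q‖ = p (gauge q) * √(zSq q) / gauge q := by
  have hq0 : 0 < gauge q := by linarith
  have hp := (hP.ineq _ hq1 hq).2.1
  rw [hP.hgrad_eq hq0 hq, norm_smul, norm_gaugeFourGrad, Real.norm_of_nonneg (by positivity)]
  field_simp

theorem isOpen_regular (R : ℝ) : IsOpen {q : Point m | (1 < gauge q ∧ gauge q < R) ∧ 0 < zSq q} :=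
  ((isOpen_lt continuous_const continuous_gauge).inter (isOpen_gauge_lt R)).inter
    (isOpen_lt continuous_const contDiff_zSq.continuous)

theorem IsProfile.regular_of_hgrad_ne_zero (hP : IsProfile φ f h ε κ R α p p') {q : Point m}
    (hq : gauge q < R) (hne : hgrad (fun q : Point m => α (gauge q)) q ≠ 0) :
    (1 < gauge q ∧ gauge q < R) ∧ 0 < zSq q := by
  have h1 : 1 < gauge q := by
    by_contra h1
    exact hne (hP.hgrad_eq_zero (not_lt.1 h1))
  refine ⟨⟨h1, hq⟩, lt_of_le_of_ne (zSq_nonneg q) fun h0 => hne ?_⟩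
  rw [← norm_eq_zero, hP.norm_hgrad h1 hq, ← h0]
  simp

/-- The coefficient of `gaugeFourGrad` in the truncated flux of the barrier. -/
noncomputable def fluxCoeff (Γ p : ℝ → ℝ) (q : Point m) : ℝ :=
  Γ (p (gauge q) * √(zSq q) / gauge q) / (4 * gauge q ^ 2 * √(zSq q))

theorem IsProfile.flux_eq (hP : IsProfile φ f h ε κ R α p p') (Γ : ℝ → ℝ) {q : Point m}
    (hq : (1 < gauge q ∧ gauge q < R) ∧ 0 < zSq q) (i : Fin m ⊕ Fin m) :
    ‖hgrad (fun q : Point m => α (gauge q)) q‖⁻¹ *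
      Γ ‖hgrad (fun q : Point m => α (gauge q)) q‖ * hgrad (fun q : Point m => α (gauge q)) q i =
      fluxCoeff Γ p q * gaugeFourGrad i q := by
  have hq0 : 0 < gauge q := by linarith [hq.1.1]
  have hp := (hP.ineq _ hq.1.1 hq.1.2).2.1
  have hz := Real.sqrt_pos.2 hq.2
  rw [hP.norm_hgrad hq.1.1 hq.1.2, hP.hgrad_eq hq0 hq.1.2, fluxCoeff, PiLp.smul_apply]
  simp only [smul_eq_mul]
  field_simp

theorem IsProfile.contDiffAt_fluxCoeff (hP : IsProfile φ f h ε κ R α p p') {Γ : ℝ → ℝ}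
    (hΓ : ContDiffOn ℝ 1 Γ (Ioi 0)) {q : Point m}
    (hq : (1 < gauge q ∧ gauge q < R) ∧ 0 < zSq q) : ContDiffAt ℝ 1 (fluxCoeff Γ p) q := by
  have hq0 : 0 < gauge q := by linarith [hq.1.1]
  have hp := (hP.ineq _ hq.1.1 hq.1.2).2.1
  have hz := Real.sqrt_pos.2 hq.2
  have h1 := contDiffAt_gauge hq0
  have h2 : ContDiffAt ℝ 1 (fun q : Point m => √(zSq q)) q :=
    contDiff_zSq.contDiffAt.sqrt hq.2.ne'
  have h3 : ContDiffAt ℝ 1 (fun q : Point m => p (gauge q)) q :=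
    ((contDiffOn_one_of_hasDerivAt isOpen_Ioo (fun x hx => (hP.ineq x hx.1 hx.2).2.2.1)
      hP.continuousOn').contDiffAt (Ioo_mem_nhds hq.1.1 hq.1.2)).comp q h1
  have h4 : ContDiffAt ℝ 1 (fun q : Point m => Γ (p (gauge q) * √(zSq q) / gauge q)) q :=
    (hΓ.contDiffAt (Ioi_mem_nhds (by positivity))).comp q ((h3.mul h2).div h1 hq0.ne')
  exact h4.div ((contDiffAt_const.mul (h1.pow 2)).mul h2) (by positivity)

/-- The horizontal divergence of the truncated flux of the barrier. -/
theorem IsProfile.sum_fderiv_flux (hP : IsProfile φ f h ε κ R α p p') {Γ : ℝ → ℝ} {γ : ℝ}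
    (hΓ : ContDiffOn ℝ 1 Γ (Ioi 0)) {q : Point m}
    (hq : (1 < gauge q ∧ gauge q < R) ∧ 0 < zSq q)
    (hγ : HasDerivAt Γ γ (p (gauge q) * √(zSq q) / gauge q)) :
    ∑ i, fderiv ℝ (fun q => fluxCoeff Γ p q * gaugeFourGrad i q) q (frame i q) =
      γ * p' (gauge q) * (√(zSq q) / gauge q) ^ 2 +
        (2 * m + 1) * Γ (p (gauge q) * √(zSq q) / gauge q) * ((√(zSq q) / gauge q) / gauge q) := by
  have hq0 : 0 < gauge q := by linarith [hq.1.1]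
  have hz := Real.sqrt_pos.2 hq.2
  have hΨ : DifferentiableAt ℝ (fluxCoeff Γ p) q :=
    (hP.contDiffAt_fluxCoeff hΓ hq).differentiableAt one_ne_zero
  -- `E` is the horizontal gradient of `gaugeFour` as a vector of `Point m`. Differentiating along
  -- the line `q + t E` reduces the derivative of `fluxCoeff` to the one-variable computation of
  -- `hasDerivAt_fluxCoeff`.
  set E : Point m := ∑ i, gaugeFourGrad i q • frame i q with hE
  have hline : ∀ k : Point m → ℝ, fderiv ℝ k q E = ∑ i, gaugeFourGrad i q *
      fderiv ℝ k q (frame i q) := fun k => by simp [hE, map_sum]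
  have hcurve : ∀ k : Point m → ℝ, DifferentiableAt ℝ k q →
      HasDerivAt (fun t : ℝ => k (q + t • E)) (fderiv ℝ k q E) 0 := fun k hk =>
    hk.hasFDerivAt.hasLineDerivAt E
  have hN := hcurve _ (contDiff_gaugeFour.differentiable one_ne_zero q)
  rw [hline] at hN
  simp only [fderiv_gaugeFour_frame, sum_gaugeFourGrad_sq] at hN
  have hS := hcurve _ (contDiff_zSq.differentiable one_ne_zero q)
  rw [hline, sum_gaugeFourGrad_mul_fderiv_zSq] at hS
  have hd := hasDerivAt_fluxCoeff (p := p) (Γ := Γ) (by simp) (by simp) (gaugeFour_pos hq0) hq.2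
    hN hS ((hP.ineq _ hq.1.1 hq.1.2).2.2.1) hγ
  have hEΨ := (hcurve _ hΨ).unique hd
  have hprod : ∀ i, fderiv ℝ (fun q => fluxCoeff Γ p q * gaugeFourGrad i q) q (frame i q) =
      gaugeFourGrad i q * fderiv ℝ (fluxCoeff Γ p) q (frame i q) +
      fluxCoeff Γ p q * fderiv ℝ (gaugeFourGrad i) q (frame i q) := by
    intro i
    rw [fderiv_fun_mul hΨ ((contDiff_gaugeFourGrad i).differentiable one_ne_zero q)]
    simp only [add_apply, smul_apply, smul_eq_mul]
    ring
  -- The coefficient `2m + 1` arises as `2(m + 2)`, from the sub-Laplacian of `gaugeFour`, minus the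
  -- `3` from the derivative of the denominator of `fluxCoeff`.
  simp only [hprod, Finset.sum_add_distrib, ← Finset.mul_sum, sum_fderiv_gaugeFourGrad]
  rw [← hline, hEΨ]
  change γ * p' (gauge q) * (zSq q / gauge q ^ 2) - Γ (p (gauge q) * √(zSq q) / gauge q) *
    (3 * √(zSq q) / gauge q ^ 2) + _ = _
  rw [fluxCoeff]
  have hz2 : zSq q = √(zSq q) ^ 2 := (Real.sq_sqrt hq.2.le).symm
  generalize √(zSq q) = z at *
  rw [hz2]
  field_simp
  ring

end Barrier

/-! ### The barrier is a weak supersolution -/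

theorem inner_hgrad_eq_sum {m : ℕ} (a : EuclideanSpace ℝ (Fin m ⊕ Fin m)) (ζ : Point m → ℝ)
    (q : Point m) : inner ℝ a (hgrad ζ q) = ∑ i, a i * fderiv ℝ ζ q (frame i q) := by
  simp [PiLp.inner_apply, hgrad_apply, mul_comm]

theorem integrable_mul_fderiv_frame {m : ℕ} {U : Set (Point m)} {ζ : Point m → ℝ}
    {F : Point m → ℝ} (hU : IsOpen U) (hF : ContinuousOn F U) (hζ : ContDiff ℝ 1 ζ)
    (hc : HasCompactSupport ζ) (hsub : tsupport ζ ⊆ U) (i : Fin m ⊕ Fin m) :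
    Integrable (fun q => F q * fderiv ℝ ζ q (frame i q)) :=
  integrable_mul_of_tsupport_subset hU hF
    ((hζ.continuous_fderiv one_ne_zero).clm_apply (continuous_frame i))
    (hasCompactSupport_fderiv_apply hc _) ((tsupport_fderiv_apply_subset' _).trans hsub)

theorem integrable_inner_hgrad {m : ℕ} {U : Set (Point m)} {ζ : Point m → ℝ}
    {F : Point m → EuclideanSpace ℝ (Fin m ⊕ Fin m)} (hU : IsOpen U) (hF : ContinuousOn F U)
    (hζ : ContDiff ℝ 1 ζ) (hc : HasCompactSupport ζ) (hsub : tsupport ζ ⊆ U) :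
    Integrable (fun q => inner ℝ (F q) (hgrad ζ q)) := by
  simp only [inner_hgrad_eq_sum]
  exact integrable_finsetSum _ fun i _ => integrable_mul_fderiv_frame hU
    ((EuclideanSpace.proj (𝕜 := ℝ) i).continuous.comp_continuousOn hF) hζ hc hsub i

theorem hasCompactSupport_hgrad {m : ℕ} {ζ : Point m → ℝ} (hc : HasCompactSupport ζ) :
    HasCompactSupport (hgrad ζ) := by
  refine hc.of_isClosed_subset (isClosed_tsupport _)
    (closure_minimal (fun q hq => ?_) (isClosed_tsupport ζ))
  by_contra h
  refine hq ?_
  have : fderiv ℝ ζ q = 0 := by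
    by_contra h'
    exact h (support_fderiv_subset ℝ h')
  ext i
  simp [hgrad_apply, this]

theorem integrable_norm_hgrad {m : ℕ} {ζ : Point m → ℝ} (hζ : ContDiff ℝ 1 ζ)
    (hc : HasCompactSupport ζ) : Integrable (fun q => ‖hgrad ζ q‖) := by
  refine Continuous.integrable_of_hasCompactSupport ?_ (hasCompactSupport_hgrad hc).norm
  exact (continuousOn_univ.1 (continuousOn_hgrad isOpen_univ hζ.contDiffOn)).norm

/-- At zero, the hypothesis with `t = 1` bounds `s φ'(s)` by a constant, so `s² φ'(s)` tends to `0`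
even if `φ'` is unbounded there. -/
theorem continuousOn_sq_mul_deriv {φ : ℝ → ℝ} {D : ℝ} (hφ : CondPhi φ)
    (hD : ∀ s : ℝ, 0 ≤ s → s ≤ 1 → ∀ t : ℝ, 0 < t → s * deriv φ (s * t) ≤ D * deriv φ t) (C : ℝ) :
    ContinuousOn (fun s => C * s ^ 2 * deriv φ s) (Ici 0) := by
  intro s hs
  rcases (show (0 : ℝ) ≤ s from hs).eq_or_lt with rfl | hs
  · have h1 : Tendsto (fun s => s ^ 2 * deriv φ s) (𝓝[≥] 0) (𝓝 0) := by
      have h2 : Tendsto (fun s : ℝ => s * (D * deriv φ 1)) (𝓝[≥] 0) (𝓝 0) := by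
        have : Tendsto (fun s : ℝ => s * (D * deriv φ 1)) (𝓝 0) (𝓝 (0 * (D * deriv φ 1))) :=
          tendsto_id.mul_const _
        rw [zero_mul] at this
        exact this.mono_left nhdsWithin_le_nhds
      refine tendsto_of_tendsto_of_tendsto_of_le_of_le' tendsto_const_nhds h2 ?_ ?_
      · filter_upwards [self_mem_nhdsWithin] with x hx
        rcases (show (0 : ℝ) ≤ x from hx).eq_or_lt with rfl | hx
        · simp
        · have := hφ.deriv_pos x hx
          positivity
      · filter_upwards [self_mem_nhdsWithin, mem_nhdsWithin_of_mem_nhds (Iic_mem_nhds one_pos)]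
          with x hx hx1
        have := hD x hx hx1 1 one_pos
        rw [mul_one] at this
        calc x ^ 2 * deriv φ x = x * (x * deriv φ x) := by ring
          _ ≤ x * (D * deriv φ 1) := mul_le_mul_of_nonneg_left this hx
    have h3 := h1.const_mul C
    simp only [ContinuousWithinAt]
    convert h3 using 2 <;> ring
  · exact ((continuousAt_const.mul (continuousAt_id.pow 2)).mul
      (hφ.continuousOn_deriv.continuousAt (Ioi_mem_nhds hs))).continuousWithinAt

section Barrier

variable {φ f h : ℝ → ℝ} {ε κ R : ℝ} {α p p' : ℝ → ℝ} {m : ℕ}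

theorem IsProfile.eps_le (hP : IsProfile φ f h ε κ R α p p') {r : ℝ} (hr : r < R) : ε ≤ α r := by
  rcases le_or_gt r 1 with h | h
  · exact (hP.of_le_one r h).1.ge
  · exact (hP.ineq r h hr).1.le

theorem IsProfile.continuousOn_source (hP : IsProfile φ f h ε κ R α p p') (hφ : CondPhi φ)
    (hf : CondF f) (hh : CondH h) {D : ℝ}
    (hD : ∀ s : ℝ, 0 ≤ s → s ≤ 1 → ∀ t : ℝ, 0 < t → s * deriv φ (s * t) ≤ D * deriv φ t) (C : ℝ) :
    ContinuousOn (fun q : Point m => 1 / 2 * f (α (gauge q)) - h (α (gauge q)) *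
      (C * ‖hgrad (fun q : Point m => α (gauge q)) q‖ ^ 2 *
        deriv φ ‖hgrad (fun q : Point m => α (gauge q)) q‖)) {q | gauge q < R} := by
  have hpos : ∀ q ∈ {q : Point m | gauge q < R}, 0 < α (gauge q) := fun q hq =>
    hP.eps_pos.trans_le (hP.eps_le hq)
  have hvc := hP.contDiffOn (m := m) |>.continuousOn
  refine ContinuousOn.sub (continuousOn_const.mul (hf.continuousOn.comp hvc fun q hq =>
    (hpos q hq).le)) ((hh.continuousOn.comp hvc hpos).mul ?_)
  exact (continuousOn_sq_mul_deriv hφ hD C).comp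
    (continuousOn_hgrad (isOpen_gauge_lt R) hP.contDiffOn).norm fun q _ => norm_nonneg _

/-- The barrier is a supersolution for the truncated operator. -/
theorem IsProfile.truncated_supersolution (hP : IsProfile φ f h ε κ R α p p') (hφ : CondPhi φ)
    (hf : CondF f) (hh : CondH h) {D C : ℝ}
    (hD : ∀ s : ℝ, 0 ≤ s → s ≤ 1 → ∀ t : ℝ, 0 < t → s * deriv φ (s * t) ≤ D * deriv φ t)
    (hD0 : 0 < D) (hC : 0 < C) (hκ : 0 < κ) (hκ' : (D + (2 * m + 1) + C * D) * κ ≤ 1 / 2)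
    {ζ : Point m → ℝ} (hζ : ContDiff ℝ 1 ζ) (hc : HasCompactSupport ζ)
    (hsub : tsupport ζ ⊆ {q | gauge q < R}) (hζ0 : ∀ q, 0 ≤ ζ q) {δ : ℝ} (hδ : 0 < δ)
    {G : ℝ → ℝ} (hG : ContDiff ℝ 1 G) (hG' : ∀ y, 0 ≤ deriv G y ∧ deriv G y ≤ 1)
    (hGδ : ∀ y, y ≤ δ → G y = 0) (hGy : ∀ y, 0 ≤ y → G y ≤ y) :
    -∫ q, inner ℝ ((‖hgrad (fun q : Point m => α (gauge q)) q‖⁻¹ *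
          G (φ ‖hgrad (fun q : Point m => α (gauge q)) q‖)) •
          hgrad (fun q : Point m => α (gauge q)) q) (hgrad ζ q) ≤
      ∫ q, (1 / 2 * f (α (gauge q)) - h (α (gauge q)) *
        (C * ‖hgrad (fun q : Point m => α (gauge q)) q‖ ^ 2 *
          deriv φ ‖hgrad (fun q : Point m => α (gauge q)) q‖)) * ζ q := by
  have hU : IsOpen {q : Point m | gauge q < R} := isOpen_gauge_lt R
  have hEc := hP.continuousOn_source (m := m) hφ hf hh hD C
  set V : Point m → EuclideanSpace ℝ (Fin m ⊕ Fin m) :=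
    hgrad (fun q : Point m => α (gauge q)) with hV
  have hVc : ContinuousOn V {q : Point m | gauge q < R} := continuousOn_hgrad hU hP.contDiffOn
  set W : (Fin m ⊕ Fin m) → Point m → ℝ := fun i q => ‖V q‖⁻¹ * G (φ ‖V q‖) * V q i with hW
  set Γ : ℝ → ℝ := fun s => G (φ s) with hΓ
  have hΓc : ContDiffOn ℝ 1 Γ (Ioi 0) := hG.comp_contDiffOn hφ.contDiffOn
  have hWreg : ∀ q : Point m, (1 < gauge q ∧ gauge q < R) ∧ 0 < zSq q → ∀ i,
      W i =ᶠ[𝓝 q] fun q => fluxCoeff Γ p q * gaugeFourGrad i q := by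
    intro q hq i
    filter_upwards [(isOpen_regular R).mem_nhds hq] with y hy
    exact hP.flux_eq Γ hy i
  -- Near a critical point `φ(|V|)` stays below `δ`, where `G` vanishes. The truncated flux is
  -- locally zero, hence `C¹` across the degenerate set, and integration by parts is legitimate.
  have hWzero : ∀ q : Point m, gauge q < R → V q = 0 → ∀ i, W i =ᶠ[𝓝 q] fun _ => 0 := by
    intro q hq hVq i
    have h1 : ContinuousAt (fun q => φ ‖V q‖) q :=
      (hφ.continuousOn.comp hVc.norm fun q _ => norm_nonneg _).continuousAt (hU.mem_nhds hq)
    have h2 : φ ‖V q‖ < δ := by rwa [hVq, norm_zero, hφ.map_zero]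
    filter_upwards [h1.eventually_lt_const h2] with y hy
    simp [hW, hGδ _ hy.le]
  have hWd : ∀ i, ContDiffOn ℝ 1 (W i) {q : Point m | gauge q < R} := by
    intro i q hq
    refine ContDiffAt.contDiffWithinAt ?_
    by_cases hVq : V q = 0
    · exact contDiffAt_const.congr_of_eventuallyEq (hWzero q hq hVq i)
    · have hreg := hP.regular_of_hgrad_ne_zero hq hVq
      exact ((hP.contDiffAt_fluxCoeff hΓc hreg).mul
        (contDiff_gaugeFourGrad i).contDiffAt).congr_of_eventuallyEq (hWreg q hreg i)
  -- At critical points the divergence is `0` and the right side is `½ f(α) > 0`. Elsewhere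
  -- `flux_divergence_le` bounds the divergence plus the `h` term by a multiple of `κ f(α)`, which
  -- `hκ'` makes at most `½ f(α)`.
  have hdiv : ∀ q : Point m, gauge q < R → ∑ i, fderiv ℝ (W i) q (frame i q) ≤
      1 / 2 * f (α (gauge q)) - h (α (gauge q)) * (C * ‖V q‖ ^ 2 * deriv φ ‖V q‖) := by
    intro q hq
    have hαpos : 0 < α (gauge q) := hP.eps_pos.trans_le (hP.eps_le hq)
    have hfα := hf.pos _ hαpos
    by_cases hVq : V q = 0
    · have : ∀ i, fderiv ℝ (W i) q (frame i q) = 0 := fun i => by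
        rw [(hWzero q hq hVq i).fderiv_eq]; simp
      simp only [this, hVq, Finset.sum_const_zero, norm_zero]
      simp [hfα.le]
    · have hreg := hP.regular_of_hgrad_ne_zero hq hVq
      obtain ⟨_, hp0, _, h1, h2, h3⟩ := hP.ineq _ hreg.1.1 hreg.1.2
      have hr0 : 0 < gauge q := by linarith [hreg.1.1]
      have hz := Real.sqrt_pos.2 hreg.2
      set σ := √(zSq q) / gauge q with hσ
      have hσ0 : 0 < σ := by positivity
      have hσ1 : σ ≤ 1 := by
        rw [hσ, div_le_one hr0]
        exact Real.sqrt_le_iff.2 ⟨hr0.le, zSq_le_gauge_sq q⟩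
      have hs : p (gauge q) * √(zSq q) / gauge q = p (gauge q) * σ := by rw [hσ, mul_div_assoc]
      have hnorm : ‖V q‖ = p (gauge q) * σ := by
        rw [← hs]; exact hP.norm_hgrad hreg.1.1 hreg.1.2
      have hγ : HasDerivAt Γ (deriv G (φ (p (gauge q) * σ)) * deriv φ (p (gauge q) * σ))
          (p (gauge q) * √(zSq q) / gauge q) := by
        rw [hs]
        exact HasDerivAt.comp _ (hG.differentiable one_ne_zero _).hasDerivAt
          (hφ.hasDerivAt (mul_pos hp0 hσ0))
      have hsum : ∑ i, fderiv ℝ (W i) q (frame i q) =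
          ∑ i, fderiv ℝ (fun q => fluxCoeff Γ p q * gaugeFourGrad i q) q (frame i q) :=
        Finset.sum_congr rfl fun i _ => by rw [(hWreg q hreg i).fderiv_eq]
      rw [hsum, hP.sum_fderiv_flux hΓc hreg hγ, hs, hnorm]
      have key := flux_divergence_le (c := 2 * m + 1) (G := Γ (p (gauge q) * σ))
        (γ := deriv G (φ (p (gauge q) * σ))) hφ hD hD0 hC hp0 hr0 hσ0 hσ1
        (hh.nonneg _ hαpos) hfα hκ (by positivity) h1 h2 h3 (hG' _).1 (hG' _).2
        (hGy _ (hφ.nonneg (mul_pos hp0 hσ0).le))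
      have := mul_le_mul_of_nonneg_right hκ' hfα.le
      linarith
  have hWf : ∀ i, ContinuousOn (fun q => fderiv ℝ (W i) q (frame i q)) {q : Point m | gauge q < R} :=
    fun i => ((hWd i).continuousOn_fderiv_of_isOpen hU le_rfl).clm_apply
      (continuous_frame i).continuousOn
  calc -∫ q, inner ℝ ((‖V q‖⁻¹ * G (φ ‖V q‖)) • V q) (hgrad ζ q)
      = -∫ q, ∑ i, W i q * fderiv ℝ ζ q (frame i q) := by
        simp only [inner_hgrad_eq_sum, PiLp.smul_apply, smul_eq_mul, hW]
    _ = ∑ i, ∫ q, fderiv ℝ (W i) q (frame i q) * ζ q := by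
        rw [integral_finsetSum _ fun i _ =>
          integrable_mul_fderiv_frame hU (hWd i).continuousOn hζ hc hsub i,
          ← Finset.sum_neg_distrib]
        exact Finset.sum_congr rfl fun i _ => by
          rw [integral_mul_frame_eq_neg hU (hWd i) hζ hc hsub i, neg_neg]
    _ = ∫ q, (∑ i, fderiv ℝ (W i) q (frame i q)) * ζ q := by
        rw [← integral_finsetSum _ fun i _ =>
          integrable_mul_of_tsupport_subset hU (hWf i) hζ.continuous hc hsub]
        simp only [Finset.sum_mul]
    _ ≤ _ := by
        refine integral_mono (integrable_mul_of_tsupport_subset hU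
          (continuousOn_finsetSum _ fun i _ => hWf i) hζ.continuous hc hsub)
          (integrable_mul_of_tsupport_subset hU hEc hζ.continuous hc hsub) fun q => ?_
        by_cases hq : q ∈ tsupport ζ
        · exact mul_le_mul_of_nonneg_right (hdiv q (hsub hq)) (hζ0 q)
        · simp [image_eq_zero_of_notMem_tsupport hq]

/-- The barrier is a weak supersolution. -/
theorem IsProfile.supersolution (hP : IsProfile φ f h ε κ R α p p') (hφ : CondPhi φ)
    (hf : CondF f) (hh : CondH h) {D C : ℝ}
    (hD : ∀ s : ℝ, 0 ≤ s → s ≤ 1 → ∀ t : ℝ, 0 < t → s * deriv φ (s * t) ≤ D * deriv φ t)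
    (hD0 : 0 < D) (hC : 0 < C) (hκ : 0 < κ) (hκ' : (D + (2 * m + 1) + C * D) * κ ≤ 1 / 2)
    {ζ : Point m → ℝ} (hζ : ContDiff ℝ 1 ζ) (hc : HasCompactSupport ζ)
    (hsub : tsupport ζ ⊆ {q | gauge q < R}) (hζ0 : ∀ q, 0 ≤ ζ q) :
    -∫ q, inner ℝ (flux φ (hgrad (fun q : Point m => α (gauge q)) q)) (hgrad ζ q) ≤
      ∫ q, (1 / 2 * f (α (gauge q)) - h (α (gauge q)) *
        (C * ‖hgrad (fun q : Point m => α (gauge q)) q‖ ^ 2 *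
          deriv φ ‖hgrad (fun q : Point m => α (gauge q)) q‖)) * ζ q := by
  have hU : IsOpen {q : Point m | gauge q < R} := isOpen_gauge_lt R
  set V : Point m → EuclideanSpace ℝ (Fin m ⊕ Fin m) :=
    hgrad (fun q : Point m => α (gauge q)) with hV
  have hVc : ContinuousOn V {q : Point m | gauge q < R} := continuousOn_hgrad hU hP.contDiffOn
  set I : ℝ := ∫ q, ‖hgrad ζ q‖ with hI
  have hI0 : 0 ≤ I := integral_nonneg fun q => norm_nonneg _
  refine le_of_forall_pos_le_add fun η hη => ?_
  -- The truncation changes the flux by at most `2 δ` uniformly, so the integral changes by at most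
  -- `2 δ I ≤ η`. The `+ 1` covers `I = 0`.
  set δ : ℝ := η / (2 * (I + 1)) with hδ
  have hδ0 : 0 < δ := by positivity
  obtain ⟨G, hG, hG', hGδ, hGy⟩ := exists_truncation hδ0
  have key := hP.truncated_supersolution hφ hf hh hD hD0 hC hκ hκ' hζ hc hsub hζ0 hδ0 hG hG' hGδ
    fun y hy => (hGy y hy).2.1
  rw [← hV] at key
  have hpt : ∀ q, ‖flux φ (V q) - (‖V q‖⁻¹ * G (φ ‖V q‖)) • V q‖ ≤ 2 * δ := by
    intro q
    rw [flux, ← sub_smul, ← mul_sub, norm_smul]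
    obtain ⟨h1, h2, h3⟩ := hGy _ (hφ.nonneg (norm_nonneg (V q)))
    rw [Real.norm_of_nonneg (mul_nonneg (inv_nonneg.2 (norm_nonneg _)) (by linarith))]
    rcases eq_or_ne (V q) 0 with h0 | h0
    · rw [h0]; simp [hδ0.le]
    · have := norm_pos_iff.2 h0
      calc _ = φ ‖V q‖ - G (φ ‖V q‖) := by field_simp
        _ ≤ 2 * δ := by linarith
  have hfl : ContinuousOn (fun q => flux φ (V q)) {q : Point m | gauge q < R} :=
    (continuous_flux hφ).comp_continuousOn hVc
  have hint1 := integrable_inner_hgrad hU hfl hζ hc hsub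
  have hint3 := integrable_norm_hgrad hζ hc
  have hGφ : ContinuousOn (fun q => (‖V q‖⁻¹ * G (φ ‖V q‖)) • V q)
      {q : Point m | gauge q < R} := by
    have hcpt : ContinuousOn (fun a : EuclideanSpace ℝ (Fin m ⊕ Fin m) =>
        (‖a‖⁻¹ * G (φ ‖a‖)) • a) univ := by
      intro a _
      have hφc : Continuous fun a : EuclideanSpace ℝ (Fin m ⊕ Fin m) => φ ‖a‖ :=
        hφ.continuousOn.comp_continuous continuous_norm fun a => norm_nonneg a
      refine ContinuousAt.continuousWithinAt ?_
      rcases eq_or_ne a 0 with rfl | h0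
      · have h2 : φ ‖(0 : EuclideanSpace ℝ (Fin m ⊕ Fin m))‖ < δ := by
          rwa [norm_zero, hφ.map_zero]
        refine (continuousAt_const (y := (0 : EuclideanSpace ℝ (Fin m ⊕ Fin m)))).congr ?_
        filter_upwards [hφc.continuousAt.eventually_lt_const h2] with y hy
        simp [hGδ _ hy.le]
      · exact ((continuous_norm.continuousAt.inv₀ (norm_ne_zero_iff.2 h0)).mul
          (hG.continuous.comp hφc).continuousAt).smul continuousAt_id
    exact (continuousOn_univ.1 hcpt).comp_continuousOn hVc
  have hint2 := integrable_inner_hgrad hU hGφ hζ hc hsub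
  have hle : -∫ q, inner ℝ (flux φ (V q)) (hgrad ζ q) ≤
      -(∫ q, inner ℝ ((‖V q‖⁻¹ * G (φ ‖V q‖)) • V q) (hgrad ζ q)) + 2 * δ * I := by
    have hint2' : Integrable (fun q => -inner ℝ ((‖V q‖⁻¹ * G (φ ‖V q‖)) • V q) (hgrad ζ q)) :=
      hint2.neg
    rw [← integral_neg, ← integral_neg, hI, ← integral_const_mul, ← integral_add hint2'
      (hint3.const_mul _)]
    refine integral_mono hint1.neg (hint2'.add (hint3.const_mul _)) fun q => ?_
    have h1 := abs_real_inner_le_norm (flux φ (V q) - (‖V q‖⁻¹ * G (φ ‖V q‖)) • V q) (hgrad ζ q)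
    have h2 := mul_le_mul_of_nonneg_right (hpt q) (norm_nonneg (hgrad ζ q))
    rw [inner_sub_left] at h1
    have := neg_abs_le (inner ℝ (flux φ (V q)) (hgrad ζ q) -
      inner ℝ ((‖V q‖⁻¹ * G (φ ‖V q‖)) • V q) (hgrad ζ q))
    simp only
    linarith
  have hfin : 2 * δ * I ≤ η := by
    rw [hδ]
    have : 2 * (η / (2 * (I + 1))) * I = η * (I / (I + 1)) := by field_simp
    rw [this]
    have : I / (I + 1) ≤ 1 := by rw [div_le_one (by linarith)]; linarith
    nlinarith
  linarith

end Barrier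

/-! ### `C¹` test functions -/

/-- Compactly supported nonnegative `C¹` functions can be approximated in `C¹` by smooth
nonnegative functions supported in a slightly larger compact set. -/
theorem exists_contDiff_approx_of_hasCompactSupport {E : Type*} [NormedAddCommGroup E]
    [NormedSpace ℝ E] [FiniteDimensional ℝ E] {ζ : E → ℝ} {O : Set E} (hO : IsOpen O)
    (hζ : ContDiff ℝ 1 ζ) (hc : HasCompactSupport ζ) (hsub : tsupport ζ ⊆ O)
    (hζ0 : ∀ q, 0 ≤ ζ q) :
    ∃ K : Set E, IsCompact K ∧ K ⊆ O ∧ tsupport ζ ⊆ K ∧ ∀ η : ℝ, 0 < η → ∃ ψ : E → ℝ,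
      ContDiff ℝ (⊤ : ℕ∞) ψ ∧ (∀ q, 0 ≤ ψ q) ∧ tsupport ψ ⊆ K ∧ (∀ q, |ψ q - ζ q| ≤ η) ∧
      ∀ q, ‖fderiv ℝ ψ q - fderiv ℝ ζ q‖ ≤ η := by
  let _ : MeasurableSpace E := borel E
  have : BorelSpace E := ⟨rfl⟩
  have : ProperSpace E := FiniteDimensional.proper ℝ E
  let μ : Measure E := Measure.addHaar
  obtain ⟨r, hr, hrO⟩ := hc.isCompact.exists_cthickening_subset_open hO hsub
  refine ⟨Metric.cthickening r (tsupport ζ), hc.isCompact.cthickening, hrO,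
    Metric.self_subset_cthickening _, fun η hη => ?_⟩
  have hu1 : UniformContinuous ζ := hc.uniformContinuous_of_continuous hζ.continuous
  have hu2 : UniformContinuous (fderiv ℝ ζ) :=
    (hc.fderiv (𝕜 := ℝ)).uniformContinuous_of_continuous (hζ.continuous_fderiv one_ne_zero)
  obtain ⟨d1, hd1, h1⟩ := Metric.uniformContinuous_iff.1 hu1 η hη
  obtain ⟨d2, hd2, h2⟩ := Metric.uniformContinuous_iff.1 hu2 η hη
  -- The mollification radius: `r` keeps the support in the thickening, and `d1`, `d2` are moduli of
  -- continuity of `ζ` and of its derivative.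
  set d := min r (min d1 d2) with hd
  have hd0 : 0 < d := lt_min hr (lt_min hd1 hd2)
  let b : ContDiffBump (0 : E) := ⟨d / 2, d, by positivity, by linarith⟩
  have hbn : ContDiff ℝ (⊤ : ℕ∞) (b.normed μ) := b.contDiff_normed
  have hbc : HasCompactSupport (b.normed μ) := b.hasCompactSupport_normed
  set ψ : E → ℝ := convolution (b.normed μ) ζ (ContinuousLinearMap.lsmul ℝ ℝ) μ with hψ
  have hfd : ∀ q, fderiv ℝ ψ q =
      convolution (b.normed μ) (fderiv ℝ ζ) (ContinuousLinearMap.lsmul ℝ ℝ) μ q := by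
    intro q
    have h3 := hc.hasFDerivAt_convolution_right (μ := μ) (ContinuousLinearMap.lsmul ℝ ℝ)
      (hbn.continuous.locallyIntegrable (μ := μ)) hζ q
    rw [hψ, h3.fderiv]
    unfold convolution
    refine integral_congr_ae (Eventually.of_forall fun t => ?_)
    ext v
    simp [ContinuousLinearMap.precompR_apply]
  refine ⟨ψ, hbc.contDiff_convolution_left _ hbn (hζ.continuous.locallyIntegrable), fun q => ?_,
    ?_, fun q => ?_, fun q => ?_⟩
  · refine integral_nonneg fun t => ?_
    simp only [ContinuousLinearMap.lsmul_apply, smul_eq_mul, Pi.zero_apply]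
    exact mul_nonneg (b.nonneg_normed t) (hζ0 _)
  · refine closure_minimal ?_ Metric.isClosed_cthickening
    refine (support_convolution_subset _).trans ?_
    rintro x ⟨y, hy, z, hz, rfl⟩
    rw [b.support_normed_eq] at hy
    refine Metric.mem_cthickening_of_dist_le (y + z) z r _ (subset_tsupport ζ hz) ?_
    have hy' : ‖y‖ < d := by simpa using hy
    simp only [dist_eq_norm, add_sub_cancel_right]
    exact hy'.le.trans (min_le_left _ _)
  · rw [← Real.dist_eq]
    refine b.dist_normed_convolution_le hζ.continuous.aestronglyMeasurable fun x hx => ?_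
    exact (h1 (lt_of_lt_of_le (Metric.mem_ball.1 hx)
      ((min_le_right _ _).trans (min_le_left _ _)))).le
  · rw [← dist_eq_norm, hfd]
    refine b.dist_normed_convolution_le
      (hζ.continuous_fderiv one_ne_zero).aestronglyMeasurable fun x hx => ?_
    exact (h2 (lt_of_lt_of_le (Metric.mem_ball.1 hx)
      ((min_le_right _ _).trans (min_le_right _ _)))).le

/-- For positive arguments this is (G) at scale `1`. At the origin, scale `0` gives `g 0 ≤ 0`,
because `τ + 1 > 0`. -/
theorem CondG.exists_le {φ g : ℝ → ℝ} {τ : ℝ} (hg : CondG φ g τ) (hτ : 0 ≤ τ) :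
    ∃ C : ℝ, 0 < C ∧ ∀ s, 0 ≤ s → g s ≤ C * s ^ 2 * deriv φ s := by
  obtain ⟨C, hC, h⟩ := hg.bound
  refine ⟨C, hC, fun s hs => ?_⟩
  rcases hs.eq_or_lt with rfl | hs
  · have := h 0 le_rfl zero_le_one 1 one_pos
    rw [Real.zero_rpow (by linarith)] at this
    simpa using this
  · simpa using h 1 zero_le_one le_rfl s hs

theorem CondG.measurable_comp {φ g : ℝ → ℝ} {τ : ℝ} (hg : CondG φ g τ) {X : Type*}
    [MeasurableSpace X] {s : X → ℝ} (hs : Measurable s) (hs0 : ∀ x, 0 ≤ s x) :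
    Measurable fun x => g (s x) :=
  hg.measurable.comp (hs.subtype_mk (h := hs0))

/-- A weak solution may be tested with `C¹` functions supported where the solution is positive,
and `g` may be replaced by a continuous majorant. -/
theorem IsWeakSolution.le_of_contDiff_one {m : ℕ} {φ f h g : ℝ → ℝ} {τ C D : ℝ}
    {u : Point m → ℝ} (hsol : IsWeakSolution φ f h g u) (hφ : CondPhi φ) (hf : CondF f)
    (hh : CondH h) (hg : CondG φ g τ)
    (hD : ∀ s : ℝ, 0 ≤ s → s ≤ 1 → ∀ t : ℝ, 0 < t → s * deriv φ (s * t) ≤ D * deriv φ t)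
    (hgC : ∀ s, 0 ≤ s → g s ≤ C * s ^ 2 * deriv φ s) (hu : ContDiff ℝ 1 u)
    {ζ : Point m → ℝ} (hζ : ContDiff ℝ 1 ζ) (hc : HasCompactSupport ζ)
    (hsub : tsupport ζ ⊆ {q | 0 < u q}) (hζ0 : ∀ q, 0 ≤ ζ q) :
    ∫ q, (f (u q) - h (u q) * (C * ‖hgrad u q‖ ^ 2 * deriv φ ‖hgrad u q‖)) * ζ q ≤
      -∫ q, inner ℝ (flux φ (hgrad u q)) (hgrad ζ q) := by
  have hO : IsOpen {q : Point m | 0 < u q} := isOpen_lt continuous_const hu.continuous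
  obtain ⟨Kc, hKc, hKO, hζK, happ⟩ := exists_contDiff_approx_of_hasCompactSupport hO hζ hc hsub hζ0
  have hVc : Continuous (hgrad u) :=
    continuousOn_univ.1 (continuousOn_hgrad isOpen_univ hu.contDiffOn)
  have hflc : Continuous fun q => flux φ (hgrad u q) := (continuous_flux hφ).comp hVc
  set E : Point m → ℝ := fun q =>
    f (u q) - h (u q) * (C * ‖hgrad u q‖ ^ 2 * deriv φ ‖hgrad u q‖) with hE
  have hhc : ContinuousOn (fun q => h (u q)) {q : Point m | 0 < u q} :=
    hh.continuousOn.comp hu.continuous.continuousOn fun q hq => hq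
  have hfc : ContinuousOn (fun q => f (u q)) {q : Point m | 0 < u q} :=
    hf.continuousOn.comp hu.continuous.continuousOn fun q hq => (show 0 < u q from hq).le
  have hgc : Continuous fun q => C * ‖hgrad u q‖ ^ 2 * deriv φ ‖hgrad u q‖ :=
    (continuousOn_sq_mul_deriv hφ hD C).comp_continuous hVc.norm fun q => norm_nonneg _
  have hEc : ContinuousOn E {q : Point m | 0 < u q} := hfc.sub (hhc.mul hgc.continuousOn)
  -- the inequality for smooth test functions
  have hsmooth : ∀ ψ : Point m → ℝ, ContDiff ℝ (⊤ : ℕ∞) ψ → (∀ q, 0 ≤ ψ q) →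
      tsupport ψ ⊆ Kc → (∫ q, E q * ψ q) ≤ -∫ q, inner ℝ (flux φ (hgrad u q)) (hgrad ψ q) := by
    intro ψ hψ hψ0 hψK
    have hψc : HasCompactSupport ψ := hKc.of_isClosed_subset (isClosed_tsupport _) hψK
    have hgm : Measurable fun q => g (gradNorm u q) := by
      simp only [gradNorm_eq_norm]
      exact hg.measurable_comp hVc.norm.measurable fun q => norm_nonneg _
    have hint0 : Integrable (fun q => f (u q) * ψ q) :=
      integrable_mul_of_tsupport_subset hO hfc hψ.continuous hψc (hψK.trans hKO)
    have hint1 : Integrable (fun q => h (u q) * (C * ‖hgrad u q‖ ^ 2 * deriv φ ‖hgrad u q‖) * ψ q) :=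
      integrable_mul_of_tsupport_subset hO (hhc.mul hgc.continuousOn) hψ.continuous hψc
        (hψK.trans hKO)
    have hhm : Measurable fun q => h (u q) * ψ q :=
      (continuous_mul_of_tsupport_subset hO hhc hψ.continuous (hψK.trans hKO)).measurable
    have hpt : ∀ q, 0 ≤ g (gradNorm u q) ∧
        g (gradNorm u q) ≤ C * ‖hgrad u q‖ ^ 2 * deriv φ ‖hgrad u q‖ := by
      intro q
      rw [gradNorm_eq_norm]
      exact ⟨hg.nonneg _ (norm_nonneg _), hgC _ (norm_nonneg _)⟩
    have hhψ : ∀ q, 0 ≤ h (u q) * ψ q := by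
      intro q
      by_cases hq : q ∈ tsupport ψ
      · exact mul_nonneg (hh.nonneg _ (hKO (hψK hq))) (hψ0 q)
      · simp [image_eq_zero_of_notMem_tsupport hq]
    have hint2 : Integrable (fun q => h (u q) * g (gradNorm u q) * ψ q) := by
      refine Integrable.mono' hint1 ?_ (Eventually.of_forall fun q => ?_)
      · refine ((hhm.mul hgm).aestronglyMeasurable).congr (Eventually.of_forall fun q => ?_)
        simp only [Pi.mul_apply]; ring
      · have e1 := mul_le_mul_of_nonneg_left (hpt q).2 (hhψ q)
        have e2 := mul_nonneg (hhψ q) (hpt q).1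
        rw [Real.norm_of_nonneg (by linarith)]
        linarith
    -- This integrability activates the weak inequality. It holds because `ψ` lives on a compact
    -- subset of `{u > 0}`, where `h(u)` is continuous even if `h` is singular at `0`.
    have hint3 : Integrable (fun q => (f (u q) - h (u q) * g (gradNorm u q)) * ψ q) := by
      refine (hint0.sub hint2).congr (Eventually.of_forall fun q => ?_)
      simp only [Pi.sub_apply]; ring
    have hint4 : Integrable (fun q => E q * ψ q) :=
      integrable_mul_of_tsupport_subset hO hEc hψ.continuous hψc (hψK.trans hKO)
    have key := hsol ψ hψ hψc hψ0 hint3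
    have heq : ∀ q, (gradNorm u q)⁻¹ * φ (gradNorm u q) * gradDot u ψ q =
        inner ℝ (flux φ (hgrad u q)) (hgrad ψ q) := fun q => by
      rw [gradNorm_eq_norm, gradDot_eq_inner, flux, real_inner_smul_left]
    simp only [heq] at key
    refine le_trans (integral_mono hint4 hint3 fun q => ?_) key
    have e1 := mul_le_mul_of_nonneg_left (hpt q).2 (hhψ q)
    simp only [hE]
    linarith
  -- passage to the limit
  set b : Point m → ℝ := fun q => |E q| + ∑ i, |flux φ (hgrad u q) i| * ‖frame i q‖ with hb
  have hbc : ContinuousOn b Kc := by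
    refine (hEc.mono hKO).abs.add (continuousOn_finsetSum _ fun i _ => ?_)
    exact ((((EuclideanSpace.proj (𝕜 := ℝ) i).continuous.comp hflc).abs).mul
      (continuous_frame i).norm).continuousOn
  have hbi : Integrable (Kc.indicator b) :=
    (integrable_indicator_iff hKc.measurableSet).2 (hbc.integrableOn_compact hKc)
  set I : ℝ := ∫ q, Kc.indicator b q with hI
  have hb0 : ∀ q, 0 ≤ b q := fun q =>
    add_nonneg (abs_nonneg _) (Finset.sum_nonneg fun i _ => by positivity)
  have hI0 : 0 ≤ I := integral_nonneg fun q => indicator_nonneg (fun q _ => hb0 q) q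
  have hintE : ∀ ψ : Point m → ℝ, ContDiff ℝ 1 ψ → tsupport ψ ⊆ Kc →
      Integrable (fun q => E q * ψ q) ∧
      Integrable (fun q => inner ℝ (flux φ (hgrad u q)) (hgrad ψ q)) := by
    intro ψ hψ hψK
    have hψc : HasCompactSupport ψ := hKc.of_isClosed_subset (isClosed_tsupport _) hψK
    exact ⟨integrable_mul_of_tsupport_subset hO hEc hψ.continuous hψc (hψK.trans hKO),
      integrable_inner_hgrad hO hflc.continuousOn hψ hψc (hψK.trans hKO)⟩
  refine le_of_forall_pos_le_add fun η hη => ?_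
  obtain ⟨ψ, hψ, hψ0, hψK, hψ1, hψ2⟩ := happ (η / (I + 1)) (by positivity)
  have key := hsmooth ψ hψ hψ0 hψK
  obtain ⟨i1, i2⟩ := hintE ζ hζ hζK
  obtain ⟨i3, i4⟩ := hintE ψ (hψ.of_le (by exact_mod_cast le_top)) hψK
  -- Both sides of the inequality are linear in the test function and its derivative, with
  -- coefficients collected in `b`; a `C¹` error of size `η / (I + 1)` on `Kc` therefore costs at
  -- most `η` after integration.
  have hpt : ∀ q, E q * ζ q + inner ℝ (flux φ (hgrad u q)) (hgrad ζ q) ≤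
      (E q * ψ q + inner ℝ (flux φ (hgrad u q)) (hgrad ψ q)) +
        η / (I + 1) * Kc.indicator b q := by
    intro q
    by_cases hq : q ∈ Kc
    · rw [indicator_of_mem hq, inner_hgrad_eq_sum, inner_hgrad_eq_sum, hb, mul_add, Finset.mul_sum,
        add_add_add_comm, ← Finset.sum_add_distrib]
      refine add_le_add ?_ (Finset.sum_le_sum fun i _ => ?_)
      · have e1 := mul_le_mul_of_nonneg_left (hψ1 q) (abs_nonneg (E q))
        rw [← abs_mul] at e1
        have := neg_abs_le (E q * (ψ q - ζ q))
        linarith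
      · have e0 : |fderiv ℝ ψ q (frame i q) - fderiv ℝ ζ q (frame i q)| ≤
            η / (I + 1) * ‖frame i q‖ := by
          have := (fderiv ℝ ψ q - fderiv ℝ ζ q).le_opNorm (frame i q)
          rw [sub_apply, Real.norm_eq_abs] at this
          exact this.trans (mul_le_mul_of_nonneg_right (hψ2 q) (norm_nonneg _))
        have e1 := mul_le_mul_of_nonneg_left e0 (abs_nonneg (flux φ (hgrad u q) i))
        rw [← abs_mul] at e1
        have := neg_abs_le (flux φ (hgrad u q) i *
          (fderiv ℝ ψ q (frame i q) - fderiv ℝ ζ q (frame i q)))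
        linarith
    · have hz : ∀ ψ : Point m → ℝ, tsupport ψ ⊆ Kc → ψ q = 0 ∧ hgrad ψ q = 0 := by
        intro ψ hψK
        refine ⟨image_eq_zero_of_notMem_tsupport fun h => hq (hψK h), ?_⟩
        ext i
        exact image_eq_zero_of_notMem_tsupport
          (f := fun q => fderiv ℝ ψ q (frame i q))
          fun h => hq (hψK (tsupport_fderiv_apply_subset' _ h))
      rw [indicator_of_notMem hq, (hz ζ hζK).1, (hz ζ hζK).2, (hz ψ hψK).1, (hz ψ hψK).2]
      simp
  have hle := integral_mono (i1.add i2) ((i3.add i4).add (hbi.const_mul (η / (I + 1)))) hpt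
  rw [integral_add' (i3.add i4) (hbi.const_mul _), integral_add' i1 i2, integral_add' i3 i4,
    integral_const_mul] at hle
  have hfin : η / (I + 1) * I ≤ η := by
    rw [div_mul_eq_mul_div, div_le_iff₀ (by linarith)]
    nlinarith
  linarith

/-! ### Comparison with the barrier -/

theorem isCompact_gauge_le {m : ℕ} (r : ℝ) : IsCompact {q : Point m | gauge q ≤ r} := by
  have hcl : IsClosed {q : Point m | gauge q ≤ r} :=
    isClosed_le continuous_gauge continuous_const
  refine Metric.isCompact_of_isClosed_isBounded hcl
    ((Metric.isBounded_closedBall (x := (0 : Point m)) (r := max r (r ^ 2))).subset fun q hq => ?_)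
  have hq : gauge q ≤ r := hq
  have h0 := gauge_nonneg q
  have hr : 0 ≤ r := h0.trans hq
  have hz : zSq q ≤ r ^ 2 := (zSq_le_gauge_sq q).trans (pow_le_pow_left₀ h0 hq 2)
  have hcoord : ∀ j, q.1 j ^ 2 + q.2.1 j ^ 2 ≤ r ^ 2 := fun j =>
    (Finset.single_le_sum (f := fun j => q.1 j ^ 2 + q.2.1 j ^ 2) (fun _ _ => by positivity)
      (Finset.mem_univ j)).trans hz
  have ht : q.2.2 ^ 2 ≤ (r ^ 2) ^ 2 := by
    have h1 : gauge q ^ 4 ≤ r ^ 4 := pow_le_pow_left₀ h0 hq 4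
    rw [gauge_pow_four, gaugeFour] at h1
    nlinarith [sq_nonneg (zSq q)]
  rw [mem_closedBall_zero_iff, norm_prod_le_iff, norm_prod_le_iff]
  refine ⟨?_, ?_, ?_⟩
  · refine (pi_norm_le_iff_of_nonneg (le_max_of_le_left hr)).2 fun j => le_max_of_le_left ?_
    exact abs_le_of_sq_le_sq (by linarith [hcoord j, sq_nonneg (q.2.1 j)]) hr
  · refine (pi_norm_le_iff_of_nonneg (le_max_of_le_left hr)).2 fun j => le_max_of_le_left ?_
    exact abs_le_of_sq_le_sq (by linarith [hcoord j, sq_nonneg (q.1 j)]) hr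
  · exact le_max_of_le_right (abs_le_of_sq_le_sq ht (sq_nonneg r))

theorem hgrad_sub {m : ℕ} {u v : Point m → ℝ} {q : Point m} (hu : DifferentiableAt ℝ u q)
    (hv : DifferentiableAt ℝ v q) :
    hgrad (fun q => u q - v q) q = hgrad u q - hgrad v q := by
  ext i
  simp [hgrad_apply, fderiv_fun_sub hu hv]

/-- The truncation `((w - c)⁺)²` inside the gauge ball of radius `r`, extended by `0`. -/
noncomputable def cutoff {m : ℕ} (w : Point m → ℝ) (c r : ℝ) (q : Point m) : ℝ :=
  if gauge q < r then (max (w q - c) 0) ^ 2 else 0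

section Cutoff

variable {m : ℕ} {w : Point m → ℝ} {c r R : ℝ}

theorem cutoff_nonneg (w : Point m → ℝ) (c r : ℝ) (q : Point m) : 0 ≤ cutoff w c r q := by
  unfold cutoff; split_ifs <;> positivity

theorem cutoff_eventuallyEq {q : Point m} (hq : gauge q < r) :
    cutoff w c r =ᶠ[𝓝 q] fun q => (max (w q - c) 0) ^ 2 := by
  filter_upwards [(isOpen_gauge_lt r).mem_nhds hq] with y hy
  exact if_pos hy

theorem cutoff_eventuallyEq_zero (hw : ContDiffOn ℝ 1 w {q | gauge q < R}) (hrR : r < R)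
    (hneg : ∀ q, gauge q = r → w q < c) {q : Point m} (hq : r ≤ gauge q) :
    cutoff w c r =ᶠ[𝓝 q] fun _ => 0 := by
  rcases hq.eq_or_lt with h | h
  · have hcont : ContinuousAt w q :=
      hw.continuousOn.continuousAt ((isOpen_gauge_lt R).mem_nhds (show gauge q < R by rwa [← h]))
    filter_upwards [hcont.eventually_lt_const (hneg q h.symm)] with y hy
    unfold cutoff
    split_ifs
    · rw [max_eq_right (by linarith)]; norm_num
    · rfl
  · filter_upwards [(isOpen_lt continuous_const continuous_gauge).mem_nhds h] with y hy
    exact if_neg (not_lt.2 (le_of_lt hy))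

/-- The square makes the positive part `C¹`. Since `w < c` on the sphere `gauge = r`, the function
already vanishes near it, and the extension by zero creates no jump. -/
theorem contDiff_cutoff (hw : ContDiffOn ℝ 1 w {q | gauge q < R}) (hrR : r < R)
    (hneg : ∀ q, gauge q = r → w q < c) : ContDiff ℝ 1 (cutoff w c r) := by
  rw [contDiff_iff_contDiffAt]
  intro q
  rcases lt_or_ge (gauge q) r with h | h
  · refine ContDiffAt.congr_of_eventuallyEq ?_ (cutoff_eventuallyEq h)
    exact contDiff_max_zero_sq.contDiffAt.comp q
      ((hw.contDiffAt ((isOpen_gauge_lt R).mem_nhds (h.trans hrR))).sub contDiffAt_const)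
  · exact contDiffAt_const.congr_of_eventuallyEq (cutoff_eventuallyEq_zero hw hrR hneg h)

theorem hgrad_cutoff (hw : ContDiffOn ℝ 1 w {q | gauge q < R}) (hrR : r < R) {q : Point m}
    (hq : gauge q < r) : hgrad (cutoff w c r) q = (2 * max (w q - c) 0) • hgrad w q := by
  have hwd : DifferentiableAt ℝ w q :=
    (hw.contDiffAt ((isOpen_gauge_lt R).mem_nhds (hq.trans hrR))).differentiableAt one_ne_zero
  have hd : HasFDerivAt (fun q => (max (w q - c) 0) ^ 2) _ q :=
    HasDerivAt.comp_hasFDerivAt q (f := fun q => w q - c) (hasDerivAt_max_zero_sq (w q - c))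
      (hwd.hasFDerivAt.sub_const c)
  ext i
  rw [hgrad_apply, (cutoff_eventuallyEq hq).fderiv_eq, hd.fderiv]
  simp [hgrad_apply]

theorem hgrad_cutoff_eq_zero (hw : ContDiffOn ℝ 1 w {q | gauge q < R}) (hrR : r < R)
    (hneg : ∀ q, gauge q = r → w q < c) {q : Point m} (hq : r ≤ gauge q) :
    hgrad (cutoff w c r) q = 0 := by
  ext i
  rw [hgrad_apply, (cutoff_eventuallyEq_zero hw hrR hneg hq).fderiv_eq]
  simp

theorem isCompact_superlevel (hw : ContDiffOn ℝ 1 w {q | gauge q < R}) (hrR : r < R) (c : ℝ) :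
    IsCompact {q | gauge q ≤ r ∧ c ≤ w q} := by
  have hcont : ContinuousOn w {q : Point m | gauge q ≤ r} :=
    hw.continuousOn.mono fun q hq => lt_of_le_of_lt hq hrR
  exact (isCompact_gauge_le r).of_isClosed_subset
    (hcont.preimage_isClosed_of_isClosed (isCompact_gauge_le r).isClosed isClosed_Ici)
    fun q hq => hq.1

theorem tsupport_cutoff_subset (hw : ContDiffOn ℝ 1 w {q | gauge q < R}) (hrR : r < R) :
    tsupport (cutoff w c r) ⊆ {q | gauge q ≤ r ∧ c ≤ w q} := by
  refine closure_minimal (fun q hq => ?_) (isCompact_superlevel hw hrR c).isClosed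
  rw [Function.mem_support, cutoff] at hq
  split_ifs at hq with h
  · refine ⟨h.le, ?_⟩
    by_contra hcw
    rw [max_eq_right (by linarith)] at hq
    norm_num at hq
  · exact absurd rfl hq

end Cutoff

/-- A superlevel set of `w` on which `e` is positive, provided that `e` is positive at the maxima
of `w`. -/
theorem exists_superlevel_pos {X : Type*} [TopologicalSpace X] [T2Space X] {B : Set X}
    {w e : X → ℝ} {x : X} (hB : IsCompact {q | q ∈ B ∧ 0 ≤ w q})
    (hw : ContinuousOn w {q | q ∈ B ∧ 0 ≤ w q}) (he : ContinuousOn e {q | q ∈ B ∧ 0 ≤ w q})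
    (hpos : 0 < w x) (hmax : ∀ q ∈ B, w q ≤ w x) (hep : ∀ q ∈ B, w q = w x → 0 < e q) :
    ∃ c, 0 ≤ c ∧ c < w x ∧ ∀ q ∈ B, c < w q → 0 < e q := by
  -- The bad set, where `e ≤ 0`, is compact. The level `c` is the maximum of `w` over it, or `0` if
  -- it is empty; the bad set contains no maximum point of `w`, so `c < w x`.
  have hZ : IsCompact ({q | q ∈ B ∧ 0 ≤ w q} ∩ e ⁻¹' Iic 0) :=
    hB.of_isClosed_subset (he.preimage_isClosed_of_isClosed hB.isClosed isClosed_Iic)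
      inter_subset_left
  rcases ({q | q ∈ B ∧ 0 ≤ w q} ∩ e ⁻¹' Iic 0).eq_empty_or_nonempty with hne | hne
  · refine ⟨0, le_rfl, hpos, fun q hq hwq => ?_⟩
    by_contra h
    have : q ∈ {q | q ∈ B ∧ 0 ≤ w q} ∩ e ⁻¹' Iic 0 := ⟨⟨hq, hwq.le⟩, not_lt.1 h⟩
    rw [hne] at this
    exact this
  · obtain ⟨z, hz, hzmax⟩ := hZ.exists_isMaxOn hne (hw.mono inter_subset_left)
    refine ⟨w z, hz.1.2, lt_of_le_of_ne (hmax z hz.1.1) fun h => ?_, fun q hq hwq => ?_⟩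
    · exact absurd (hep z hz.1.1 h) (not_lt.2 hz.2)
    · by_contra h
      have : q ∈ {q | q ∈ B ∧ 0 ≤ w q} ∩ e ⁻¹' Iic 0 :=
        ⟨⟨hq, hz.1.2.trans hwq.le⟩, not_lt.1 h⟩
      exact absurd (hzmax this) (not_le.2 hwq)

/-- A weak subsolution lies below every barrier that exceeds it on some gauge sphere. -/
theorem IsProfile.le_of_isWeakSolution {φ f h g : ℝ → ℝ} {τ ε κ R C D : ℝ} {α p p' : ℝ → ℝ}
    {m : ℕ} (hP : IsProfile φ f h ε κ R α p p') (hφ : CondPhi φ) (hf : CondF f) (hh : CondH h)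
    (hg : CondG φ g τ)
    (hD : ∀ s : ℝ, 0 ≤ s → s ≤ 1 → ∀ t : ℝ, 0 < t → s * deriv φ (s * t) ≤ D * deriv φ t)
    (hD0 : 0 < D) (hC : 0 < C) (hgC : ∀ s, 0 ≤ s → g s ≤ C * s ^ 2 * deriv φ s) (hκ : 0 < κ)
    (hκ' : (D + (2 * m + 1) + C * D) * κ ≤ 1 / 2) {u : Point m → ℝ} (hu : ContDiff ℝ 1 u)
    (hsol : IsWeakSolution φ f h g u) {r : ℝ} (hrR : r < R)
    (hbd : ∀ q, gauge q = r → u q < α r) {q₀ : Point m} (hq₀ : gauge q₀ ≤ r) :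
    u q₀ ≤ α (gauge q₀) := by
  by_contra hlt
  rw [not_le] at hlt
  set v : Point m → ℝ := fun q => α (gauge q) with hv
  set w : Point m → ℝ := fun q => u q - v q with hw
  have hU : IsOpen {q : Point m | gauge q < R} := isOpen_gauge_lt R
  have hBU : ∀ q : Point m, gauge q ≤ r → gauge q < R := fun q hq => lt_of_le_of_lt hq hrR
  have hvd : ContDiffOn ℝ 1 v {q : Point m | gauge q < R} := hP.contDiffOn
  have hwd : ContDiffOn ℝ 1 w {q : Point m | gauge q < R} := hu.contDiffOn.sub hvd
  have hvε : ∀ q : Point m, gauge q < R → ε ≤ v q := fun q hq => hP.eps_le hq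
  have hVu : Continuous (hgrad u) :=
    continuousOn_univ.1 (continuousOn_hgrad isOpen_univ hu.contDiffOn)
  have hVv : ContinuousOn (hgrad v) {q : Point m | gauge q < R} := continuousOn_hgrad hU hvd
  have hO : IsOpen {q : Point m | gauge q < R ∧ 0 < u q} :=
    hU.inter (isOpen_lt continuous_const hu.continuous)
  -- the difference of the two right-hand sides
  set eu : Point m → ℝ := fun q =>
    f (u q) - h (u q) * (C * ‖hgrad u q‖ ^ 2 * deriv φ ‖hgrad u q‖) with heu
  set ev : Point m → ℝ := fun q =>
    1 / 2 * f (v q) - h (v q) * (C * ‖hgrad v q‖ ^ 2 * deriv φ ‖hgrad v q‖) with hev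
  have hevc : ContinuousOn ev {q : Point m | gauge q < R} :=
    hP.continuousOn_source hφ hf hh hD C
  have heuc : ContinuousOn eu {q : Point m | gauge q < R ∧ 0 < u q} := by
    refine ContinuousOn.sub (hf.continuousOn.comp hu.continuous.continuousOn fun q hq =>
      (show 0 < u q from hq.2).le) ((hh.continuousOn.comp hu.continuous.continuousOn
        fun q hq => hq.2).mul ?_)
    exact ((continuousOn_sq_mul_deriv hφ hD C).comp_continuous hVu.norm
      fun q => norm_nonneg _).continuousOn
  have hec : ContinuousOn (fun q => eu q - ev q) {q : Point m | gauge q < R ∧ 0 < u q} :=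
    heuc.sub (hevc.mono fun q hq => hq.1)
  have hsubO : ∀ c, 0 ≤ c → {q : Point m | gauge q ≤ r ∧ c ≤ w q} ⊆
      {q : Point m | gauge q < R ∧ 0 < u q} := by
    intro c hc0 q hq
    have h1 := hvε q (hBU q hq.1)
    have h2 : c ≤ u q - v q := hq.2
    exact ⟨hBU q hq.1, by linarith [hP.eps_pos]⟩
  -- the maximum of `u - v`
  obtain ⟨x, hxB, hxmax⟩ := (isCompact_gauge_le (m := m) r).exists_isMaxOn ⟨q₀, hq₀⟩
    (hwd.continuousOn.mono fun q hq => hBU q hq)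
  have hxpos : 0 < w x := lt_of_lt_of_le (sub_pos.2 hlt) (hxmax hq₀)
  have hneg : ∀ q : Point m, gauge q = r → w q < 0 := fun q hq => by
    have := hbd q hq
    simp only [hw, hv, hq]; linarith
  -- At a maximum the gradients coincide, so the gradient terms differ only through `h(u) ≤ h(v)`.
  -- With `f(u) ≥ f(v)`, the factor `½` in the source of the barrier leaves the strict gain `½
  -- f(v)`.
  have hemax : ∀ q ∈ {q : Point m | gauge q ≤ r}, w q = w x → 0 < eu q - ev q := by
    intro q hq hqx
    have hqr : gauge q < r := lt_of_le_of_ne hq fun h => by linarith [hneg q h]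
    have hloc : IsLocalMax w q := by
      filter_upwards [(isOpen_gauge_lt r).mem_nhds hqr] with y hy
      rw [hqx]; exact hxmax (le_of_lt hy)
    have hvq := hvε q (hBU q hq)
    have hvpos : 0 < v q := hP.eps_pos.trans_le hvq
    have huv : v q < u q := by
      have : 0 < u q - v q := by rw [← hqx] at hxpos; exact hxpos
      linarith
    have hgradeq : hgrad u q = hgrad v q := by
      have h1 : hgrad w q = 0 := by
        ext i; rw [hgrad_apply, hloc.fderiv_eq_zero]; simp
      rw [hw, hgrad_sub (hu.differentiable one_ne_zero q)
        ((hvd.contDiffAt (hU.mem_nhds (hBU q hq))).differentiableAt one_ne_zero)] at h1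
      exact sub_eq_zero.1 h1
    have h1 : f (v q) ≤ f (u q) := hf.monotoneOn hvpos.le (hvpos.trans huv).le huv.le
    have h2 : h (u q) ≤ h (v q) := hh.antitoneOn hvpos (hvpos.trans huv) huv.le
    have h3 : 0 ≤ C * ‖hgrad v q‖ ^ 2 * deriv φ ‖hgrad v q‖ :=
      (hg.nonneg _ (norm_nonneg _)).trans (hgC _ (norm_nonneg _))
    have h4 := mul_le_mul_of_nonneg_right h2 h3
    have h5 := hf.pos _ hvpos
    simp only [heu, hev, hgradeq]
    linarith
  obtain ⟨c, hc0, hcx, hce⟩ := exists_superlevel_pos (B := {q : Point m | gauge q ≤ r})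
    (isCompact_superlevel hwd hrR 0) (hwd.continuousOn.mono fun q hq => hBU q hq.1)
    (hec.mono (hsubO 0 le_rfl)) hxpos (fun q hq => hxmax hq) hemax
  -- the test function
  have hnegc : ∀ q : Point m, gauge q = r → w q < c := fun q hq => (hneg q hq).trans_le hc0
  set ζ : Point m → ℝ := cutoff w c r with hζdef
  have hζ : ContDiff ℝ 1 ζ := contDiff_cutoff hwd hrR hnegc
  have hζs := tsupport_cutoff_subset (c := c) hwd hrR
  have hζc : HasCompactSupport ζ :=
    (isCompact_superlevel hwd hrR c).of_isClosed_subset (isClosed_tsupport _) hζs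
  have hζ0 : ∀ q, 0 ≤ ζ q := cutoff_nonneg w c r
  have hζO := hζs.trans (hsubO c hc0)
  have hsubU : tsupport ζ ⊆ {q | gauge q < R} := fun q hq => (hζO hq).1
  have hsub := hsol.le_of_contDiff_one hφ hf hh hg hD hgC hu hζ hζc (fun q hq => (hζO hq).2) hζ0
  have hsup := hP.supersolution hφ hf hh hD hD0 hC hκ hκ' hζ hζc hsubU hζ0
  have hi1 : Integrable (fun q => eu q * ζ q) :=
    integrable_mul_of_tsupport_subset hO heuc hζ.continuous hζc hζO
  have hi2 : Integrable (fun q => ev q * ζ q) :=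
    integrable_mul_of_tsupport_subset hU hevc hζ.continuous hζc hsubU
  have hi3 := integrable_inner_hgrad isOpen_univ
    (((continuous_flux hφ).comp hVu).continuousOn) hζ hζc (subset_univ _)
  have hi4 := integrable_inner_hgrad hU ((continuous_flux hφ).comp_continuousOn hVv) hζ hζc hsubU
  -- Inside the ball `∇ζ = 2 (w - c)⁺ (∇u - ∇v)`, so the integrand is nonnegative by monotonicity of
  -- the flux; outside, `∇ζ = 0`.
  have hmono : 0 ≤ ∫ q, (inner ℝ (flux φ (hgrad u q)) (hgrad ζ q) -
      inner ℝ (flux φ (hgrad v q)) (hgrad ζ q)) := by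
    refine integral_nonneg fun q => ?_
    simp only [Pi.zero_apply, ← inner_sub_left]
    rcases lt_or_ge (gauge q) r with hq | hq
    · rw [hζdef, hgrad_cutoff hwd hrR hq, hw, hgrad_sub (hu.differentiable one_ne_zero q)
        ((hvd.contDiffAt (hU.mem_nhds (hBU q hq.le))).differentiableAt one_ne_zero),
        real_inner_smul_right]
      exact mul_nonneg (mul_nonneg two_pos.le (le_max_right _ _)) (inner_flux_sub_nonneg hφ _ _)
    · rw [hζdef, hgrad_cutoff_eq_zero hwd hrR hnegc hq, inner_zero_right]
  -- The integrand is nonnegative because `ζ` vanishes off the superlevel set `w > c`, and it is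
  -- nonzero at the maximum point `x`. The two weak inequalities and `hmono` force this integral to
  -- be `≤ 0`.
  have hpos : 0 < ∫ q, (eu q - ev q) * ζ q := by
    refine Continuous.integral_pos_of_hasCompactSupport_nonneg_nonzero (x := x)
      (continuous_mul_of_tsupport_subset hO hec hζ.continuous hζO) hζc.mul_left (fun q => ?_) ?_
    · rcases lt_or_ge (gauge q) r with hq | hq
      · rcases lt_or_ge c (w q) with hwq | hwq
        · exact mul_nonneg (hce q hq.le hwq).le (hζ0 q)
        · have : ζ q = 0 := by
            rw [hζdef, cutoff, if_pos hq, max_eq_right (by linarith)]; norm_num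
          simp [this]
      · have : ζ q = 0 := if_neg (not_lt.2 hq)
        simp [this]
    · have hxr : gauge x < r := lt_of_le_of_ne hxB fun h => by linarith [hneg x h]
      have : ζ x = (w x - c) ^ 2 := by
        rw [hζdef, cutoff, if_pos hxr, max_eq_left (by linarith)]
      rw [this]
      exact mul_ne_zero (hce x hxB hcx).ne' (by have : 0 < w x - c := by linarith
                                                positivity)
  have hsplit : ∫ q, (eu q - ev q) * ζ q = (∫ q, eu q * ζ q) - ∫ q, ev q * ζ q := by
    rw [← integral_sub hi1 hi2]
    simp only [sub_mul]
  simp only [Function.comp] at hi3 hi4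
  rw [integral_sub hi3 hi4] at hmono
  have hsub' : ∫ q, eu q * ζ q ≤ -∫ q, inner ℝ (flux φ (hgrad u q)) (hgrad ζ q) := hsub
  have hsup' : -∫ q, inner ℝ (flux φ (hgrad v q)) (hgrad ζ q) ≤ ∫ q, ev q * ζ q := hsup
  linarith

end Heisenberg

/-! ### The Liouville theorem. -/

theorem mainTheorem4 (m : ℕ) (φ f h g : ℝ → ℝ) (τ θ : ℝ)
    (hφ : Heisenberg.CondPhi φ) (hf : Heisenberg.CondF f) (hh : Heisenberg.CondH h)
    (hg : Heisenberg.CondG φ g τ)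
    (hφ0 : Heisenberg.CondPhi0 φ) (hφ2 : Heisenberg.CondPhi2 φ τ)
    (hφ3 : Heisenberg.CondPhi3 φ θ)
    (hKO : Heisenberg.KellerOsserman φ f h θ)
    (u : Heisenberg.Point m → ℝ) (hu : ContDiff ℝ 1 u) (hu0 : ∀ q, 0 ≤ u q)
    (hsol : Heisenberg.IsWeakSolution φ f h g u) :
    ∀ q, u q = 0 := by
  intro q₀
  by_contra hne
  have hpos : 0 < u q₀ := lt_of_le_of_ne (hu0 q₀) (Ne.symm hne)
  obtain ⟨C, hC, hgC⟩ := hg.exists_le hφ2.1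
  -- Only the consequence of (Φ2) obtained from `s^τ ≤ 1` is needed for the comparison.
  obtain ⟨D, hD0, hD⟩ : ∃ D : ℝ, 0 < D ∧ ∀ s : ℝ, 0 ≤ s → s ≤ 1 → ∀ t : ℝ, 0 < t →
      s * deriv φ (s * t) ≤ D * deriv φ t := by
    obtain ⟨hτ, D, hD0, hD⟩ := hφ2
    refine ⟨D, hD0, fun s hs hs1 t ht => (hD s hs hs1 t ht).trans ?_⟩
    have h1 := hφ.deriv_pos t ht
    have h2 : s ^ τ ≤ 1 := Real.rpow_le_one hs hs1 hτ
    exact mul_le_mul_of_nonneg_right (mul_le_of_le_one_right hD0.le h2) h1.le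
  have hden : 0 < D + (2 * (m : ℝ) + 1) + C * D := by positivity
  have hκ : 0 < 1 / 2 / (D + (2 * (m : ℝ) + 1) + C * D) := by positivity
  -- The profile starts at half the value `u q₀` and is still below `u q₀` at the gauge of `q₀`. The
  -- value of `κ` is the largest allowed by the smallness condition of the supersolution.
  obtain ⟨R, α, p, p', hR1, -, hle, hαd, hpc, hp'c, hαη, hαM, hineq⟩ :=
    Heisenberg.exists_profile (ε := u q₀ / 2) (η := u q₀) (ρ := Heisenberg.gauge q₀)
      hφ hf hh hφ0 hφ2 hφ3 hKO (by linarith) hκ (by linarith)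
  have hP : Heisenberg.IsProfile φ f h (u q₀ / 2) _ R α p p' :=
    ⟨by linarith, hR1, hle, hαd, hpc, hp'c, hineq⟩
  -- `u` is bounded on the closed gauge ball of radius `R` while `α` blows up at `R`, so the barrier
  -- exceeds `u` on some sphere of radius `r < R` enclosing `q₀`.
  obtain ⟨M, hM⟩ := (Heisenberg.isCompact_gauge_le (m := m) R).bddAbove_image
    hu.continuous.continuousOn
  obtain ⟨r, -, hρr, hrR, hMr⟩ := hαM M
  have := hP.le_of_isWeakSolution hφ hf hh hg hD hD0 hC hgC hκ
    (mul_div_cancel₀ _ hden.ne').le hu hsol hrR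
    (fun q hq => lt_of_le_of_lt (hM ⟨q, show Heisenberg.gauge q ≤ R by rw [hq]; exact hrR.le, rfl⟩) hMr)
    hρr.le
  linarith
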